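/- All manifolds are smooth, finite-dimensional, Hausdorff and second countable. A Poisson manifold $(Z,\varpi)$ has bracket $\{f,g\}=\varpi(df,dg)$; $\varpi^\sharp:T^*Z\to TZ$ is given by $\alpha(\varpi^\sharp\beta)=\varpi(\alpha,\beta)$, and 1-forms on $Z$ carry the bracket $\{\alpha,\beta\}=i_{\varpi^\sharp\beta}d\alpha-i_{\varpi^\sharp\alpha}d\beta+d(\varpi(\alpha,\beta))$, for which $\{df,dg\}=d\{f,g\}$. *Sternberg–Weinstein approximation.* Let $X$ be an embedded Lagrangian submanifold of a symplectic leaf of $(Z,\varpi)$ (if $X$ is disconnected, each component is allowed to lie in its own leaf). Then $E_X=(TX)^0\subset T^*Z|_X$ is a Lie algebroid over $X$ with anchor $-\varpi^\sharp|_{E_X}:E_X\to TX$ and bracket $\{\alpha|_X,\beta|_X\}=\{\alpha,\beta\}|_X$ (for 1-forms $\alpha,\beta$ whose restrictions to $X$ take values in $E_X$). The Sternberg–Weinstein approximation of $Z$ at $X$ is the manifold $E_X^*=TZ|_X/TX\stackrel{\tau}{\to}X$ with the unique Poisson bracket $\{\cdot,\cdot\}'$ such that, for $h,k\in C^\infty(X)$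 and for sections $\alpha,\beta$ of $E_X$ with corresponding fibrewise linear functions $\bar\alpha,\bar\beta$ on $E_X^*$, $$\{\tau^*h,\tau^*k\}'=0,\qquad \{\bar\alpha,\tau^*h\}'=\tau^*\big((-\varpi^\sharp\alpha)\cdot h\big),\qquad \{\bar\alpha,\bar\beta\}'=\overline{\{\alpha,\beta\}}.$$ *Statement.* Let $p:P\to B$ be a smooth principal fibre bundle with structure group a Lie group $G$ acting on $P$ from the right. Let $G$ act on $T^*P$ by the cotangent lift, and suppose that $T^*P/G$ is a manifold such that the projection $\rho:T^*P\to T^*P/G$ is a submersion. Then there is a unique Poisson structure $\varpi$ on $T^*P/G$ for which $\rho$ is a Poisson map, where $T^*P$ carries its canonical Poisson structure ($\{x^\mu,p_\nu\}=\delta^\mu_\nu$); $(T^*P/G,\varpi)$ is the Sternberg–Weinstein phase space. The map $i:B\to T^*P/G$, $i(p(y))=\rho(0_y)$ (the zero section of $T^*B\subset T^*P/G$), is well defined and smooth, and it embeds $B$ as a Lagrangian submanifold of a symplectic leaf (in the above sense). The Sternberg–Weinstein approximation of $(T^*P/G,\varpi)$ at $B$ exists, and the natural map $$\Phi:T^*P/G\longrightarrow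 T(T^*P/G)|_B/TB,\qquad \Phi(\rho(\alpha))=\Big[\tfrac{d}{dt}\Big|_{t=0}\rho(t\alpha)\Big]\in T_{i(p(y))}(T^*P/G)/T_{p(y)}B\qquad(\alpha\in T_y^*P),$$ is a well-defined diffeomorphism which is a Poisson isomorphism from $(T^*P/G,\varpi)$ onto its Sternberg–Weinstein approximation at $B$. -/

import Mathlib

open scoped Manifold ContDiff Bundle Topology

noncomputable section

namespace SternbergWeinstein

/-! ### Poisson structures -/

section Poisson

variable {E : Type*} [NormedAddCommGroup E] [NormedSpace ℝ E]
  {H : Type*} [TopologicalSpace H] (I : ModelWithCorners ℝ E H)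
  (M : Type*) [TopologicalSpace M] [ChartedSpace H M]
  {E' : Type*} [NormedAddCommGroup E'] [NormedSpace ℝ E']
  {H' : Type*} [TopologicalSpace H'] (I' : ModelWithCorners ℝ E' H')
  (M' : Type*) [TopologicalSpace M'] [ChartedSpace H' M']

/-- The cotangent space `T*_x M`. -/
abbrev Cotangent {M : Type*} [TopologicalSpace M] [ChartedSpace H M] (x : M) : Type _ :=
  TangentSpace I x →L[ℝ] ℝ

variable {M} in
/-- The differential `d_x f ∈ T*_x M` of a real function. -/
def diff (f : M → ℝ) (x : M) : Cotangent I x := mfderiv I 𝓘(ℝ, ℝ) f x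

/-- A (not necessarily smooth) field of bilinear forms on the cotangent spaces of `M`. -/
abbrev BilinField : Type _ :=
  ∀ x : M, Cotangent I x →ₗ[ℝ] Cotangent I x →ₗ[ℝ] ℝ

variable {M I} in
/-- The bracket of functions `{f, g} = w(df, dg)`. -/
def bracket (w : BilinField I M) (f g : M → ℝ) : M → ℝ :=
  fun x => w x (diff I f x) (diff I g x)

/-- A Poisson structure on `M`: a bivector field `w` such that `{f, g} = w(df, dg)` is a
Lie bracket on `C^∞(M)`.  (The Leibniz rule is automatic.) -/
structure PoissonStructure where
  /-- the Poisson tensor -/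
  tensor : BilinField I M
  skew : ∀ (x : M) (α β : Cotangent I x), tensor x α β = - tensor x β α
  smooth : ∀ f g : M → ℝ, ContMDiff I 𝓘(ℝ, ℝ) ∞ f → ContMDiff I 𝓘(ℝ, ℝ) ∞ g →
    ContMDiff I 𝓘(ℝ, ℝ) ∞ (bracket tensor f g)
  jacobi : ∀ f g h : M → ℝ, ContMDiff I 𝓘(ℝ, ℝ) ∞ f → ContMDiff I 𝓘(ℝ, ℝ) ∞ g →
    ContMDiff I 𝓘(ℝ, ℝ) ∞ h → ∀ x : M,
    bracket tensor f (bracket tensor g h) x + bracket tensor g (bracket tensor h f) x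
      + bracket tensor h (bracket tensor f g) x = 0

variable {I I' M M'} in
/-- `φ` is a Poisson map: it is smooth and `{φ^*f, φ^*g} = φ^*{f, g}` for all smooth `f, g`. -/
def IsPoissonMap (w : BilinField I M) (w' : BilinField I' M') (φ : M → M') : Prop :=
  ContMDiff I I' ∞ φ ∧
    ∀ f g : M' → ℝ, ContMDiff I' 𝓘(ℝ, ℝ) ∞ f → ContMDiff I' 𝓘(ℝ, ℝ) ∞ g →
      ∀ x : M, bracket w (f ∘ φ) (g ∘ φ) x = bracket w' f g (φ x)

variable {I I' M M'} in
/-- A submersion between finite-dimensional manifolds: a smooth map all of whose differentials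
are onto. -/
def IsSmoothSubmersion (f : M → M') : Prop :=
  ContMDiff I I' ∞ f ∧ ∀ x : M, Function.Surjective (mfderiv I I' f x)

variable {I M} [FiniteDimensional ℝ E]

/-- The vector `w^♯ β`, determined by `α (w^♯ β) = w(α, β)` for all covectors `α`
(see `apply_sharp`). -/
def sharp (w : BilinField I M) (x : M) (β : Cotangent I x) : TangentSpace I x :=
  (Module.evalEquiv ℝ E).symm
    (((w x).flip β).comp (LinearMap.toContinuousLinearMap (𝕜 := ℝ) (E := E) (F' := ℝ)).toLinearMap)

theorem apply_sharp (w : BilinField I M) (x : M) (α β : Cotangent I x) :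
    α (sharp w x β) = w x α β := by
  exact Module.apply_evalEquiv_symm_apply (R := ℝ) (M := E)
    (LinearMap.toContinuousLinearMap.symm (show E →L[ℝ] ℝ from α))
    (((w x).flip β).comp (LinearMap.toContinuousLinearMap (𝕜 := ℝ) (E := E) (F' := ℝ)).toLinearMap)

/-- Some integral curve, over the time interval `[0, 1]`, of the Hamiltonian vector field
`X_f = w^♯ df` of some smooth function `f` runs from `x` to `y`. -/
def HamiltonianStep (w : BilinField I M) (x y : M) : Prop :=
  ∃ f : M → ℝ, ContMDiff I 𝓘(ℝ, ℝ) ∞ f ∧ ∃ γ : ℝ → M, γ 0 = x ∧ γ 1 = y ∧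
    IsMIntegralCurveOn γ (fun z => sharp w z (diff I f z)) (Set.Icc 0 1)

/-- The symplectic leaf through `x`: all points that can be reached from `x` by finitely many
flows of Hamiltonian vector fields. -/
def symplecticLeaf (w : BilinField I M) (x : M) : Set M :=
  {y | Relation.ReflTransGen (HamiltonianStep w) x y}

/-- `i : X → M` is an embedded Lagrangian submanifold of a symplectic leaf of `(M, w)`
(for disconnected `X`: each connected component of `X` lies in a leaf).  The tangent space of the
leaf is the image of `w^♯`, with the symplectic form `ω(w^♯ α, w^♯ β) = w(α, β)`;
`lagrangian` says that `T_x X` lies in it and is equal to its own `ω`-orthogonal. -/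
structure IsLagrangianInLeaf (w : BilinField I M) (i : M' → M) : Prop where
  smooth : ContMDiff I' I ∞ i
  immersion : ∀ x : M', Function.Injective (mfderiv I' I i x)
  embedding : Topology.IsEmbedding i
  leaf : ∀ x : M', ∀ y ∈ connectedComponent x, i y ∈ symplecticLeaf w (i x)
  lagrangian : ∀ (x : M') (v : TangentSpace I (i x)),
    v ∈ Set.range (mfderiv I' I i x) ↔
      ∃ α : Cotangent I (i x), sharp w (i x) α = v ∧
        ∀ β : Cotangent I (i x), sharp w (i x) β ∈ Set.range (mfderiv I' I i x) →
          w (i x) α β = 0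

end Poisson

/-! ### One-forms on a manifold -/

section Forms

variable {E : Type*} [NormedAddCommGroup E] [NormedSpace ℝ E]
  {M : Type*} [TopologicalSpace M] [ChartedSpace E M]

/-- The 1-form `α` written in the preferred chart at `x`. -/
def formInChart (α : ∀ x : M, Cotangent 𝓘(ℝ, E) x) (x : M) : E → (E →L[ℝ] ℝ) :=
  fun u => (α ((extChartAt 𝓘(ℝ, E) x).symm u)).comp
    (mfderiv 𝓘(ℝ, E) 𝓘(ℝ, E) (extChartAt 𝓘(ℝ, E) x).symm u)

/-- The exterior derivative `(dα)_x(u, v)` of a 1-form, computed in the preferred chart at `x`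
(in which `T_x M` is identified with the model space). -/
def extDerivForm (α : ∀ x : M, Cotangent 𝓘(ℝ, E) x) (x : M) (u v : TangentSpace 𝓘(ℝ, E) x) : ℝ :=
  let D : E →L[ℝ] E →L[ℝ] ℝ := fderiv ℝ (formInChart α x) (extChartAt 𝓘(ℝ, E) x x)
  D u v - D v u

/-- Smoothness of a 1-form. -/
def IsSmoothForm [IsManifold 𝓘(ℝ, E) ∞ M] (α : ∀ x : M, Cotangent 𝓘(ℝ, E) x) : Prop :=
  ContMDiff 𝓘(ℝ, E) (𝓘(ℝ, E).prod 𝓘(ℝ, E →L[ℝ] ℝ)) ∞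
    (fun x => (⟨x, α x⟩ : Bundle.TotalSpace (E →L[ℝ] ℝ) (fun x : M => Cotangent 𝓘(ℝ, E) x)))

/-- The bracket of 1-forms of a Poisson manifold,
`{α, β} = i_{w^♯ β} dα - i_{w^♯ α} dβ + d(w(α, β))`, evaluated at the tangent vector `v`.
It satisfies `{df, dg} = d{f, g}` and `{α, f β} = f {α, β} - (w^♯ α)(f) β`. -/
def formBracket [FiniteDimensional ℝ E] (w : BilinField 𝓘(ℝ, E) M)
    (α β : ∀ x : M, Cotangent 𝓘(ℝ, E) x) (x : M) (v : TangentSpace 𝓘(ℝ, E) x) : ℝ :=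
  extDerivForm α x (sharp w x (β x)) v - extDerivForm β x (sharp w x (α x)) v
    + diff 𝓘(ℝ, E) (fun y => w y (α y) (β y)) x v

end Forms

/-! ### The cotangent bundle and its canonical Poisson structure -/

section CotangentBundle

variable (E : Type*) [NormedAddCommGroup E] [NormedSpace ℝ E]
  (M : Type*) [TopologicalSpace M] [ChartedSpace E M]

/-- The cotangent bundle `T*M`. -/
abbrev CotangentBundle : Type _ :=
  Bundle.TotalSpace (E →L[ℝ] ℝ) (fun x : M => Cotangent 𝓘(ℝ, E) x)

/-- The model with corners of `T*M`. -/
abbrev cotangentModel :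
    ModelWithCorners ℝ (E × (E →L[ℝ] ℝ)) (ModelProd E (E →L[ℝ] ℝ)) :=
  𝓘(ℝ, E).prod 𝓘(ℝ, E →L[ℝ] ℝ)

/-- The bivector `∂_x ∧ ∂_p` of the vector space `E × E*`, the inverse of the symplectic form
`dx ∧ dp`.  For a covector `α` on `E × E*`, its restriction `α ∘ inl` to `E × 0` is an element of
`E*`, on which the restriction of `β` to `0 × E*` can be evaluated. -/
def modelPoisson :
    ((E × (E →L[ℝ] ℝ)) →L[ℝ] ℝ) →ₗ[ℝ] ((E × (E →L[ℝ] ℝ)) →L[ℝ] ℝ) →ₗ[ℝ] ℝ :=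
  have hadd : ∀ p q : E →L[ℝ] ℝ, ((0 : E), p + q) = (0, p) + (0, q) := fun p q => by simp
  have hsmul : ∀ (c : ℝ) (p : E →L[ℝ] ℝ), ((0 : E), c • p) = c • ((0 : E), p) :=
    fun c p => by simp
  LinearMap.mk₂ ℝ
    (fun α β => β (0, α.comp (ContinuousLinearMap.inl ℝ E (E →L[ℝ] ℝ)))
      - α (0, β.comp (ContinuousLinearMap.inl ℝ E (E →L[ℝ] ℝ))))
    (fun α α' β => by
      rw [ContinuousLinearMap.add_comp, hadd, map_add, add_apply]; ring)
    (fun c α β => by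
      rw [ContinuousLinearMap.smul_comp, hsmul, map_smul, smul_apply,
        smul_eq_mul, smul_eq_mul, smul_eq_mul]; ring)
    (fun α β β' => by
      rw [ContinuousLinearMap.add_comp, hadd, map_add, add_apply]; ring)
    (fun c α β => by
      rw [ContinuousLinearMap.smul_comp, hsmul, map_smul, smul_apply,
        smul_eq_mul, smul_eq_mul, smul_eq_mul]; ring)

/-- The canonical Poisson structure of `T*M`, i.e. the inverse of the canonical symplectic form
`dx ∧ dp`.  The preferred chart of `T*M` at `a` consists of the canonical coordinates
`(x, p) ∈ E × E*` that belong to the preferred chart of `M` at the base point of `a`, and it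
identifies `T_a(T*M)` with `E × E*`.  In these coordinates
`{f, g} = ∂f/∂x · ∂g/∂p - ∂f/∂p · ∂g/∂x`. -/
def canonicalPoisson [IsManifold 𝓘(ℝ, E) ∞ M] :
    BilinField (cotangentModel E) (CotangentBundle E M) :=
  fun _ => modelPoisson E

variable {E M} in
/-- For `α ∈ T*_y M`, the vertical tangent vector at the zero covector over `y` with
value `α`: the velocity at `t = 0` of `t ↦ t α ∈ T*_y M ⊂ T*M`. -/
def verticalVector [IsManifold 𝓘(ℝ, E) ∞ M] (a : CotangentBundle E M) :
    TangentSpace (cotangentModel E) (⟨a.proj, 0⟩ : CotangentBundle E M) :=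
  mfderiv 𝓘(ℝ, E →L[ℝ] ℝ) (cotangentModel E)
    (fun β : E →L[ℝ] ℝ => (⟨a.proj, β⟩ : CotangentBundle E M)) 0 a.snd

end CotangentBundle

/-! ### Principal bundles and the quotient `T*P/G` -/

section Principal

variable {EG : Type*} [NormedAddCommGroup EG] [NormedSpace ℝ EG]
  (G : Type*) [Group G] [TopologicalSpace G] [ChartedSpace EG G]
  {EP : Type*} [NormedAddCommGroup EP] [NormedSpace ℝ EP]
  {P : Type*} [TopologicalSpace P] [ChartedSpace EP P] [MulAction Gᵐᵒᵖ P]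
  {EB : Type*} [NormedAddCommGroup EB] [NormedSpace ℝ EB]
  {B : Type*} [TopologicalSpace B] [ChartedSpace EB B]

variable {G} in
/-- The right action `y ↦ y g`. -/
def rightMul (g : G) (y : P) : P := MulOpposite.op g • y

/-- `p : P → B` is a smooth principal fibre bundle with structure group `G`, acting on `P` from
the right: it is locally isomorphic to `U × G → U`, with `G` acting by right translations. -/
structure IsPrincipalBundle (p : P → B) : Prop where
  smooth_proj : ContMDiff 𝓘(ℝ, EP) 𝓘(ℝ, EB) ∞ p
  smooth_action : ContMDiff (𝓘(ℝ, EP).prod 𝓘(ℝ, EG)) 𝓘(ℝ, EP) ∞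
    (fun x : P × G => rightMul x.2 x.1)
  proj_rightMul : ∀ (g : G) (y : P), p (rightMul g y) = p y
  locally_trivial : ∀ b : B, ∃ (U : Set B) (Ψ : OpenPartialHomeomorph P (B × G)),
    IsOpen U ∧ b ∈ U ∧ Ψ.source = p ⁻¹' U ∧ Ψ.target = U ×ˢ Set.univ ∧
    ContMDiffOn 𝓘(ℝ, EP) (𝓘(ℝ, EB).prod 𝓘(ℝ, EG)) ∞ Ψ Ψ.source ∧
    ContMDiffOn (𝓘(ℝ, EB).prod 𝓘(ℝ, EG)) 𝓘(ℝ, EP) ∞ Ψ.symm Ψ.target ∧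
    (∀ y ∈ Ψ.source, (Ψ y).1 = p y) ∧
    (∀ y ∈ Ψ.source, ∀ g : G, (Ψ (rightMul g y)).2 = (Ψ y).2 * g)

variable {G} in
/-- The canonical lift to `T*P` of the right action: `g` maps `α ∈ T*_y P` to
`α ∘ (T_y R_g)⁻¹ ∈ T*_{yg} P`, where `(T_y R_g)⁻¹ = T_{yg} R_{g⁻¹}`. -/
def cotangentLift (g : G) (a : CotangentBundle EP P) : CotangentBundle EP P :=
  ⟨rightMul g a.proj, ContinuousLinearMap.comp (show EP →L[ℝ] ℝ from a.snd)
    (show EP →L[ℝ] EP from mfderiv 𝓘(ℝ, EP) 𝓘(ℝ, EP) (rightMul g⁻¹ : P → P) (rightMul g a.proj))⟩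

variable (EP P) in
/-- The quotient `T*P/G`. -/
abbrev CotangentQuotient : Type _ :=
  Quot (fun a a' : CotangentBundle EP P => ∃ g : G, a' = cotangentLift g a)

variable (EP P) in
/-- The projection `ρ : T*P → T*P/G`. -/
def quotientMap (a : CotangentBundle EP P) : CotangentQuotient G EP P := Quot.mk _ a

end Principal

/-! ### The Sternberg-Weinstein approximation -/

section Approximation

variable {EX : Type*} [NormedAddCommGroup EX] [NormedSpace ℝ EX]
  {X : Type*} [TopologicalSpace X] [ChartedSpace EX X]
  {EZ : Type*} [NormedAddCommGroup EZ] [NormedSpace ℝ EZ] [FiniteDimensional ℝ EZ]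
  {Z : Type*} [TopologicalSpace Z] [ChartedSpace EZ Z] [IsManifold 𝓘(ℝ, EZ) ∞ Z]

/-- The tangent space `T_x X`, as a subspace of `T_{i(x)} Z`. -/
abbrev tangentRange (i : C^∞⟮𝓘(ℝ, EX), X; 𝓘(ℝ, EZ), Z⟯) (x : X) :
    Submodule ℝ (TangentSpace 𝓘(ℝ, EZ) (i x)) :=
  LinearMap.range (mfderiv 𝓘(ℝ, EX) 𝓘(ℝ, EZ) i x).toLinearMap

/-- The normal bundle `TZ|_X / TX` (as a set). -/
structure NormalBundle (i : C^∞⟮𝓘(ℝ, EX), X; 𝓘(ℝ, EZ), Z⟯) where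
  /-- the base point -/
  base : X
  /-- the class of a tangent vector -/
  vec : TangentSpace 𝓘(ℝ, EZ) (i base) ⧸ tangentRange i base

/-- The projection `TZ|_X → TZ|_X / TX`. -/
def normalProj (i : C^∞⟮𝓘(ℝ, EX), X; 𝓘(ℝ, EZ), Z⟯)
    (v : Bundle.TotalSpace EZ (i *ᵖ (TangentSpace 𝓘(ℝ, EZ) : Z → Type _))) : NormalBundle i :=
  ⟨v.proj, Submodule.Quotient.mk (p := tangentRange i v.proj) v.snd⟩

/-- The restriction of `α` to `X` takes values in the annihilator `E_X = (TX)^0 ⊂ T*Z|_X`. -/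
def Annihilates (i : C^∞⟮𝓘(ℝ, EX), X; 𝓘(ℝ, EZ), Z⟯) (α : ∀ z : Z, Cotangent 𝓘(ℝ, EZ) z) : Prop :=
  ∀ x : X, tangentRange i x ≤ LinearMap.ker (α (i x)).toLinearMap

/-- The function on `E_X^* = TZ|_X / TX`, linear on the fibres, that is defined by the section
`α|_X` of `E_X`. -/
def fiberLinear (i : C^∞⟮𝓘(ℝ, EX), X; 𝓘(ℝ, EZ), Z⟯) (α : ∀ z : Z, Cotangent 𝓘(ℝ, EZ) z)
    (hα : Annihilates i α) : NormalBundle i → ℝ :=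
  fun n => (tangentRange i n.base).liftQ (α (i n.base)).toLinearMap (hα n.base) n.vec

/-- The Sternberg-Weinstein approximation of the Poisson manifold `(Z, w)` at `i : X → Z`
(to be used for Lagrangian submanifolds `X` of symplectic leaves): the normal bundle
`E_X^* = TZ|_X / TX` with its quotient manifold structure, and the Poisson structure `{·,·}'`
on it for which, with `τ : E_X^* → X` the projection and `ᾱ` the linear function given by a section
`α` of the Lie algebroid `E_X = (TX)^0` with anchor `-w^♯` and bracket `{α|_X, β|_X} = {α, β}|_X`,
`{τ^*h, τ^*k}' = 0`, `{ᾱ, τ^*h}' = τ^*((-w^♯ α) · h)` and `{ᾱ, β̄}'` is the linear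
function of `{α, β}`. The manifold structure (up to equivalent atlases) and the Poisson structure
are determined by these conditions. -/
structure Approximation (w : PoissonStructure 𝓘(ℝ, EZ) Z)
    (i : C^∞⟮𝓘(ℝ, EX), X; 𝓘(ℝ, EZ), Z⟯) where
  [topology : TopologicalSpace (NormalBundle i)]
  [charts : ChartedSpace EZ (NormalBundle i)]
  [manifold : IsManifold 𝓘(ℝ, EZ) ∞ (NormalBundle i)]
  submersion : IsSmoothSubmersion (I := 𝓘(ℝ, EX).prod 𝓘(ℝ, EZ)) (I' := 𝓘(ℝ, EZ)) (normalProj i)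
  /-- the Poisson structure `{·,·}'` -/
  poisson : PoissonStructure 𝓘(ℝ, EZ) (NormalBundle i)
  base_base : ∀ h k : X → ℝ, ContMDiff 𝓘(ℝ, EX) 𝓘(ℝ, ℝ) ∞ h → ContMDiff 𝓘(ℝ, EX) 𝓘(ℝ, ℝ) ∞ k →
    ∀ n : NormalBundle i,
      bracket poisson.tensor (fun n => h n.base) (fun n => k n.base) n = 0
  linear_base : ∀ (α : ∀ z : Z, Cotangent 𝓘(ℝ, EZ) z) (hα : Annihilates i α) (h : X → ℝ),
    IsSmoothForm α → ContMDiff 𝓘(ℝ, EX) 𝓘(ℝ, ℝ) ∞ h →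
    ∀ (n : NormalBundle i) (u : TangentSpace 𝓘(ℝ, EX) n.base),
      mfderiv 𝓘(ℝ, EX) 𝓘(ℝ, EZ) i n.base u = - sharp w.tensor (i n.base) (α (i n.base)) →
      bracket poisson.tensor (fiberLinear i α hα) (fun n => h n.base) n
        = diff 𝓘(ℝ, EX) h n.base u
  linear_linear : ∀ (α β : ∀ z : Z, Cotangent 𝓘(ℝ, EZ) z)
    (hα : Annihilates i α) (hβ : Annihilates i β), IsSmoothForm α → IsSmoothForm β →
    ∀ (x : X) (v : TangentSpace 𝓘(ℝ, EZ) (i x)),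
      bracket poisson.tensor (fiberLinear i α hα) (fiberLinear i β hβ)
          ⟨x, Submodule.Quotient.mk v⟩
        = formBracket w.tensor α β (i x) v

namespace Approximation

variable {w : PoissonStructure 𝓘(ℝ, EZ) Z} {i : C^∞⟮𝓘(ℝ, EX), X; 𝓘(ℝ, EZ), Z⟯}

/-- The underlying manifold of the Sternberg-Weinstein approximation. -/
def Total (_A : Approximation w i) : Type _ := NormalBundle i

variable (A : Approximation w i)

instance : TopologicalSpace A.Total := A.topology

instance : ChartedSpace EZ A.Total := A.charts

instance : IsManifold 𝓘(ℝ, EZ) ∞ A.Total := A.manifold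

/-- The Poisson tensor of the Sternberg-Weinstein approximation. -/
def tensor : BilinField 𝓘(ℝ, EZ) A.Total :=
  letI := A.topology
  letI := A.charts
  A.poisson.tensor

/-- The point `[v]` over `x` of the Sternberg-Weinstein approximation. -/
def point (x : X) (v : TangentSpace 𝓘(ℝ, EZ) (i x)) : A.Total :=
  (⟨x, Submodule.Quotient.mk v⟩ : NormalBundle i)

end Approximation

end Approximation

end SternbergWeinstein

end

open scoped Manifold ContDiff Bundle Topology

set_option linter.unusedSectionVars false

noncomputable section

namespace SternbergWeinstein

section Model

variable {V : Type*} [NormedAddCommGroup V] [NormedSpace ℝ V] [FiniteDimensional ℝ V]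

/-- The vector `X` such that `α X = w α β` for all covectors `α`. -/
theorem exists_sharp (w : (V →L[ℝ] ℝ) →ₗ[ℝ] (V →L[ℝ] ℝ) →ₗ[ℝ] ℝ) (β : V →L[ℝ] ℝ) :
    ∃ X : V, ∀ α : V →L[ℝ] ℝ, α X = w α β :=
  ⟨sharp (I := 𝓘(ℝ, V)) (M := V) (fun _ => w) 0 β,
    fun α => apply_sharp (I := 𝓘(ℝ, V)) (M := V) (fun _ => w) 0 α β⟩

/-- A linear form on the dual of a finite-dimensional space is an evaluation. -/
theorem exists_eval (l : (V →L[ℝ] ℝ) →ₗ[ℝ] ℝ) : ∃ X : V, ∀ α : V →L[ℝ] ℝ, l α = α X := by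
  obtain ⟨X, hX⟩ := (Module.evalEquiv ℝ V).surjective
    (l.comp (LinearMap.toContinuousLinearMap (𝕜 := ℝ) (E := V) (F' := ℝ)).toLinearMap)
  refine ⟨X, fun α => ?_⟩
  have := LinearMap.congr_fun hX α.toLinearMap
  simp only [Module.evalEquiv_apply, LinearMap.comp_apply] at this
  exact this.symm

/-- Covectors separate vectors. -/
theorem eq_of_forall_covector {X Y : V} (h : ∀ α : V →L[ℝ] ℝ, α X = α Y) : X = Y := by
  refine (Module.evalEquiv ℝ V).injective (LinearMap.ext fun α => ?_)
  exact h (LinearMap.toContinuousLinearMap α)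

theorem hasFDerivAt_bilin {U : Type*} [NormedAddCommGroup U] [NormedSpace ℝ U]
    (w : (V →L[ℝ] ℝ) →ₗ[ℝ] (V →L[ℝ] ℝ) →ₗ[ℝ] ℝ)
    {a b : U → (V →L[ℝ] ℝ)} {u : U} (ha : DifferentiableAt ℝ a u) (hb : DifferentiableAt ℝ b u)
    (v : U) :
    DifferentiableAt ℝ (fun y => w (a y) (b y)) u ∧
    fderiv ℝ (fun y => w (a y) (b y)) u v = w (fderiv ℝ a u v) (b u) + w (a u) (fderiv ℝ b u v) := by
  have h := (LinearMap.toContinuousBilinearMap w).isBoundedBilinearMap.hasFDerivAt (a u, b u)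
  have h2 := HasFDerivAt.comp u h (ha.hasFDerivAt.prodMk hb.hasFDerivAt)
  refine ⟨h2.differentiableAt, ?_⟩
  have h3 := h2.fderiv
  have : (fun y => w (a y) (b y)) = (fun p : (V →L[ℝ] ℝ) × (V →L[ℝ] ℝ) =>
      LinearMap.toContinuousBilinearMap w p.1 p.2) ∘ (fun x => (a x, b x)) := rfl
  rw [this, h3]
  simp [add_comm]

theorem contDiffAt_bilin {U : Type*} [NormedAddCommGroup U] [NormedSpace ℝ U]
    (w : (V →L[ℝ] ℝ) →ₗ[ℝ] (V →L[ℝ] ℝ) →ₗ[ℝ] ℝ) {n : WithTop ℕ∞}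
    {a b : U → (V →L[ℝ] ℝ)} {u : U} (ha : ContDiffAt ℝ n a u) (hb : ContDiffAt ℝ n b u) :
    ContDiffAt ℝ n (fun y => w (a y) (b y)) u :=
  ContDiffAt.comp u ((LinearMap.toContinuousBilinearMap w).isBoundedBilinearMap.contDiff.contDiffAt)
    (ha.prodMk hb)

/-- The bracket of functions on a vector space defined by a constant bivector. -/
def constBracket (w : (V →L[ℝ] ℝ) →ₗ[ℝ] (V →L[ℝ] ℝ) →ₗ[ℝ] ℝ) (f g : V → ℝ) : V → ℝ :=
  fun u => w (fderiv ℝ f u) (fderiv ℝ g u)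

theorem ContDiffAt.constBracket (w : (V →L[ℝ] ℝ) →ₗ[ℝ] (V →L[ℝ] ℝ) →ₗ[ℝ] ℝ) {f g : V → ℝ} {u : V}
    (hf : ContDiffAt ℝ ∞ f u) (hg : ContDiffAt ℝ ∞ g u) :
    ContDiffAt ℝ ∞ (constBracket w f g) u :=
  contDiffAt_bilin w (hf.fderiv_right (by simp)) (hg.fderiv_right (by simp))

theorem constBracket_jacobi (w : (V →L[ℝ] ℝ) →ₗ[ℝ] (V →L[ℝ] ℝ) →ₗ[ℝ] ℝ)
    (hw : ∀ α β, w α β = - w β α) {f g h : V → ℝ} {u : V}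
    (hf : ContDiffAt ℝ ∞ f u) (hg : ContDiffAt ℝ ∞ g u) (hh : ContDiffAt ℝ ∞ h u) :
    constBracket w f (constBracket w g h) u + constBracket w g (constBracket w h f) u
      + constBracket w h (constBracket w f g) u = 0 := by
  have key : ∀ {f g h : V → ℝ}, ContDiffAt ℝ ∞ f u → ContDiffAt ℝ ∞ g u → ContDiffAt ℝ ∞ h u →
      ∀ {X Y Z : V}, (∀ α : V →L[ℝ] ℝ, α X = w α (fderiv ℝ f u)) →
      (∀ α : V →L[ℝ] ℝ, α Y = w α (fderiv ℝ g u)) → (∀ α : V →L[ℝ] ℝ, α Z = w α (fderiv ℝ h u)) →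
      constBracket w f (constBracket w g h) u =
        - fderiv ℝ (fderiv ℝ g) u X Z + fderiv ℝ (fderiv ℝ h) u X Y := by
    intro f g h hf hg hh X Y Z hX hY hZ
    have dg : DifferentiableAt ℝ (fderiv ℝ g) u :=
      (hg.fderiv_right (m := ∞) (by simp)).differentiableAt (by simp)
    have dh : DifferentiableAt ℝ (fderiv ℝ h) u :=
      (hh.fderiv_right (m := ∞) (by simp)).differentiableAt (by simp)
    unfold constBracket
    rw [hw, ← hX, (hasFDerivAt_bilin w dg dh X).2, hw (fderiv ℝ g u), ← hY, ← hZ]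
    ring
  obtain ⟨X, hX⟩ := exists_sharp w (fderiv ℝ f u)
  obtain ⟨Y, hY⟩ := exists_sharp w (fderiv ℝ g u)
  obtain ⟨Z, hZ⟩ := exists_sharp w (fderiv ℝ h u)
  have sym : ∀ {f : V → ℝ}, ContDiffAt ℝ ∞ f u → ∀ a b,
      fderiv ℝ (fderiv ℝ f) u a b = fderiv ℝ (fderiv ℝ f) u b a := fun hf a b =>
    (hf.isSymmSndFDerivAt (by simpa using ENat.LEInfty.out)).eq a b
  rw [key hf hg hh hX hY hZ, key hg hh hf hY hZ hX, key hh hf hg hZ hX hY, sym hg X Z, sym hh X Y,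
    sym hf Y Z]
  ring

end Model

section ModelLift

variable {E : Type*} [NormedAddCommGroup E] [NormedSpace ℝ E]

theorem modelPoisson_apply (α β : (E × (E →L[ℝ] ℝ)) →L[ℝ] ℝ) :
    modelPoisson E α β = β (0, α.comp (ContinuousLinearMap.inl ℝ E (E →L[ℝ] ℝ)))
      - α (0, β.comp (ContinuousLinearMap.inl ℝ E (E →L[ℝ] ℝ))) := rfl

theorem modelPoisson_skew (α β : (E × (E →L[ℝ] ℝ)) →L[ℝ] ℝ) :
    modelPoisson E α β = - modelPoisson E β α := by
  simp only [modelPoisson_apply]; ring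

variable [FiniteDimensional ℝ E]

/-- The cotangent lift of a local diffeomorphism preserves the canonical bivector. -/
theorem modelPoisson_lift {θ θ' : E → E} {x : E} (p : E →L[ℝ] ℝ)
    (hθ : DifferentiableAt ℝ θ x) (hθ' : ContDiffAt ℝ 2 θ' (θ x))
    (h1 : ∀ᶠ y in 𝓝 x, θ' (θ y) = y) (h2 : ∀ᶠ y in 𝓝 (θ x), θ (θ' y) = y) :
    ∃ T' : (E × (E →L[ℝ] ℝ)) →L[ℝ] (E × (E →L[ℝ] ℝ)),
      HasFDerivAt (fun z : E × (E →L[ℝ] ℝ) => (θ z.1, z.2 ∘L fderiv ℝ θ' (θ z.1))) T' (x, p) ∧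
      ∀ α β, modelPoisson E (α.comp T') (β.comp T') = modelPoisson E α β := by
  have hx : θ' (θ x) = x := h1.self_of_nhds
  have dθ' : DifferentiableAt ℝ θ' (θ x) := hθ'.differentiableAt (by simp)
  have hAB : (fderiv ℝ θ x) ∘L (fderiv ℝ θ' (θ x)) = ContinuousLinearMap.id ℝ E := by
    have h : HasFDerivAt (θ ∘ θ') ((fderiv ℝ θ x) ∘L (fderiv ℝ θ' (θ x))) (θ x) := by
      refine HasFDerivAt.comp (θ x) ?_ dθ'.hasFDerivAt
      rw [hx]; exact hθ.hasFDerivAt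
    exact (h.congr_of_eventuallyEq (f₁ := id) (h2.mono fun y hy => hy.symm)).unique
      (hasFDerivAt_id _)
  set A := fderiv ℝ θ x
  set B := fderiv ℝ θ' (θ x)
  set D := fderiv ℝ (fderiv ℝ θ') (θ x)
  have dD : HasFDerivAt (fderiv ℝ θ') D (θ x) :=
    ((hθ'.fderiv_right (m := 1) (by norm_num)).differentiableAt (by simp)).hasFDerivAt
  have hsym : ∀ a b, D a b = D b a := fun a b => (hθ'.isSymmSndFDerivAt (by simp)).eq a b
  have hfst : HasFDerivAt (fun z : E × (E →L[ℝ] ℝ) => θ z.1)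
      (A ∘L ContinuousLinearMap.fst ℝ E (E →L[ℝ] ℝ)) (x, p) :=
    HasFDerivAt.comp (x, p) (f := Prod.fst) (g := θ) hθ.hasFDerivAt hasFDerivAt_fst
  have hsnd : HasFDerivAt (fun z : E × (E →L[ℝ] ℝ) => fderiv ℝ θ' (θ z.1))
      (D ∘L (A ∘L ContinuousLinearMap.fst ℝ E (E →L[ℝ] ℝ))) (x, p) :=
    HasFDerivAt.comp (x, p) (f := fun z : E × (E →L[ℝ] ℝ) => θ z.1) dD hfst
  have hT := hfst.prodMk ((hasFDerivAt_snd (𝕜 := ℝ) (p := (x, p))).clm_comp hsnd)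
  refine ⟨_, hT, fun α β => ?_⟩
  have hABv : ∀ v, A (fderiv ℝ θ' (θ x) v) = v := fun v => DFunLike.congr_fun hAB v
  obtain ⟨a, ha⟩ := exists_eval (V := E) (α.comp (ContinuousLinearMap.inr ℝ E (E →L[ℝ] ℝ))).toLinearMap
  obtain ⟨b, hb⟩ := exists_eval (V := E) (β.comp (ContinuousLinearMap.inr ℝ E (E →L[ℝ] ℝ))).toLinearMap
  replace ha : ∀ q : E →L[ℝ] ℝ, α (0, q) = q a := ha
  replace hb : ∀ q : E →L[ℝ] ℝ, β (0, q) = q b := hb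
  have split : ∀ (γ : (E × (E →L[ℝ] ℝ)) →L[ℝ] ℝ) v q, γ (v, q) = γ (v, 0) + γ (0, q) := by
    intro γ v q
    rw [← map_add]; simp
  simp only [modelPoisson_apply, ContinuousLinearMap.comp_apply, ContinuousLinearMap.prod_apply,
    ContinuousLinearMap.coe_fst', map_zero,
    add_apply, ContinuousLinearMap.coe_snd']
  simp only [ha, hb, ContinuousLinearMap.compL_apply, ContinuousLinearMap.flip_apply,
    ContinuousLinearMap.comp_apply, ContinuousLinearMap.inl_apply, zero_add,
    ContinuousLinearMap.prod_apply, ContinuousLinearMap.coe_fst', ContinuousLinearMap.coe_snd',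
    add_apply, ContinuousLinearMap.zero_comp, add_zero, hABv]
  rw [split α b (p ∘L D b), split β a (p ∘L D a)]
  simp only [ha, hb, ContinuousLinearMap.comp_apply, hsym a b]
  ring

end ModelLift

section CotangentCoordinates

variable {E : Type*} [NormedAddCommGroup E] [NormedSpace ℝ E]
  {M : Type*} [TopologicalSpace M] [ChartedSpace E M] [IsManifold 𝓘(ℝ, E) ∞ M]

theorem mdifferentiableAt_extChartAt_symm_self {x₀ : M} {z : E}
    (hz : z ∈ (extChartAt 𝓘(ℝ, E) x₀).target) :
    MDifferentiableAt 𝓘(ℝ, E) 𝓘(ℝ, E) (extChartAt 𝓘(ℝ, E) x₀).symm z := by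
  have := mdifferentiableWithinAt_extChartAt_symm (I := 𝓘(ℝ, E)) hz
  rwa [modelWithCornersSelf_coe, Set.range_id, mdifferentiableWithinAt_univ] at this

theorem mfderiv_extChartAt_symm_apply {x₀ y : M}
    (hy : y ∈ (extChartAt 𝓘(ℝ, E) x₀).source) (v : E) :
    mfderiv 𝓘(ℝ, E) 𝓘(ℝ, E) (extChartAt 𝓘(ℝ, E) x₀) y
      (mfderiv 𝓘(ℝ, E) 𝓘(ℝ, E) (extChartAt 𝓘(ℝ, E) x₀).symm (extChartAt 𝓘(ℝ, E) x₀ y) v) = v := by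
  have := mfderiv_extChartAt_comp_mfderivWithin_extChartAt_symm' (I := 𝓘(ℝ, E)) hy
  rw [modelWithCornersSelf_coe, Set.range_id, mfderivWithin_univ] at this
  exact DFunLike.congr_fun this v

theorem mfderiv_symm_extChartAt_apply {x₀ y : M}
    (hy : y ∈ (extChartAt 𝓘(ℝ, E) x₀).source) (v : TangentSpace 𝓘(ℝ, E) y) :
    mfderiv 𝓘(ℝ, E) 𝓘(ℝ, E) (extChartAt 𝓘(ℝ, E) x₀).symm (extChartAt 𝓘(ℝ, E) x₀ y)
      (mfderiv 𝓘(ℝ, E) 𝓘(ℝ, E) (extChartAt 𝓘(ℝ, E) x₀) y v) = v := by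
  have := mfderivWithin_extChartAt_symm_comp_mfderiv_extChartAt' (I := 𝓘(ℝ, E)) hy
  rw [modelWithCornersSelf_coe, Set.range_id, mfderivWithin_univ] at this
  exact DFunLike.congr_fun this v

theorem mem_extChartAt_cotangent_source (a b : CotangentBundle E M) :
    b ∈ (extChartAt (cotangentModel E) a).source ↔
      b.proj ∈ (extChartAt 𝓘(ℝ, E) a.proj).source := by
  rw [FiberBundle.extChartAt]
  simp
  exact fun h => h

theorem extChartAt_cotangent_apply {a b : CotangentBundle E M}
    (hb : b.proj ∈ (extChartAt 𝓘(ℝ, E) a.proj).source) :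
    extChartAt (cotangentModel E) a b = (extChartAt 𝓘(ℝ, E) a.proj b.proj,
      (show E →L[ℝ] ℝ from b.snd) ∘L (show E →L[ℝ] E from mfderiv 𝓘(ℝ, E) 𝓘(ℝ, E)
        (extChartAt 𝓘(ℝ, E) a.proj).symm (extChartAt 𝓘(ℝ, E) a.proj b.proj))) := by
  have h := TangentBundle.symmL_trivializationAt (I := 𝓘(ℝ, E)) (x₀ := a.proj) (x := b.proj)
    (by simpa using hb)
  rw [FiberBundle.extChartAt]
  simp only [hom_trivializationAt_apply, mfld_simps]
  refine Prod.ext rfl ?_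
  ext v
  simp [ContinuousLinearMap.inCoordinates]
  rw [h, modelWithCornersSelf_coe, Set.range_id, mfderivWithin_univ]
  rfl

theorem extChartAt_cotangent_target (a : CotangentBundle E M) (z : E × (E →L[ℝ] ℝ)) :
    z ∈ (extChartAt (cotangentModel E) a).target ↔ z.1 ∈ (extChartAt 𝓘(ℝ, E) a.proj).target := by
  rw [FiberBundle.extChartAt]
  simp
  exact (chartAt E a.proj).map_target

theorem extChartAt_cotangent_symm_apply {a : CotangentBundle E M} {z : E × (E →L[ℝ] ℝ)}
    (hz : z.1 ∈ (extChartAt 𝓘(ℝ, E) a.proj).target) :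
    (extChartAt (cotangentModel E) a).symm z = ⟨(extChartAt 𝓘(ℝ, E) a.proj).symm z.1,
      z.2 ∘L (show E →L[ℝ] E from mfderiv 𝓘(ℝ, E) 𝓘(ℝ, E)
        (extChartAt 𝓘(ℝ, E) a.proj) ((extChartAt 𝓘(ℝ, E) a.proj).symm z.1))⟩ := by
  symm
  rw [PartialEquiv.eq_symm_apply, extChartAt_cotangent_apply]
  · refine Prod.ext ((extChartAt 𝓘(ℝ, E) a.proj).right_inv hz) ?_
    ext v
    exact congrArg z.2 (mfderiv_extChartAt_symm_apply
      ((extChartAt 𝓘(ℝ, E) a.proj).map_target hz) v)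
  · exact (extChartAt 𝓘(ℝ, E) a.proj).map_target hz
  · rw [mem_extChartAt_cotangent_source]
    exact (extChartAt 𝓘(ℝ, E) a.proj).map_target hz
  · rwa [extChartAt_cotangent_target]


end CotangentCoordinates

section CanonicalPoisson

variable {E : Type*} [NormedAddCommGroup E] [NormedSpace ℝ E]
  {M : Type*} [TopologicalSpace M] [ChartedSpace E M] [IsManifold 𝓘(ℝ, E) ∞ M]

theorem modelPoisson_comp_mfderiv [FiniteDimensional ℝ E]
    {H' : Type*} [TopologicalSpace H'] {I' : ModelWithCorners ℝ (E × (E →L[ℝ] ℝ)) H'}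
    {Z : Type*} [TopologicalSpace Z] [ChartedSpace H' Z]
    {f : CotangentBundle E M → Z} {a : CotangentBundle E M}
    (hf : MDifferentiableAt (cotangentModel E) I' f a) {θ θ' : E → E}
    (hθ : DifferentiableAt ℝ θ (extChartAt 𝓘(ℝ, E) a.proj a.proj))
    (hθ' : ContDiffAt ℝ 2 θ' (θ (extChartAt 𝓘(ℝ, E) a.proj a.proj)))
    (h1 : ∀ᶠ y in 𝓝 (extChartAt 𝓘(ℝ, E) a.proj a.proj), θ' (θ y) = y)
    (h2 : ∀ᶠ y in 𝓝 (θ (extChartAt 𝓘(ℝ, E) a.proj a.proj)), θ (θ' y) = y)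
    (h : writtenInExtChartAt (cotangentModel E) I' a f =ᶠ[𝓝 (extChartAt (cotangentModel E) a a)]
      fun z => (θ z.1, z.2 ∘L fderiv ℝ θ' (θ z.1)))
    (α β : (E × (E →L[ℝ] ℝ)) →L[ℝ] ℝ) :
    modelPoisson E (α.comp (mfderiv (cotangentModel E) I' f a))
      (β.comp (mfderiv (cotangentModel E) I' f a)) = modelPoisson E α β := by
  have ha : a.proj ∈ (extChartAt 𝓘(ℝ, E) a.proj).source := mem_extChartAt_source _
  have e := extChartAt_cotangent_apply (a := a) ha
  obtain ⟨T', hT, hw⟩ := modelPoisson_lift (extChartAt (cotangentModel E) a a).2 hθ hθ' h1 h2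
  have hz : extChartAt (cotangentModel E) a a = (extChartAt 𝓘(ℝ, E) a.proj a.proj,
      (extChartAt (cotangentModel E) a a).2) := Prod.ext (by rw [e]) rfl
  rw [← hz] at hT
  have : mfderiv (cotangentModel E) I' f a = T' := by
    rw [hf.mfderiv, ModelWithCorners.Boundaryless.range_eq_univ, fderivWithin_univ]
    exact (hT.congr_of_eventuallyEq h).fderiv
  rw [this]
  exact hw α β

/-- The transition map between two charts, in a neighbourhood of a point. -/
theorem transition_facts {x₀ x₁ y : M} (h0 : y ∈ (extChartAt 𝓘(ℝ, E) x₀).source)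
    (h1 : y ∈ (extChartAt 𝓘(ℝ, E) x₁).source) :
    ContDiffAt ℝ ∞ (extChartAt 𝓘(ℝ, E) x₁ ∘ (extChartAt 𝓘(ℝ, E) x₀).symm)
      (extChartAt 𝓘(ℝ, E) x₀ y) := by
  rw [← contMDiffAt_iff_contDiffAt]
  refine ContMDiffAt.comp (I' := 𝓘(ℝ, E)) (extChartAt 𝓘(ℝ, E) x₀ y) ?_
    ((contMDiffOn_extChartAt_symm x₀).contMDiffAt
      ((isOpen_extChartAt_target x₀).mem_nhds ((extChartAt 𝓘(ℝ, E) x₀).map_source h0)))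
  rw [(extChartAt 𝓘(ℝ, E) x₀).left_inv h0]
  exact contMDiffAt_extChartAt' (by simpa using h1)

/-- The derivative of a map written in charts. -/
theorem fderiv_written_in_charts {x₀ x₁ y : M} {ξ : M → M}
    (h0 : y ∈ (extChartAt 𝓘(ℝ, E) x₀).source) (h1 : ξ y ∈ (extChartAt 𝓘(ℝ, E) x₁).source)
    (hξ : MDifferentiableAt 𝓘(ℝ, E) 𝓘(ℝ, E) ξ y) (v : E) :
    fderiv ℝ (extChartAt 𝓘(ℝ, E) x₁ ∘ ξ ∘ (extChartAt 𝓘(ℝ, E) x₀).symm)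
        (extChartAt 𝓘(ℝ, E) x₀ y) v =
      mfderiv 𝓘(ℝ, E) 𝓘(ℝ, E) (extChartAt 𝓘(ℝ, E) x₁) (ξ y)
        (mfderiv 𝓘(ℝ, E) 𝓘(ℝ, E) ξ y
          (mfderiv 𝓘(ℝ, E) 𝓘(ℝ, E) (extChartAt 𝓘(ℝ, E) x₀).symm (extChartAt 𝓘(ℝ, E) x₀ y) v)) := by
  have e := (extChartAt 𝓘(ℝ, E) x₀).left_inv h0
  have hs := (mdifferentiableAt_extChartAt_symm_self
    ((extChartAt 𝓘(ℝ, E) x₀).map_source h0)).hasMFDerivAt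
  have h2 : MDifferentiableAt 𝓘(ℝ, E) 𝓘(ℝ, E) (extChartAt 𝓘(ℝ, E) x₁) (ξ y) :=
    mdifferentiableAt_extChartAt (by simpa using h1)
  have h3 : HasMFDerivAt 𝓘(ℝ, E) 𝓘(ℝ, E) (extChartAt 𝓘(ℝ, E) x₁ ∘ ξ)
      ((extChartAt 𝓘(ℝ, E) x₀).symm (extChartAt 𝓘(ℝ, E) x₀ y))
      ((mfderiv 𝓘(ℝ, E) 𝓘(ℝ, E) (extChartAt 𝓘(ℝ, E) x₁) (ξ y)).comp
        (mfderiv 𝓘(ℝ, E) 𝓘(ℝ, E) ξ y)) := by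
    rw [e]
    exact h2.hasMFDerivAt.comp y hξ.hasMFDerivAt
  rw [← mfderiv_eq_fderiv]
  exact DFunLike.congr_fun (h3.comp _ hs).mfderiv v

theorem eventually_proj_extChartAt_cotangent (a : CotangentBundle E M) {p : E → Prop}
    (h : ∀ᶠ x in 𝓝 (extChartAt 𝓘(ℝ, E) a.proj a.proj), p x) :
    ∀ᶠ z in 𝓝 (extChartAt (cotangentModel E) a a), p z.1 := by
  have : Filter.Tendsto Prod.fst (𝓝 (extChartAt (cotangentModel E) a a))
      (𝓝 (extChartAt 𝓘(ℝ, E) a.proj a.proj)) := by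
    have := continuous_fst.tendsto (extChartAt (cotangentModel E) a a)
    rwa [extChartAt_cotangent_apply (mem_extChartAt_source a.proj)] at this ⊢
  exact this.eventually h

/-- Every preferred chart of `T*M` is canonical. -/
theorem modelPoisson_comp_mfderiv_extChartAt [FiniteDimensional ℝ E] {a₀ a : CotangentBundle E M}
    (ha : a ∈ (extChartAt (cotangentModel E) a₀).source) (α β : (E × (E →L[ℝ] ℝ)) →L[ℝ] ℝ) :
    modelPoisson E
      (α.comp (mfderiv (cotangentModel E) 𝓘(ℝ, E × (E →L[ℝ] ℝ))
        (extChartAt (cotangentModel E) a₀) a))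
      (β.comp (mfderiv (cotangentModel E) 𝓘(ℝ, E × (E →L[ℝ] ℝ))
        (extChartAt (cotangentModel E) a₀) a)) = modelPoisson E α β := by
  have hap : a.proj ∈ (extChartAt 𝓘(ℝ, E) a₀.proj).source :=
    (mem_extChartAt_cotangent_source _ _).1 ha
  have haa : a.proj ∈ (extChartAt 𝓘(ℝ, E) a.proj).source := mem_extChartAt_source _
  set φ := extChartAt 𝓘(ℝ, E) a.proj with hφ
  set φ₀ := extChartAt 𝓘(ℝ, E) a₀.proj with hφ₀
  have e0 : φ.symm (φ a.proj) = a.proj := φ.left_inv haa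
  have hx : (φ₀ ∘ φ.symm) (φ a.proj) = φ₀ a.proj := by simp [e0]
  have near1 : ∀ᶠ x in 𝓝 (φ a.proj), x ∈ φ.target ∧ φ.symm x ∈ φ₀.source := by
    refine Filter.Eventually.and ((isOpen_extChartAt_target a.proj).mem_nhds (φ.map_source haa)) ?_
    refine (continuousAt_extChartAt_symm a.proj).eventually_mem ?_
    rw [← hφ, e0]
    exact (isOpen_extChartAt_source a₀.proj).mem_nhds hap
  have near2 : ∀ᶠ x in 𝓝 (φ₀ a.proj), x ∈ φ₀.target ∧ φ₀.symm x ∈ φ.source := by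
    refine Filter.Eventually.and ((isOpen_extChartAt_target a₀.proj).mem_nhds
      (φ₀.map_source hap)) ?_
    refine (continuousAt_extChartAt_symm' hap).eventually_mem ?_
    rw [← hφ₀, φ₀.left_inv hap]
    exact (isOpen_extChartAt_source a.proj).mem_nhds haa
  refine modelPoisson_comp_mfderiv (θ := φ₀ ∘ φ.symm) (θ' := φ ∘ φ₀.symm)
    ((contMDiffAt_extChartAt' (by simpa using ha)).mdifferentiableAt (n := ∞) (by simp))
    ((transition_facts haa hap).differentiableAt (by simp))
    (by rw [hx]; exact (transition_facts hap haa).of_le ENat.LEInfty.out) ?_ ?_ ?_ α β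
  · filter_upwards [near1] with x hx
    simp [φ₀.left_inv hx.2, φ.right_inv hx.1]
  · rw [hx]
    filter_upwards [near2] with x hx
    simp [φ.left_inv hx.2, φ₀.right_inv hx.1]
  · have near3 : ∀ᶠ z in 𝓝 (extChartAt (cotangentModel E) a a),
        z.1 ∈ φ.target ∧ φ.symm z.1 ∈ φ₀.source :=
      eventually_proj_extChartAt_cotangent a near1
    filter_upwards [near3] with z hz
    simp only [writtenInExtChartAt, Function.comp_apply, extChartAt_model_space_eq_id,
      PartialEquiv.refl_coe, id]
    rw [extChartAt_cotangent_symm_apply hz.1, extChartAt_cotangent_apply hz.2]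
    refine Prod.ext rfl ?_
    ext v
    have := fderiv_written_in_charts (ξ := id) hz.2 (φ.map_target hz.1) mdifferentiableAt_id v
    rw [mfderiv_id] at this
    exact congrArg z.2 this.symm

end CanonicalPoisson

section CotangentMaps

variable {E : Type*} [NormedAddCommGroup E] [NormedSpace ℝ E]
  {M : Type*} [TopologicalSpace M] [ChartedSpace E M] [IsManifold 𝓘(ℝ, E) ∞ M]

/-- The cotangent lift of a map `ξ` with inverse `ξ'`. -/
def diffLift (ξ ξ' : M → M) (a : CotangentBundle E M) : CotangentBundle E M :=
  ⟨ξ a.proj, ContinuousLinearMap.comp (show E →L[ℝ] ℝ from a.snd)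
    (show E →L[ℝ] E from mfderiv 𝓘(ℝ, E) 𝓘(ℝ, E) ξ' (ξ a.proj))⟩

theorem canonicalPoisson_diffLift [FiniteDimensional ℝ E] {ξ ξ' : M → M}
    (hξ : ContMDiff 𝓘(ℝ, E) 𝓘(ℝ, E) ∞ ξ) (hξ' : ContMDiff 𝓘(ℝ, E) 𝓘(ℝ, E) ∞ ξ')
    (hl : Function.LeftInverse ξ' ξ) (hr : Function.RightInverse ξ' ξ)
    {a : CotangentBundle E M}
    (hd : MDifferentiableAt (cotangentModel E) (cotangentModel E) (diffLift ξ ξ') a)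
    (α β : Cotangent (cotangentModel E) (diffLift ξ ξ' a)) :
    canonicalPoisson E M a (α.comp (mfderiv (cotangentModel E) (cotangentModel E) (diffLift ξ ξ') a))
      (β.comp (mfderiv (cotangentModel E) (cotangentModel E) (diffLift ξ ξ') a)) =
      canonicalPoisson E M (diffLift ξ ξ' a) α β := by
  have haa : a.proj ∈ (extChartAt 𝓘(ℝ, E) a.proj).source := mem_extChartAt_source _
  have hap : ξ a.proj ∈ (extChartAt 𝓘(ℝ, E) (ξ a.proj)).source := mem_extChartAt_source _
  set φ := extChartAt 𝓘(ℝ, E) a.proj with hφ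
  set φ₀ := extChartAt 𝓘(ℝ, E) (ξ a.proj) with hφ₀
  have e0 : φ.symm (φ a.proj) = a.proj := φ.left_inv haa
  have hx : (φ₀ ∘ ξ ∘ φ.symm) (φ a.proj) = φ₀ (ξ a.proj) := by simp [e0]
  have near1 : ∀ᶠ x in 𝓝 (φ a.proj), x ∈ φ.target ∧ ξ (φ.symm x) ∈ φ₀.source := by
    refine Filter.Eventually.and ((isOpen_extChartAt_target a.proj).mem_nhds (φ.map_source haa)) ?_
    refine (hξ.continuous.continuousAt.comp (continuousAt_extChartAt_symm a.proj)).eventually_mem ?_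
    rw [Function.comp_apply, ← hφ, e0]
    exact (isOpen_extChartAt_source _).mem_nhds hap
  have near2 : ∀ᶠ x in 𝓝 (φ₀ (ξ a.proj)), x ∈ φ₀.target ∧ ξ' (φ₀.symm x) ∈ φ.source := by
    refine Filter.Eventually.and ((isOpen_extChartAt_target _).mem_nhds (φ₀.map_source hap)) ?_
    refine (hξ'.continuous.continuousAt.comp (continuousAt_extChartAt_symm' hap)).eventually_mem ?_
    rw [Function.comp_apply, ← hφ₀, φ₀.left_inv hap, hl]
    exact (isOpen_extChartAt_source a.proj).mem_nhds haa
  have smooth : ∀ {η : M → M} {x₀ x₁ y : M}, ContMDiff 𝓘(ℝ, E) 𝓘(ℝ, E) ∞ η →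
      y ∈ (extChartAt 𝓘(ℝ, E) x₀).source → η y ∈ (extChartAt 𝓘(ℝ, E) x₁).source →
      ContDiffAt ℝ ∞ (extChartAt 𝓘(ℝ, E) x₁ ∘ η ∘ (extChartAt 𝓘(ℝ, E) x₀).symm)
        (extChartAt 𝓘(ℝ, E) x₀ y) := by
    intro η x₀ x₁ y hη h0 h1
    rw [← contMDiffAt_iff_contDiffAt]
    have hs : ContMDiffAt 𝓘(ℝ, E) 𝓘(ℝ, E) ∞ (extChartAt 𝓘(ℝ, E) x₀).symm
        (extChartAt 𝓘(ℝ, E) x₀ y) := (contMDiffOn_extChartAt_symm x₀).contMDiffAt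
      ((isOpen_extChartAt_target x₀).mem_nhds ((extChartAt 𝓘(ℝ, E) x₀).map_source h0))
    refine ContMDiffAt.comp (I' := 𝓘(ℝ, E)) (extChartAt 𝓘(ℝ, E) x₀ y) ?_
      (hη.contMDiffAt.comp (extChartAt 𝓘(ℝ, E) x₀ y) hs)
    rw [Function.comp_apply, (extChartAt 𝓘(ℝ, E) x₀).left_inv h0]
    exact contMDiffAt_extChartAt' (by simpa using h1)
  refine modelPoisson_comp_mfderiv (θ := φ₀ ∘ ξ ∘ φ.symm) (θ' := φ ∘ ξ' ∘ φ₀.symm) hd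
    ((smooth hξ haa hap).differentiableAt (by simp))
    (by rw [hx]; exact (smooth hξ' hap (by rw [hl]; exact haa)).of_le ENat.LEInfty.out)
    ?_ ?_ ?_ α β
  · filter_upwards [near1] with x hx
    simp [φ₀.left_inv hx.2, hl (φ.symm x), φ.right_inv hx.1]
  · rw [hx]
    filter_upwards [near2] with x hx
    simp [φ.left_inv hx.2, hr (φ₀.symm x), φ₀.right_inv hx.1]
  · filter_upwards [eventually_proj_extChartAt_cotangent a near1] with z hz
    simp only [writtenInExtChartAt, Function.comp_apply]
    rw [extChartAt_cotangent_symm_apply hz.1, extChartAt_cotangent_apply (by exact hz.2)]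
    refine Prod.ext rfl ?_
    ext v
    have := fderiv_written_in_charts (ξ := ξ') hz.2 (by rw [hl]; exact φ.map_target hz.1)
      (hξ'.mdifferentiableAt (by simp)) v
    rw [hl (φ.symm z.1)] at this
    exact congrArg z.2 this.symm

theorem extChartAt_cotangent_self (y : M) (β β₀ : E →L[ℝ] ℝ) :
    extChartAt (cotangentModel E) (⟨y, β₀⟩ : CotangentBundle E M) ⟨y, β⟩ =
      (extChartAt 𝓘(ℝ, E) y y, β) := by
  rw [extChartAt_cotangent_apply (by exact mem_extChartAt_source y)]
  refine Prod.ext rfl ?_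
  ext v
  have := mfderivWithin_range_extChartAt_symm (I := 𝓘(ℝ, E)) (x := y)
  rw [modelWithCornersSelf_coe, Set.range_id, mfderivWithin_univ] at this
  exact congrArg β (DFunLike.congr_fun this v)

theorem contMDiff_cotangent_fiber (y : M) :
    ContMDiff 𝓘(ℝ, E →L[ℝ] ℝ) (cotangentModel E) ∞
      (fun β : E →L[ℝ] ℝ => (⟨y, β⟩ : CotangentBundle E M)) := by
  intro β₀
  rw [Bundle.contMDiffAt_totalSpace]
  refine ⟨contMDiffAt_const, ?_⟩
  have : (fun β : E →L[ℝ] ℝ => (trivializationAt (E →L[ℝ] ℝ)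
      (fun x : M => Cotangent 𝓘(ℝ, E) x) y ⟨y, β⟩).2) = id := by
    ext1 β
    have := congrArg Prod.snd (extChartAt_cotangent_self y β β₀)
    rw [FiberBundle.extChartAt] at this
    simpa using this
  rw [this]
  exact contMDiffAt_id

theorem hasMFDerivAt_cotangent_fiber (y : M) (β₀ : E →L[ℝ] ℝ) :
    HasMFDerivAt 𝓘(ℝ, E →L[ℝ] ℝ) (cotangentModel E)
      (fun β : E →L[ℝ] ℝ => (⟨y, β⟩ : CotangentBundle E M)) β₀
      (ContinuousLinearMap.inr ℝ E (E →L[ℝ] ℝ)) := by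
  refine ⟨(contMDiff_cotangent_fiber y).continuous.continuousAt, ?_⟩
  have : writtenInExtChartAt 𝓘(ℝ, E →L[ℝ] ℝ) (cotangentModel E) β₀
      (fun β : E →L[ℝ] ℝ => (⟨y, β⟩ : CotangentBundle E M)) =
      fun β => (extChartAt 𝓘(ℝ, E) y y, β) := by
    ext1 β
    exact extChartAt_cotangent_self y β β₀
  rw [this]
  exact ((hasFDerivAt_const _ _).prodMk (hasFDerivAt_id _)).hasFDerivWithinAt

theorem extChartAt_cotangent_zero {y₀ y : M} (hy : y ∈ (extChartAt 𝓘(ℝ, E) y₀).source)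
    (β₀ : E →L[ℝ] ℝ) :
    extChartAt (cotangentModel E) (⟨y₀, β₀⟩ : CotangentBundle E M) ⟨y, 0⟩ =
      (extChartAt 𝓘(ℝ, E) y₀ y, 0) := by
  rw [extChartAt_cotangent_apply (by exact hy)]
  exact Prod.ext rfl (ContinuousLinearMap.zero_comp _)

theorem contMDiff_cotangent_zero :
    ContMDiff 𝓘(ℝ, E) (cotangentModel E) ∞ (fun y : M => (⟨y, 0⟩ : CotangentBundle E M)) :=
  Bundle.contMDiff_zeroSection ℝ (fun x : M => Cotangent 𝓘(ℝ, E) x)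

theorem hasMFDerivAt_cotangent_zero (y : M) :
    HasMFDerivAt 𝓘(ℝ, E) (cotangentModel E) (fun y : M => (⟨y, 0⟩ : CotangentBundle E M)) y
      (ContinuousLinearMap.inl ℝ E (E →L[ℝ] ℝ)) := by
  refine ⟨contMDiff_cotangent_zero.continuous.continuousAt, ?_⟩
  have : writtenInExtChartAt 𝓘(ℝ, E) (cotangentModel E) y
      (fun y : M => (⟨y, 0⟩ : CotangentBundle E M)) =ᶠ[𝓝 (extChartAt 𝓘(ℝ, E) y y)]
      fun x => (x, 0) := by
    filter_upwards [(isOpen_extChartAt_target y).mem_nhds (mem_extChartAt_target y)] with x hx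
    have := extChartAt_cotangent_zero ((extChartAt 𝓘(ℝ, E) y).map_target hx) 0
    rw [(extChartAt 𝓘(ℝ, E) y).right_inv hx] at this
    exact this
  exact (((hasFDerivAt_id _).prodMk (hasFDerivAt_const _ _)).congr_of_eventuallyEq
    this).hasFDerivWithinAt

theorem hasMFDerivAt_cotangent_proj (a : CotangentBundle E M) :
    HasMFDerivAt (cotangentModel E) 𝓘(ℝ, E) (fun a : CotangentBundle E M => a.proj) a
      (ContinuousLinearMap.fst ℝ E (E →L[ℝ] ℝ)) := by
  refine ⟨(Bundle.contMDiff_proj (n := ∞) (IB := 𝓘(ℝ, E))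
    (fun x : M => Cotangent 𝓘(ℝ, E) x)).continuous.continuousAt, ?_⟩
  have : writtenInExtChartAt (cotangentModel E) 𝓘(ℝ, E) a
      (fun a : CotangentBundle E M => a.proj) =ᶠ[𝓝 (extChartAt (cotangentModel E) a a)]
      Prod.fst := by
    filter_upwards [eventually_proj_extChartAt_cotangent a
      ((isOpen_extChartAt_target a.proj).mem_nhds (mem_extChartAt_target a.proj))] with z hz
    simp only [writtenInExtChartAt, Function.comp_apply]
    rw [extChartAt_cotangent_symm_apply hz]
    exact (extChartAt 𝓘(ℝ, E) a.proj).right_inv hz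
  exact (hasFDerivAt_fst.congr_of_eventuallyEq this).hasFDerivWithinAt

theorem verticalVector_eq (a : CotangentBundle E M) :
    verticalVector a = ((0, a.snd) : E × (E →L[ℝ] ℝ)) := by
  unfold verticalVector
  rw [(hasMFDerivAt_cotangent_fiber a.proj 0).mfderiv]
  rfl

end CotangentMaps

section DiffInChart

variable {V : Type*} [NormedAddCommGroup V] [NormedSpace ℝ V] {H : Type*} [TopologicalSpace H]
  {I : ModelWithCorners ℝ V H} [I.Boundaryless]
  {Z : Type*} [TopologicalSpace Z] [ChartedSpace H Z] [IsManifold I ∞ Z]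

theorem contMDiffAt_extChartAt_symm_self {z₀ : Z} {u : V}
    (hu : u ∈ (extChartAt I z₀).target) : ContMDiffAt 𝓘(ℝ, V) I ∞ (extChartAt I z₀).symm u :=
  (contMDiffOn_extChartAt_symm z₀).contMDiffAt ((isOpen_extChartAt_target z₀).mem_nhds hu)

theorem contDiffAt_comp_extChartAt_symm {W : Type*} [NormedAddCommGroup W] [NormedSpace ℝ W]
    {f : Z → W} {z₀ : Z} {u : V} (hu : u ∈ (extChartAt I z₀).target)
    (hf : ContMDiffAt I 𝓘(ℝ, W) ∞ f ((extChartAt I z₀).symm u)) :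
    ContDiffAt ℝ ∞ (f ∘ (extChartAt I z₀).symm) u := by
  rw [← contMDiffAt_iff_contDiffAt]
  exact ContMDiffAt.comp u hf (contMDiffAt_extChartAt_symm_self hu)

theorem diff_eq_fderiv_comp {f : Z → ℝ} {z₀ z : Z} (hz : z ∈ (extChartAt I z₀).source)
    (hf : MDifferentiableAt I 𝓘(ℝ, ℝ) f z) :
    diff I f z = (fderiv ℝ (f ∘ (extChartAt I z₀).symm) (extChartAt I z₀ z)).comp
      (mfderiv I 𝓘(ℝ, V) (extChartAt I z₀) z) := by
  have e := (extChartAt I z₀).left_inv hz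
  have h1 : MDifferentiableAt I 𝓘(ℝ, V) (extChartAt I z₀) z :=
    mdifferentiableAt_extChartAt (by simpa using hz)
  have h2 : MDifferentiableAt 𝓘(ℝ, V) 𝓘(ℝ, ℝ) (f ∘ (extChartAt I z₀).symm)
      (extChartAt I z₀ z) := by
    refine MDifferentiableAt.comp (I' := I) _ (by rwa [e]) ?_
    exact (contMDiffAt_extChartAt_symm_self ((extChartAt I z₀).map_source hz)).mdifferentiableAt
      (by simp)
  have h3 : f =ᶠ[𝓝 z] (f ∘ (extChartAt I z₀).symm) ∘ (extChartAt I z₀) := by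
    filter_upwards [(isOpen_extChartAt_source z₀).mem_nhds hz] with y hy
    rw [Function.comp_apply, Function.comp_apply, (extChartAt I z₀).left_inv hy]
  unfold diff
  rw [h3.mfderiv_eq, mfderiv_comp z h2 h1, ← mfderiv_eq_fderiv]
  rfl

end DiffInChart

section CanonicalBracket

variable {E : Type*} [NormedAddCommGroup E] [NormedSpace ℝ E]
  {M : Type*} [TopologicalSpace M] [ChartedSpace E M] [IsManifold 𝓘(ℝ, E) ∞ M]

section

variable [FiniteDimensional ℝ E]

theorem canonical_bracket_eq {f g : CotangentBundle E M → ℝ} {a₀ a : CotangentBundle E M}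
    (ha : a ∈ (extChartAt (cotangentModel E) a₀).source)
    (hf : MDifferentiableAt (cotangentModel E) 𝓘(ℝ, ℝ) f a)
    (hg : MDifferentiableAt (cotangentModel E) 𝓘(ℝ, ℝ) g a) :
    bracket (canonicalPoisson E M) f g a =
      constBracket (modelPoisson E) (f ∘ (extChartAt (cotangentModel E) a₀).symm)
        (g ∘ (extChartAt (cotangentModel E) a₀).symm) (extChartAt (cotangentModel E) a₀ a) := by
  unfold bracket
  rw [diff_eq_fderiv_comp ha hf, diff_eq_fderiv_comp ha hg]
  exact modelPoisson_comp_mfderiv_extChartAt ha _ _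

theorem canonical_bracket_comp_symm {f g : CotangentBundle E M → ℝ} {a₀ : CotangentBundle E M}
    {u : E × (E →L[ℝ] ℝ)} (hu : u ∈ (extChartAt (cotangentModel E) a₀).target)
    (hf : ContMDiff (cotangentModel E) 𝓘(ℝ, ℝ) ∞ f)
    (hg : ContMDiff (cotangentModel E) 𝓘(ℝ, ℝ) ∞ g) :
    (bracket (canonicalPoisson E M) f g ∘ (extChartAt (cotangentModel E) a₀).symm) =ᶠ[𝓝 u]
      constBracket (modelPoisson E) (f ∘ (extChartAt (cotangentModel E) a₀).symm)
        (g ∘ (extChartAt (cotangentModel E) a₀).symm) := by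
  filter_upwards [(isOpen_extChartAt_target a₀).mem_nhds hu] with v hv
  rw [Function.comp_apply, canonical_bracket_eq ((extChartAt (cotangentModel E) a₀).map_target hv)
    (hf.mdifferentiableAt (by simp)) (hg.mdifferentiableAt (by simp)),
    (extChartAt (cotangentModel E) a₀).right_inv hv]

theorem contMDiff_canonical_bracket {f g : CotangentBundle E M → ℝ}
    (hf : ContMDiff (cotangentModel E) 𝓘(ℝ, ℝ) ∞ f)
    (hg : ContMDiff (cotangentModel E) 𝓘(ℝ, ℝ) ∞ g) :
    ContMDiff (cotangentModel E) 𝓘(ℝ, ℝ) ∞ (bracket (canonicalPoisson E M) f g) := by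
  intro a
  set c := extChartAt (cotangentModel E) a
  have hs : a ∈ c.source := mem_extChartAt_source a
  have hu := c.map_source hs
  have h1 : ContDiffAt ℝ ∞ (bracket (canonicalPoisson E M) f g ∘ c.symm) (c a) :=
    (ContDiffAt.constBracket _ (contDiffAt_comp_extChartAt_symm hu (hf _))
      (contDiffAt_comp_extChartAt_symm hu (hg _))).congr_of_eventuallyEq
      (canonical_bracket_comp_symm hu hf hg)
  have h2 : bracket (canonicalPoisson E M) f g =ᶠ[𝓝 a]
      (bracket (canonicalPoisson E M) f g ∘ c.symm) ∘ c := by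
    filter_upwards [(isOpen_extChartAt_source a).mem_nhds hs] with y hy
    rw [Function.comp_apply, Function.comp_apply, (extChartAt (cotangentModel E) a).left_inv hy]
  exact ((h1.contMDiffAt).comp a contMDiffAt_extChartAt).congr_of_eventuallyEq h2

theorem canonical_jacobi {f g h : CotangentBundle E M → ℝ}
    (hf : ContMDiff (cotangentModel E) 𝓘(ℝ, ℝ) ∞ f)
    (hg : ContMDiff (cotangentModel E) 𝓘(ℝ, ℝ) ∞ g)
    (hh : ContMDiff (cotangentModel E) 𝓘(ℝ, ℝ) ∞ h) (a : CotangentBundle E M) :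
    bracket (canonicalPoisson E M) f (bracket (canonicalPoisson E M) g h) a
      + bracket (canonicalPoisson E M) g (bracket (canonicalPoisson E M) h f) a
      + bracket (canonicalPoisson E M) h (bracket (canonicalPoisson E M) f g) a = 0 := by
  set c := extChartAt (cotangentModel E) a
  have hs : a ∈ c.source := mem_extChartAt_source a
  have hu := c.map_source hs
  have key : ∀ {f g h : CotangentBundle E M → ℝ}, ContMDiff (cotangentModel E) 𝓘(ℝ, ℝ) ∞ f →
      ContMDiff (cotangentModel E) 𝓘(ℝ, ℝ) ∞ g → ContMDiff (cotangentModel E) 𝓘(ℝ, ℝ) ∞ h →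
      bracket (canonicalPoisson E M) f (bracket (canonicalPoisson E M) g h) a =
      constBracket (modelPoisson E) (f ∘ c.symm)
        (constBracket (modelPoisson E) (g ∘ c.symm) (h ∘ c.symm)) (c a) := by
    intro f g h hf hg hh
    rw [canonical_bracket_eq hs (hf.mdifferentiableAt (by simp))
      ((contMDiff_canonical_bracket hg hh).mdifferentiableAt (by simp))]
    unfold constBracket
    exact congrArg _ (canonical_bracket_comp_symm hu hg hh).fderiv_eq
  rw [key hf hg hh, key hg hh hf, key hh hf hg]
  exact constBracket_jacobi _ modelPoisson_skew (contDiffAt_comp_extChartAt_symm hu (hf _))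
      (contDiffAt_comp_extChartAt_symm hu (hg _)) (contDiffAt_comp_extChartAt_symm hu (hh _))

/-- Multiplication by `t` in the fibres of the cotangent bundle. -/
def fiberScale (t : ℝ) (a : CotangentBundle E M) : CotangentBundle E M := ⟨a.proj, t • a.snd⟩

/-- The bracket of two functions that are homogeneous of degree one on the fibres is homogeneous
of degree one. -/
theorem canonical_bracket_homogeneous {f g : CotangentBundle E M → ℝ}
    (hf : ContMDiff (cotangentModel E) 𝓘(ℝ, ℝ) ∞ f)
    (hg : ContMDiff (cotangentModel E) 𝓘(ℝ, ℝ) ∞ g) {t : ℝ} (ht : t ≠ 0)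
    (hft : ∀ a, f (fiberScale t a) = t * f a) (hgt : ∀ a, g (fiberScale t a) = t * g a)
    (a : CotangentBundle E M) :
    bracket (canonicalPoisson E M) f g (fiberScale t a)
      = t * bracket (canonicalPoisson E M) f g a := by
  set c := extChartAt (cotangentModel E) a
  have hs : a ∈ c.source := mem_extChartAt_source a
  have hs' : fiberScale t a ∈ c.source :=
    (mem_extChartAt_cotangent_source _ _).2 (mem_extChartAt_source a.proj)
  have hu := c.map_source hs
  have hu' := c.map_source hs'
  let S : (E × (E →L[ℝ] ℝ)) →L[ℝ] (E × (E →L[ℝ] ℝ)) :=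
    (ContinuousLinearMap.fst ℝ _ _).prod (t • ContinuousLinearMap.snd ℝ _ _)
  have hS : S (c a) = c (fiberScale t a) := by
    simp only [c]
    rw [extChartAt_cotangent_apply (by exact mem_extChartAt_source a.proj),
      extChartAt_cotangent_apply (by exact mem_extChartAt_source a.proj)]
    refine Prod.ext rfl ?_
    ext v
    rfl
  have key : ∀ {f : CotangentBundle E M → ℝ}, ContMDiff (cotangentModel E) 𝓘(ℝ, ℝ) ∞ f →
      (∀ a, f (fiberScale t a) = t * f a) →
      (fderiv ℝ (f ∘ c.symm) (c (fiberScale t a))).comp S = t • fderiv ℝ (f ∘ c.symm) (c a) := by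
    intro f hf hft
    have d1 : HasFDerivAt (f ∘ c.symm) (fderiv ℝ (f ∘ c.symm) (S (c a))) (S (c a)) := by
      rw [hS]
      exact ((contDiffAt_comp_extChartAt_symm hu' (hf _)).differentiableAt
        (by simp)).hasFDerivAt
    have d2 := d1.comp (c a) S.hasFDerivAt
    have d3 : HasFDerivAt (fun u => t • (f ∘ c.symm) u) (t • fderiv ℝ (f ∘ c.symm) (c a)) (c a) :=
      ((contDiffAt_comp_extChartAt_symm hu (hf _)).differentiableAt
        (by simp)).hasFDerivAt.const_smul t
    rw [← hS]
    refine d2.unique (d3.congr_of_eventuallyEq ?_)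
    filter_upwards [(isOpen_extChartAt_target a).mem_nhds hu] with u hu
    have hu1 : u.1 ∈ (extChartAt 𝓘(ℝ, E) a.proj).target := (extChartAt_cotangent_target a u).1 hu
    simp only [Function.comp_apply, c]
    rw [extChartAt_cotangent_symm_apply hu1, extChartAt_cotangent_symm_apply (by exact hu1),
      smul_eq_mul, ← hft]
    congr 1
  rw [canonical_bracket_eq hs (hf.mdifferentiableAt (by simp)) (hg.mdifferentiableAt (by simp)),
    canonical_bracket_eq hs' (hf.mdifferentiableAt (by simp)) (hg.mdifferentiableAt (by simp))]
  have hSw : ∀ α β : (E × (E →L[ℝ] ℝ)) →L[ℝ] ℝ,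
      modelPoisson E (α.comp S) (β.comp S) = t * modelPoisson E α β := by
    intro α β
    have h0 : ∀ q : E →L[ℝ] ℝ, S (0, q) = t • ((0 : E), q) := fun q => by
      simp [S]
    have h1 : ∀ γ : (E × (E →L[ℝ] ℝ)) →L[ℝ] ℝ,
        (γ.comp S).comp (ContinuousLinearMap.inl ℝ E (E →L[ℝ] ℝ)) =
          γ.comp (ContinuousLinearMap.inl ℝ E (E →L[ℝ] ℝ)) := fun γ => by
      ext v; simp [S]
    simp only [modelPoisson_apply, h1]
    simp only [ContinuousLinearMap.comp_apply, h0, map_smul, smul_eq_mul]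
    ring
  have h := hSw (fderiv ℝ (f ∘ c.symm) (c (fiberScale t a)))
    (fderiv ℝ (g ∘ c.symm) (c (fiberScale t a)))
  rw [key hf hft, key hg hgt] at h
  simp only [map_smul, LinearMap.smul_apply, smul_eq_mul] at h
  exact (mul_left_cancel₀ ht h).symm

end

theorem diff_cotangent_fiber {f : CotangentBundle E M → ℝ} {y : M} {β : E →L[ℝ] ℝ}
    (hf : MDifferentiableAt (cotangentModel E) 𝓘(ℝ, ℝ) f ⟨y, β⟩) (q : E →L[ℝ] ℝ) :
    diff (cotangentModel E) f ⟨y, β⟩ ((0, q) : E × (E →L[ℝ] ℝ)) =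
      fderiv ℝ (fun β : E →L[ℝ] ℝ => f ⟨y, β⟩) β q := by
  have h := HasMFDerivAt.comp (f := fun β : E →L[ℝ] ℝ => (⟨y, β⟩ : CotangentBundle E M))
    β hf.hasMFDerivAt (hasMFDerivAt_cotangent_fiber y β)
  have := h.mfderiv
  rw [mfderiv_eq_fderiv] at this
  exact (DFunLike.congr_fun this q).symm

theorem diff_cotangent_fiber_of_linear {f : CotangentBundle E M → ℝ} {y : M} {β : E →L[ℝ] ℝ}
    (hf : MDifferentiableAt (cotangentModel E) 𝓘(ℝ, ℝ) f ⟨y, β⟩) {ξ : E}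
    (hξ : ∀ β : E →L[ℝ] ℝ, f ⟨y, β⟩ = β ξ) (q : E →L[ℝ] ℝ) :
    diff (cotangentModel E) f ⟨y, β⟩ ((0, q) : E × (E →L[ℝ] ℝ)) = q ξ := by
  rw [diff_cotangent_fiber hf]
  have e : (fun β : E →L[ℝ] ℝ => f ⟨y, β⟩) = ContinuousLinearMap.apply ℝ ℝ ξ := funext hξ
  rw [e, ContinuousLinearMap.fderiv]
  rfl

theorem diff_cotangent_proj {h : M → ℝ} {a : CotangentBundle E M}
    (hh : MDifferentiableAt 𝓘(ℝ, E) 𝓘(ℝ, ℝ) h a.proj) :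
    diff (cotangentModel E) (fun a : CotangentBundle E M => h a.proj) a =
      (diff 𝓘(ℝ, E) h a.proj).comp (ContinuousLinearMap.fst ℝ E (E →L[ℝ] ℝ)) :=
  (hh.hasMFDerivAt.comp a (hasMFDerivAt_cotangent_proj a)).mfderiv

theorem canonical_bracket_proj_proj {h k : M → ℝ} {a : CotangentBundle E M}
    (hh : MDifferentiableAt 𝓘(ℝ, E) 𝓘(ℝ, ℝ) h a.proj)
    (hk : MDifferentiableAt 𝓘(ℝ, E) 𝓘(ℝ, ℝ) k a.proj) :
    bracket (canonicalPoisson E M) (fun a => h a.proj) (fun a => k a.proj) a = 0 := by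
  unfold bracket
  rw [diff_cotangent_proj hh, diff_cotangent_proj hk]
  have h0 : ∀ l : E →L[ℝ] ℝ, l 0 = 0 := fun l => map_zero l
  exact (congrArg₂ (· - ·) (h0 _) (h0 _)).trans (sub_zero _)

theorem canonical_bracket_linear_proj {f : CotangentBundle E M → ℝ} {h : M → ℝ}
    {a : CotangentBundle E M} (hf : MDifferentiableAt (cotangentModel E) 𝓘(ℝ, ℝ) f a)
    (hh : MDifferentiableAt 𝓘(ℝ, E) 𝓘(ℝ, ℝ) h a.proj) {ξ : E}
    (hξ : ∀ β : E →L[ℝ] ℝ, f ⟨a.proj, β⟩ = β ξ) :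
    bracket (canonicalPoisson E M) f (fun a => h a.proj) a = - diff 𝓘(ℝ, E) h a.proj ξ := by
  unfold bracket
  rw [diff_cotangent_proj hh]
  have h1 := diff_cotangent_fiber_of_linear (E := E) (y := a.proj) (β := a.snd) hf hξ
    (diff 𝓘(ℝ, E) h a.proj)
  have h0 : ∀ l : E →L[ℝ] ℝ, l 0 = 0 := fun l => map_zero l
  exact (congrArg₂ (· - ·) (h0 _) h1).trans (zero_sub _)

end CanonicalBracket

section Submersions

variable {V : Type*} [NormedAddCommGroup V] [NormedSpace ℝ V] {H : Type*} [TopologicalSpace H]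
  {I : ModelWithCorners ℝ V H} [I.Boundaryless]
  {Z : Type*} [TopologicalSpace Z] [ChartedSpace H Z] [IsManifold I ∞ Z]
  {V' : Type*} [NormedAddCommGroup V'] [NormedSpace ℝ V'] {H' : Type*} [TopologicalSpace H']
  {I' : ModelWithCorners ℝ V' H'} [I'.Boundaryless]
  {Z' : Type*} [TopologicalSpace Z'] [ChartedSpace H' Z'] [IsManifold I' ∞ Z']
  {W : Type*} [NormedAddCommGroup W] [NormedSpace ℝ W] {K : Type*} [TopologicalSpace K]
  {J : ModelWithCorners ℝ W K}
  {N : Type*} [TopologicalSpace N] [ChartedSpace K N]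

/-- A smooth map with surjective differential has a smooth local section. -/
theorem exists_local_section [FiniteDimensional ℝ V'] {f : Z → Z'} {x : Z}
    (hf : ContMDiffAt I I' ∞ f x) (hs : Function.Surjective (mfderiv I I' f x)) :
    ∃ σ : Z' → Z, ContMDiffAt I' I ∞ σ (f x) ∧ σ (f x) = x ∧ ∀ᶠ y in 𝓝 (f x), f (σ y) = y := by
  set φ := extChartAt I x with hφ
  set φ' := extChartAt I' (f x) with hφ'
  have hF : ContDiffAt ℝ ∞ (φ' ∘ f ∘ φ.symm) (φ x) := by
    have := (contMDiffAt_iff.1 hf).2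
    rwa [ModelWithCorners.Boundaryless.range_eq_univ, contDiffWithinAt_univ] at this
  have hD : mfderiv I I' f x = fderiv ℝ (φ' ∘ f ∘ φ.symm) (φ x) := by
    rw [(hf.mdifferentiableAt (by simp)).mfderiv, ModelWithCorners.Boundaryless.range_eq_univ,
      fderivWithin_univ]
    rfl
  rw [hD] at hs
  obtain ⟨s₀, hs₀⟩ := (fderiv ℝ (φ' ∘ f ∘ φ.symm) (φ x)).toLinearMap.exists_rightInverse_of_surjective
    (LinearMap.range_eq_top.2 hs)
  let s : V' →L[ℝ] V := LinearMap.toContinuousLinearMap s₀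
  have hsF : ∀ w, fderiv ℝ (φ' ∘ f ∘ φ.symm) (φ x) (s w) = w := fun w =>
    LinearMap.congr_fun hs₀ w
  have hA : ContDiffAt ℝ ∞ (fun w : V' => φ x + s w) 0 :=
    contDiffAt_const.add s.contDiff.contDiffAt
  have hA0 : φ x + s 0 = φ x := by simp
  have hG : ContDiffAt ℝ ∞ ((φ' ∘ f ∘ φ.symm) ∘ fun w : V' => φ x + s w) 0 :=
    ContDiffAt.comp _ (by rw [hA0]; exact hF) hA
  have hG' : HasFDerivAt ((φ' ∘ f ∘ φ.symm) ∘ fun w : V' => φ x + s w)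
      ((ContinuousLinearEquiv.refl ℝ V' : V' ≃L[ℝ] V') : V' →L[ℝ] V') 0 := by
    have h1 : HasFDerivAt (φ' ∘ f ∘ φ.symm) (fderiv ℝ (φ' ∘ f ∘ φ.symm) (φ x)) (φ x + s 0) := by
      rw [hA0]; exact (hF.differentiableAt (by simp)).hasFDerivAt
    have h2 := h1.comp (0 : V') (s.hasFDerivAt.const_add (φ x))
    convert h2 using 1
    ext w
    exact (hsF w).symm
  have : CompleteSpace V' := FiniteDimensional.complete ℝ V'
  let L := hG.localInverse hG' (by simp)
  have hG0 : ((φ' ∘ f ∘ φ.symm) ∘ fun w : V' => φ x + s w) 0 = φ' (f x) := by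
    simp only [Function.comp_apply, map_zero, add_zero]
    rw [hφ, extChartAt_to_inv]
  have hL : ContDiffAt ℝ ∞ L (φ' (f x)) := by
    rw [← hG0]; exact hG.to_localInverse hG' (by simp)
  have hL0 : L (φ' (f x)) = 0 := by
    rw [← hG0]; exact (hG.hasStrictFDerivAt' hG' (by simp)).localInverse_apply_image
  have hLr : ∀ᶠ w in 𝓝 (φ' (f x)), (φ' ∘ f ∘ φ.symm) (φ x + s (L w)) = w := by
    rw [← hG0]; exact (hG.hasStrictFDerivAt' hG' (by simp)).eventually_right_inverse
  have hx0 : φ.symm (φ x + s (L (φ' (f x)))) = x := by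
    rw [hL0, map_zero, add_zero, hφ, extChartAt_to_inv]
  have hσ : ContMDiffAt I' I ∞ (fun y => φ.symm (φ x + s (L (φ' y)))) (f x) := by
    have h1 : ContMDiffAt I' 𝓘(ℝ, V) ∞ (fun y => φ x + s (L (φ' y))) (f x) := by
      have : ContDiffAt ℝ ∞ (fun w => φ x + s (L w)) (φ' (f x)) :=
        contDiffAt_const.add (s.contDiff.contDiffAt.comp _ hL)
      exact this.contMDiffAt.comp (f x) contMDiffAt_extChartAt
    refine ContMDiffAt.comp (I' := 𝓘(ℝ, V)) (f x) ?_ h1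
    refine contMDiffAt_extChartAt_symm_self ?_
    rw [hL0, map_zero, add_zero]
    exact mem_extChartAt_target x
  refine ⟨_, hσ, hx0, ?_⟩
  have h1 : ∀ᶠ y in 𝓝 (f x), (φ' ∘ f ∘ φ.symm) (φ x + s (L (φ' y))) = φ' y :=
    (continuousAt_extChartAt (f x)).eventually hLr
  have h2 : ∀ᶠ y in 𝓝 (f x), f (φ.symm (φ x + s (L (φ' y)))) ∈ φ'.source := by
    have : ContinuousAt (fun y => f (φ.symm (φ x + s (L (φ' y))))) (f x) := by
      refine ContinuousAt.comp (f := fun y => φ.symm (φ x + s (L (φ' y)))) ?_ hσ.continuousAt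
      rw [hx0]; exact hf.continuousAt
    refine this.eventually_mem ?_
    rw [hx0]
    exact extChartAt_source_mem_nhds (f x)
  filter_upwards [h1, h2, extChartAt_source_mem_nhds (I := I') (f x)] with y h1 h2 h3
  exact φ'.injOn h2 h3 h1

/-- Smoothness descends along submersions. -/
theorem contMDiffAt_of_comp_submersion [FiniteDimensional ℝ V'] {f : Z → Z'} {x : Z}
    (hf : ContMDiffAt I I' ∞ f x) (hs : Function.Surjective (mfderiv I I' f x)) {g : Z' → N}
    (hg : ContMDiffAt I J ∞ (g ∘ f) x) : ContMDiffAt I' J ∞ g (f x) := by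
  obtain ⟨σ, hσ, hx, hr⟩ := exists_local_section hf hs
  have h : ContMDiffAt I' J ∞ ((g ∘ f) ∘ σ) (f x) :=
    ContMDiffAt.comp (f x) (by rwa [hx]) hσ
  refine h.congr_of_eventuallyEq ?_
  filter_upwards [hr] with y hy
  simp [hy]

theorem contMDiff_of_comp_submersion [FiniteDimensional ℝ V'] {f : Z → Z'}
    (hf : IsSmoothSubmersion (I := I) (I' := I') f) (hsurj : Function.Surjective f) {g : Z' → N}
    (hg : ContMDiff I J ∞ (g ∘ f)) : ContMDiff I' J ∞ g := by
  intro y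
  obtain ⟨x, rfl⟩ := hsurj y
  exact contMDiffAt_of_comp_submersion (hf.1 x) (hf.2 x) (hg x)

/-- A map with a differentiable local section through a point has surjective differential there. -/
theorem surjective_mfderiv_of_section {f : Z → Z'} {σ : Z' → Z} {y : Z'}
    (hf : MDifferentiableAt I I' f (σ y)) (hσ : MDifferentiableAt I' I σ y)
    (h : ∀ᶠ z in 𝓝 y, f (σ z) = z) : Function.Surjective (mfderiv I I' f (σ y)) := by
  intro v
  have h1 : mfderiv I' I' (f ∘ σ) y = ContinuousLinearMap.id ℝ _ := by
    have : (f ∘ σ) =ᶠ[𝓝 y] id := h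
    rw [this.mfderiv_eq, mfderiv_id]
  have h2 := mfderiv_comp y hf hσ
  refine ⟨mfderiv I' I σ y v, ?_⟩
  exact (DFunLike.congr_fun (h2.symm.trans h1) v)

end Submersions

section Action

variable {EG : Type*} [NormedAddCommGroup EG] [NormedSpace ℝ EG]
  {G : Type*} [Group G] [TopologicalSpace G] [ChartedSpace EG G] [LieGroup 𝓘(ℝ, EG) ∞ G]
  {EP : Type*} [NormedAddCommGroup EP] [NormedSpace ℝ EP]
  {P : Type*} [TopologicalSpace P] [ChartedSpace EP P] [IsManifold 𝓘(ℝ, EP) ∞ P]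
  [MulAction Gᵐᵒᵖ P]
  {EB : Type*} [NormedAddCommGroup EB] [NormedSpace ℝ EB]
  {B : Type*} [TopologicalSpace B] [ChartedSpace EB B]

theorem rightMul_one (y : P) : rightMul (1 : G) y = y := one_smul _ y

theorem rightMul_rightMul (g h : G) (y : P) : rightMul h (rightMul g y) = rightMul (g * h) y := by
  simp [rightMul, mul_smul]

theorem rightMul_inv_rightMul (g : G) (y : P) : rightMul g⁻¹ (rightMul g y) = y := by
  rw [rightMul_rightMul, mul_inv_cancel, rightMul_one]

theorem rightMul_rightMul_inv (g : G) (y : P) : rightMul g (rightMul g⁻¹ y) = y := by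
  rw [rightMul_rightMul, inv_mul_cancel, rightMul_one]

theorem cotangent_ext {y y' : P} (h : y = y') {α α' : EP →L[ℝ] ℝ} (h' : α = α') :
    (⟨y, α⟩ : CotangentBundle EP P) = ⟨y', α'⟩ := by
  subst h h'; rfl

variable {p : P → B}

theorem IsPrincipalBundle.contMDiff_rightMul
    (hp : IsPrincipalBundle (EG := EG) (EP := EP) (EB := EB) G p) (g : G) :
    ContMDiff 𝓘(ℝ, EP) 𝓘(ℝ, EP) ∞ (rightMul g : P → P) :=
  hp.smooth_action.comp (contMDiff_id.prodMk contMDiff_const)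

theorem cotangentLift_one (a : CotangentBundle EP P) : cotangentLift (1 : G) a = a := by
  refine cotangent_ext (EP := EP) (rightMul_one _) ?_
  have h : (rightMul (1 : G)⁻¹ : P → P) = id := by
    funext y; rw [inv_one, rightMul_one]; rfl
  have key := mfderiv_id (I := 𝓘(ℝ, EP)) (x := rightMul (1 : G) a.proj)
  rw [← h] at key
  ext v
  exact congrArg (show EP →L[ℝ] ℝ from a.snd) (DFunLike.congr_fun key v)

theorem IsPrincipalBundle.cotangentLift_cotangentLift
    (hp : IsPrincipalBundle (EG := EG) (EP := EP) (EB := EB) G p) (g h : G)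
    (a : CotangentBundle EP P) :
    cotangentLift h (cotangentLift g a) = cotangentLift (g * h) a := by
  refine cotangent_ext (EP := EP) (rightMul_rightMul g h _) ?_
  have hf : (rightMul (g * h)⁻¹ : P → P) = rightMul g⁻¹ ∘ rightMul h⁻¹ := by
    funext y; rw [Function.comp_apply, rightMul_rightMul, mul_inv_rev]
  have hy : rightMul h⁻¹ (rightMul (g * h) a.proj) = rightMul g a.proj := by
    rw [← rightMul_rightMul, rightMul_inv_rightMul]
  have key := mfderiv_comp (I := 𝓘(ℝ, EP)) (I' := 𝓘(ℝ, EP)) (I'' := 𝓘(ℝ, EP))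
    (rightMul (g * h) a.proj)
    ((hp.contMDiff_rightMul g⁻¹).mdifferentiableAt (by simp))
    ((hp.contMDiff_rightMul h⁻¹).mdifferentiableAt (x := rightMul (g * h) a.proj) (by simp))
  rw [← hf, hy] at key
  ext v
  have hy' : (cotangentLift g a).proj = rightMul g a.proj := rfl
  rw [hy', rightMul_rightMul]
  exact congrArg (show EP →L[ℝ] ℝ from a.snd) (DFunLike.congr_fun key v).symm

theorem IsPrincipalBundle.contMDiff_cotangentLift
    (hp : IsPrincipalBundle (EG := EG) (EP := EP) (EB := EB) G p) :
    ContMDiff ((cotangentModel EP).prod 𝓘(ℝ, EG)) (cotangentModel EP) ∞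
      (fun x : CotangentBundle EP P × G => cotangentLift x.2 x.1) := by
  intro x₀
  have hproj : ContMDiff ((cotangentModel EP).prod 𝓘(ℝ, EG)) 𝓘(ℝ, EP) ∞
      (fun x : CotangentBundle EP P × G => x.1.proj) :=
    (Bundle.contMDiff_proj (fun x : P => Cotangent 𝓘(ℝ, EP) x)).comp contMDiff_fst
  have hbase : ContMDiff ((cotangentModel EP).prod 𝓘(ℝ, EG)) 𝓘(ℝ, EP) ∞
      (fun x : CotangentBundle EP P × G => rightMul x.2 x.1.proj) :=
    hp.smooth_action.comp (hproj.prodMk contMDiff_snd)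
  rw [contMDiffAt_hom_bundle]
  refine ⟨hbase x₀, ?_⟩
  have hid : ContMDiffAt ((cotangentModel EP).prod 𝓘(ℝ, EG)) (cotangentModel EP) ∞
      (fun x : CotangentBundle EP P × G => x.1) x₀ := contMDiffAt_fst
  rw [contMDiffAt_hom_bundle] at hid
  have hinv : ContMDiff (((cotangentModel EP).prod 𝓘(ℝ, EG)).prod 𝓘(ℝ, EP)) 𝓘(ℝ, EP) ∞
      (Function.uncurry fun (x : CotangentBundle EP P × G) (y : P) => rightMul x.2⁻¹ y) :=
    hp.smooth_action.comp (contMDiff_snd.prodMk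
      ((contMDiff_inv 𝓘(ℝ, EG) ∞).comp (contMDiff_snd.comp contMDiff_fst)))
  have hD := ContMDiffAt.mfderiv (x₀ := x₀)
    (fun (x : CotangentBundle EP P × G) (y : P) => rightMul x.2⁻¹ y)
    (fun x => rightMul x.2 x.1.proj) (hinv _) (hbase x₀) (m := ∞) (by simp)
  refine (hid.2.clm_comp hD).congr_of_eventuallyEq ?_
  have hmem : ∀ᶠ x in 𝓝 x₀, x.1.proj ∈
      (trivializationAt EP (TangentSpace 𝓘(ℝ, EP)) x₀.1.proj).baseSet :=
    hproj.continuous.continuousAt.eventually_mem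
      ((trivializationAt EP (TangentSpace 𝓘(ℝ, EP)) x₀.1.proj).open_baseSet.mem_nhds
        (FiberBundle.mem_baseSet_trivializationAt' _))
  filter_upwards [hmem] with x hx
  ext v
  have key : ∀ y₀' y' : P, y₀' = x₀.1.proj → y' = x.1.proj → ∀ w : EP,
      ((trivializationAt EP (TangentSpace 𝓘(ℝ, EP)) x₀.1.proj).symmL ℝ x.1.proj
        ((trivializationAt EP (TangentSpace 𝓘(ℝ, EP)) y₀').continuousLinearMapAt ℝ y' w) : EP)
        = w := by
    rintro _ _ rfl rfl w
    exact Bundle.Trivialization.symmL_continuousLinearMapAt _ hx w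
  have htriv : ∀ y y' : P, ∀ t : ℝ,
      (trivializationAt ℝ (fun _ : P => ℝ) y).continuousLinearMapAt ℝ y' t = t := fun y y' t => by
    simp
  simp only [inTangentCoordinates, ContinuousLinearMap.inCoordinates]
  refine (htriv _ _ _).trans (Eq.trans ?_ (htriv _ _ _).symm)
  exact (congrArg (show EP →L[ℝ] ℝ from x.1.snd)
    (key _ _ (rightMul_inv_rightMul x₀.2 x₀.1.proj) (rightMul_inv_rightMul x.2 x.1.proj) _)).symm

end Action

section Quotient

variable {EG : Type*} [NormedAddCommGroup EG] [NormedSpace ℝ EG]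
  {G : Type*} [Group G] [TopologicalSpace G] [ChartedSpace EG G] [LieGroup 𝓘(ℝ, EG) ∞ G]
  {EP : Type*} [NormedAddCommGroup EP] [NormedSpace ℝ EP]
  {P : Type*} [TopologicalSpace P] [ChartedSpace EP P] [IsManifold 𝓘(ℝ, EP) ∞ P]
  [MulAction Gᵐᵒᵖ P]
  {EB : Type*} [NormedAddCommGroup EB] [NormedSpace ℝ EB]
  {B : Type*} [TopologicalSpace B] [ChartedSpace EB B]
  {p : P → B}

theorem quotientMap_surjective : Function.Surjective (quotientMap G EP P) := Quot.mk_surjective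

theorem IsPrincipalBundle.quotientMap_cotangentLift (g : G) (a : CotangentBundle EP P) :
    quotientMap G EP P (cotangentLift g a) = quotientMap G EP P a :=
  (Quot.sound ⟨g, rfl⟩).symm

theorem IsPrincipalBundle.quotientMap_eq_iff
    (hp : IsPrincipalBundle (EG := EG) (EP := EP) (EB := EB) G p) {a a' : CotangentBundle EP P} :
    quotientMap G EP P a = quotientMap G EP P a' ↔ ∃ g : G, a' = cotangentLift g a := by
  refine ⟨fun h => ?_, fun ⟨g, hg⟩ => Quot.sound ⟨g, hg⟩⟩
  have he : Equivalence
      (fun a a' : CotangentBundle EP P => ∃ g : G, a' = cotangentLift g a) := by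
    refine ⟨fun a => ⟨1, (cotangentLift_one a).symm⟩, ?_, ?_⟩
    · rintro a _ ⟨g, rfl⟩
      refine ⟨g⁻¹, ?_⟩
      rw [hp.cotangentLift_cotangentLift, mul_inv_cancel, cotangentLift_one]
    · rintro a _ _ ⟨g, rfl⟩ ⟨h, rfl⟩
      exact ⟨g * h, hp.cotangentLift_cotangentLift g h a⟩
  exact he.eqvGen_iff.1 (Quot.eqvGen_exact h)

/-- The projection `T*P/G → B`. -/
def quotientProj (hp : IsPrincipalBundle (EG := EG) (EP := EP) (EB := EB) G p) :
    CotangentQuotient G EP P → B :=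
  Quot.lift (fun a => p a.proj) (by
    rintro a _ ⟨g, rfl⟩
    exact (hp.proj_rightMul g a.proj).symm)

theorem quotientProj_quotientMap
    (hp : IsPrincipalBundle (EG := EG) (EP := EP) (EB := EB) G p) (a : CotangentBundle EP P) :
    quotientProj hp (quotientMap G EP P a) = p a.proj := rfl

theorem IsPrincipalBundle.exists_slice
    (hp : IsPrincipalBundle (EG := EG) (EP := EP) (EB := EB) G p) (b₀ : B) :
    ∃ (U : Set B) (s : B → P) (h : P → G), IsOpen U ∧ b₀ ∈ U ∧
      ContMDiffOn 𝓘(ℝ, EB) 𝓘(ℝ, EP) ∞ s U ∧ (∀ b ∈ U, p (s b) = b) ∧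
      ContMDiffOn 𝓘(ℝ, EP) 𝓘(ℝ, EG) ∞ h (p ⁻¹' U) ∧
      (∀ y, p y ∈ U → ∀ g, h (rightMul g y) = h y * g) ∧
      (∀ b ∈ U, h (s b) = 1) ∧ (∀ y, p y ∈ U → rightMul (h y) (s (p y)) = y) := by
  obtain ⟨U, Ψ, hU, hb, hsrc, htgt, hΨ, hΨs, h1, h2⟩ := hp.locally_trivial b₀
  have hmem : ∀ b ∈ U, ∀ g : G, (b, g) ∈ Ψ.target := fun b hb g => by rw [htgt]; exact ⟨hb, trivial⟩
  have hsrc' : ∀ y, p y ∈ U → y ∈ Ψ.source := fun y hy => by rw [hsrc]; exact hy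
  have hΨ1 : ∀ b ∈ U, Ψ (Ψ.symm (b, 1)) = (b, 1) := fun b hb => Ψ.right_inv (hmem b hb 1)
  have hps : ∀ b ∈ U, p (Ψ.symm (b, 1)) = b := fun b hb => by
    rw [← h1 _ (Ψ.map_target (hmem b hb 1)), hΨ1 b hb]
  refine ⟨U, fun b => Ψ.symm (b, 1), fun y => (Ψ y).2, hU, hb, ?_, hps, ?_, ?_, ?_, ?_⟩
  · exact hΨs.comp (contMDiffOn_id.prodMk contMDiffOn_const) (fun b hb => hmem b hb 1)
  · rw [← hsrc]
    exact contMDiff_snd.comp_contMDiffOn hΨ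
  · exact fun y hy g => h2 y (hsrc' y hy) g
  · exact fun b hb => congrArg Prod.snd (hΨ1 b hb)
  · intro y hy
    have hpy : p (rightMul (Ψ y).2 (Ψ.symm (p y, 1))) = p y := by
      rw [hp.proj_rightMul, hps _ hy]
    have hy' : rightMul (Ψ y).2 (Ψ.symm (p y, 1)) ∈ Ψ.source := hsrc' _ (by rw [hpy]; exact hy)
    refine Ψ.injOn hy' (hsrc' y hy) (Prod.ext ?_ ?_)
    · rw [h1 _ hy', hpy, h1 _ (hsrc' y hy)]
    · rw [h2 _ (Ψ.map_target (hmem _ hy 1)), hΨ1 _ hy, one_mul]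

theorem IsPrincipalBundle.surjective
    (hp : IsPrincipalBundle (EG := EG) (EP := EP) (EB := EB) G p) : Function.Surjective p := by
  intro b
  obtain ⟨U, s, h, -, hb, -, hs, -⟩ := hp.exists_slice b
  exact ⟨s b, hs b hb⟩

theorem IsPrincipalBundle.exists_rightMul_eq
    (hp : IsPrincipalBundle (EG := EG) (EP := EP) (EB := EB) G p) {y y' : P} (h : p y = p y') :
    ∃ g : G, y' = rightMul g y := by
  obtain ⟨U, s, k, -, hb, -, hs, -, hk, -, hk'⟩ := hp.exists_slice (p y)
  refine ⟨(k y)⁻¹ * k y', ?_⟩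
  have h1 := hk' y hb
  have h2 := hk' y' (h ▸ hb)
  rw [← h] at h2
  calc y' = rightMul (k y') (s (p y)) := h2.symm
    _ = rightMul ((k y)⁻¹ * k y') (rightMul (k y) (s (p y))) := by
      rw [rightMul_rightMul]; simp
    _ = _ := by rw [h1]

theorem IsPrincipalBundle.free
    (hp : IsPrincipalBundle (EG := EG) (EP := EP) (EB := EB) G p) {y : P} {g : G}
    (h : rightMul g y = y) : g = 1 := by
  obtain ⟨U, s, k, -, hb, -, hs, -, hk, -, hk'⟩ := hp.exists_slice (p y)
  have := hk y hb g
  rw [h] at this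
  exact left_eq_mul.1 this

theorem IsPrincipalBundle.quotientMap_fiber_injective
    (hp : IsPrincipalBundle (EG := EG) (EP := EP) (EB := EB) G p) {y : P} {β β' : EP →L[ℝ] ℝ}
    (h : quotientMap G EP P ⟨y, β⟩ = quotientMap G EP P ⟨y, β'⟩) : β = β' := by
  obtain ⟨g, hg⟩ := hp.quotientMap_eq_iff.1 h
  have h1 : g = 1 := hp.free (congrArg Bundle.TotalSpace.proj hg).symm
  rw [h1, cotangentLift_one] at hg
  have : ∀ {a a' : CotangentBundle EP P}, a = a' →
      (show EP →L[ℝ] ℝ from a.snd) = (show EP →L[ℝ] ℝ from a'.snd) := by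
    rintro a _ rfl; rfl
  exact (this hg).symm

theorem IsPrincipalBundle.exists_fiber_point
    (hp : IsPrincipalBundle (EG := EG) (EP := EP) (EB := EB) G p) (y : P)
    (z : CotangentQuotient G EP P) (hz : quotientProj hp z = p y) :
    ∃ β : EP →L[ℝ] ℝ, quotientMap G EP P ⟨y, β⟩ = z := by
  obtain ⟨a, rfl⟩ := quotientMap_surjective z
  obtain ⟨g, hg⟩ := hp.exists_rightMul_eq (y := a.proj) (y' := y) hz
  subst hg
  exact ⟨(cotangentLift g a).snd, IsPrincipalBundle.quotientMap_cotangentLift g a⟩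

variable [IsManifold 𝓘(ℝ, EB) ∞ B]
  {EZ : Type*} [NormedAddCommGroup EZ] [NormedSpace ℝ EZ] [FiniteDimensional ℝ EZ]
  [ChartedSpace EZ (CotangentQuotient G EP P)]
  [IsManifold 𝓘(ℝ, EZ) ∞ (CotangentQuotient G EP P)]

theorem contMDiff_quotientProj
    (hp : IsPrincipalBundle (EG := EG) (EP := EP) (EB := EB) G p)
    (hρ : IsSmoothSubmersion (I := cotangentModel EP) (I' := 𝓘(ℝ, EZ)) (quotientMap G EP P)) :
    ContMDiff 𝓘(ℝ, EZ) 𝓘(ℝ, EB) ∞ (quotientProj hp) :=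
  contMDiff_of_comp_submersion hρ quotientMap_surjective
    (hp.smooth_proj.comp (Bundle.contMDiff_proj (fun x : P => Cotangent 𝓘(ℝ, EP) x)))

/-- A local section `s` of a principal bundle defines an invariant retraction of `T*P` onto the
restriction of `T*P` to the image of `s`. -/
theorem IsPrincipalBundle.exists_retraction
    (hp : IsPrincipalBundle (EG := EG) (EP := EP) (EB := EB) G p) (b₀ : B) :
    ∃ (U : Set B) (s : B → P) (r : CotangentBundle EP P → CotangentBundle EP P),
      IsOpen U ∧ b₀ ∈ U ∧ ContMDiffOn 𝓘(ℝ, EB) 𝓘(ℝ, EP) ∞ s U ∧ (∀ b ∈ U, p (s b) = b) ∧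
      (∀ a : CotangentBundle EP P, p a.proj ∈ U →
        ContMDiffAt (cotangentModel EP) (cotangentModel EP) ∞ r a) ∧
      (∀ a : CotangentBundle EP P, p a.proj ∈ U → (r a).proj = s (p a.proj)) ∧
      (∀ a : CotangentBundle EP P, ∀ b ∈ U, a.proj = s b → r a = a) ∧
      (∀ a a' : CotangentBundle EP P, p a.proj ∈ U →
        quotientMap G EP P a = quotientMap G EP P a' → r a = r a') ∧
      (∀ a, quotientMap G EP P (r a) = quotientMap G EP P a) ∧
      (∀ y, p y ∈ U → ∃ L : EP →L[ℝ] EP, ∀ β : EP →L[ℝ] ℝ, r ⟨y, β⟩ = ⟨s (p y), β ∘L L⟩) := by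
  obtain ⟨U₀, s, h, hU₀, hb₀, hs, hps, hh, hhg, hhs, hhy⟩ := hp.exists_slice b₀
  have hsy : ∀ y, p y ∈ U₀ → rightMul (h y)⁻¹ y = s (p y) := by
    intro y hy
    have h1 := congrArg (rightMul (h y)⁻¹) (hhy y hy)
    rw [rightMul_inv_rightMul] at h1
    exact h1.symm
  refine ⟨U₀, s, fun a => cotangentLift (h a.proj)⁻¹ a, hU₀, hb₀, hs, hps, ?_, ?_, ?_, ?_, ?_, ?_⟩
  · intro a ha
    have h1 : ContMDiffAt 𝓘(ℝ, EP) 𝓘(ℝ, EG) ∞ (fun y => (h y)⁻¹) a.proj :=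
      (hh.contMDiffAt ((hU₀.preimage hp.smooth_proj.continuous).mem_nhds ha)).inv
    have h2 : ContMDiffAt (cotangentModel EP) 𝓘(ℝ, EG) ∞
        (fun a : CotangentBundle EP P => (h a.proj)⁻¹) a :=
      h1.comp a (Bundle.contMDiffAt_proj (fun x : P => Cotangent 𝓘(ℝ, EP) x))
    exact (hp.contMDiff_cotangentLift (a, (h a.proj)⁻¹)).comp a (contMDiffAt_id.prodMk h2)
  · exact fun a ha => hsy a.proj ha
  · intro a b hb ha
    simp only
    rw [ha, hhs b hb, inv_one, cotangentLift_one]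
  · intro a a' ha haa
    obtain ⟨g, rfl⟩ := hp.quotientMap_eq_iff.1 haa
    have h1 : h (cotangentLift g a).proj = h a.proj * g := hhg a.proj ha g
    simp only
    rw [hp.cotangentLift_cotangentLift, h1, mul_inv_rev, mul_inv_cancel_left]
  · exact fun a => IsPrincipalBundle.quotientMap_cotangentLift _ a
  · exact fun y hy => ⟨(show EP →L[ℝ] EP from mfderiv 𝓘(ℝ, EP) 𝓘(ℝ, EP)
      (rightMul (h y)⁻¹⁻¹ : P → P) (rightMul (h y)⁻¹ y)),
      fun β => cotangent_ext (EP := EP) (hsy y hy) rfl⟩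

/-- A local trivialization `F` of `T*P/G → B` over `U`, with inverse `R`, that comes from a local
section `s` of `P → B`. -/
structure LocalModel (EZ : Type*) [NormedAddCommGroup EZ] [NormedSpace ℝ EZ]
    [ChartedSpace EZ (CotangentQuotient G EP P)]
    (hp : IsPrincipalBundle (EG := EG) (EP := EP) (EB := EB) G p) (b₀ : B) where
  U : Set B
  s : B → P
  F : CotangentQuotient G EP P → (EP →L[ℝ] ℝ)
  R : B × (EP →L[ℝ] ℝ) → CotangentQuotient G EP P
  isOpen_U : IsOpen U
  mem_U : b₀ ∈ U
  smooth_s : ContMDiffOn 𝓘(ℝ, EB) 𝓘(ℝ, EP) ∞ s U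
  proj_s : ∀ b ∈ U, p (s b) = b
  smooth_F : ContMDiffOn 𝓘(ℝ, EZ) 𝓘(ℝ, EP →L[ℝ] ℝ) ∞ F (quotientProj hp ⁻¹' U)
  smooth_R : ContMDiffOn (𝓘(ℝ, EB).prod 𝓘(ℝ, EP →L[ℝ] ℝ)) 𝓘(ℝ, EZ) ∞ R (U ×ˢ Set.univ)
  proj_R : ∀ b ∈ U, ∀ β, quotientProj hp (R (b, β)) = b
  F_R : ∀ b ∈ U, ∀ β, F (R (b, β)) = β
  R_F : ∀ z, quotientProj hp z ∈ U → R (quotientProj hp z, F z) = z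
  F_fiber : ∀ y, p y ∈ U → ∃ A : EP →L[ℝ] EP, ∀ β : EP →L[ℝ] ℝ,
    F (quotientMap G EP P ⟨y, β⟩) = β ∘L A
  mem_source : ∀ b ∈ U, s b ∈ (extChartAt 𝓘(ℝ, EP) (s b₀)).source
  F_slice : ∀ b ∈ U, ∀ β : EP →L[ℝ] ℝ,
    F (quotientMap G EP P ⟨s b, β⟩) = β ∘L (show EP →L[ℝ] EP from
      mfderiv 𝓘(ℝ, EP) 𝓘(ℝ, EP) (extChartAt 𝓘(ℝ, EP) (s b₀)).symm
        (extChartAt 𝓘(ℝ, EP) (s b₀) (s b)))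

theorem exists_localModel
    (hp : IsPrincipalBundle (EG := EG) (EP := EP) (EB := EB) G p)
    (hρ : IsSmoothSubmersion (I := cotangentModel EP) (I' := 𝓘(ℝ, EZ)) (quotientMap G EP P))
    (b₀ : B) : Nonempty (LocalModel EZ hp b₀) := by
  obtain ⟨U₀, s, r, hU₀, hb₀, hs, hps, hrsm, hrproj, hrs, hr, hρr, hrf⟩ := hp.exists_retraction b₀
  set φ := extChartAt 𝓘(ℝ, EP) (s b₀) with hφ
  set c := extChartAt (cotangentModel EP) (⟨s b₀, 0⟩ : CotangentBundle EP P) with hc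
  set U := U₀ ∩ s ⁻¹' φ.source with hUdef
  have hU : IsOpen U := hs.continuousOn.isOpen_inter_preimage hU₀ (isOpen_extChartAt_source _)
  let σ : CotangentQuotient G EP P → CotangentBundle EP P :=
    fun z => r (Function.surjInv quotientMap_surjective z)
  have hσ : ∀ a : CotangentBundle EP P, p a.proj ∈ U₀ → σ (quotientMap G EP P a) = r a := by
    intro a ha
    have h1 := Function.surjInv_eq (quotientMap_surjective (G := G)) (quotientMap G EP P a)
    exact (hr a _ ha h1.symm).symm
  have hcs : ∀ b ∈ U, ∀ β : EP →L[ℝ] ℝ, (φ (s b), β) ∈ c.target := fun b hb β =>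
    (extChartAt_cotangent_target (⟨s b₀, 0⟩ : CotangentBundle EP P) (φ (s b), β)).2
      (φ.map_source hb.2)
  have hcproj : ∀ b ∈ U, ∀ β : EP →L[ℝ] ℝ, (c.symm (φ (s b), β)).proj = s b := by
    intro b hb β
    exact (congrArg Bundle.TotalSpace.proj (extChartAt_cotangent_symm_apply
      (a := (⟨s b₀, 0⟩ : CotangentBundle EP P)) (z := (φ (s b), β))
      (φ.map_source hb.2))).trans (φ.left_inv hb.2)
  have hcfib : ∀ b ∈ U, ∀ β : EP →L[ℝ] ℝ, (c ⟨s b, β⟩).2 =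
      β ∘L (show EP →L[ℝ] EP from mfderiv 𝓘(ℝ, EP) 𝓘(ℝ, EP) φ.symm (φ (s b))) := by
    intro b hb β
    exact congrArg Prod.snd (extChartAt_cotangent_apply
      (a := (⟨s b₀, 0⟩ : CotangentBundle EP P)) (b := ⟨s b, β⟩) hb.2)
  refine ⟨⟨U, s, fun z => (c (σ z)).2, fun x => quotientMap G EP P (c.symm (φ (s x.1), x.2)), hU,
    ⟨hb₀, mem_extChartAt_source (s b₀)⟩, hs.mono Set.inter_subset_left, fun b hb => hps b hb.1,
    ?_, ?_, ?_, ?_, ?_, ?_, fun b hb => hb.2, ?_⟩⟩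
  · intro z hz
    obtain ⟨a, rfl⟩ := quotientMap_surjective z
    have ha : p a.proj ∈ U := hz
    refine ContMDiffAt.contMDiffWithinAt (contMDiffAt_of_comp_submersion (hρ.1 a) (hρ.2 a) ?_)
    have hca : ContMDiffAt (cotangentModel EP) 𝓘(ℝ, EP × (EP →L[ℝ] ℝ)) ∞ c (r a) := by
      refine contMDiffAt_extChartAt' ?_
      have : r a ∈ c.source := by
        rw [hc, mem_extChartAt_cotangent_source, hrproj a ha.1]
        exact ha.2
      simpa [c] using this
    have h3 : ContMDiffAt (cotangentModel EP) 𝓘(ℝ, EP →L[ℝ] ℝ) ∞ (fun a => (c (r a)).2) a :=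
      (contDiff_snd.contMDiff (c (r a))).comp a (hca.comp a (hrsm a ha.1))
    refine h3.congr_of_eventuallyEq ?_
    have hcont : Continuous fun a : CotangentBundle EP P => p a.proj :=
      (hp.smooth_proj.comp (Bundle.contMDiff_proj (fun x : P => Cotangent 𝓘(ℝ, EP) x))).continuous
    filter_upwards [(hU.preimage hcont).mem_nhds ha] with a' ha'
    rw [Function.comp_apply, hσ a' ha'.1]
  · intro x hx
    have hx1 : x.1 ∈ U := hx.1
    refine ContMDiffAt.contMDiffWithinAt ?_
    refine (hρ.1 _).comp x (ContMDiffAt.comp (I' := 𝓘(ℝ, EP × (EP →L[ℝ] ℝ))) x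
      (contMDiffAt_extChartAt_symm_self (hcs x.1 hx1 x.2)) ?_)
    have h1 : ContMDiffAt 𝓘(ℝ, EB) 𝓘(ℝ, EP) ∞ (fun b => φ (s b)) x.1 :=
      ContMDiffAt.comp x.1 (contMDiffAt_extChartAt' (by simpa [φ] using hx1.2))
        (hs.contMDiffAt (hU₀.mem_nhds hx1.1))
    exact (h1.comp x contMDiffAt_fst).prodMk_space contMDiffAt_snd
  · intro b hb β
    rw [quotientProj_quotientMap, hcproj b hb β, hps b hb.1]
  · intro b hb β
    have h1 := hcproj b hb β
    simp only
    rw [hσ _ (by rw [h1, hps b hb.1]; exact hb.1), hrs _ b hb.1 h1, c.right_inv (hcs b hb β)]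
  · intro z hz
    obtain ⟨a, rfl⟩ := quotientMap_surjective z
    have ha : p a.proj ∈ U := hz
    have hra : (r a).proj ∈ φ.source := by rw [hrproj a ha.1]; exact ha.2
    simp only
    rw [hσ a ha.1, quotientProj_quotientMap]
    have h1 : (φ (s (p a.proj)), (c (r a)).2) = c (r a) := by
      rw [← hrproj a ha.1]
      refine Prod.ext ?_ rfl
      exact (congrArg Prod.fst (extChartAt_cotangent_apply
        (a := (⟨s b₀, 0⟩ : CotangentBundle EP P)) (b := r a) hra)).symm
    rw [h1, c.left_inv ((mem_extChartAt_cotangent_source (⟨s b₀, 0⟩ : CotangentBundle EP P) (r a)).2 hra)]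
    exact hρr a
  · intro y hy
    obtain ⟨L, hL⟩ := hrf y hy.1
    refine ⟨L ∘L (show EP →L[ℝ] EP from mfderiv 𝓘(ℝ, EP) 𝓘(ℝ, EP) φ.symm (φ (s (p y)))),
      fun β => ?_⟩
    simp only
    rw [hσ ⟨y, β⟩ hy.1, hL]
    exact hcfib _ hy (β ∘L L)
  · intro b hb β
    have hpb : p (s b) ∈ U := by rw [hps b hb.1]; exact hb
    simp only
    rw [hσ ⟨s b, β⟩ hpb.1, hrs ⟨s b, β⟩ b hb.1 rfl]
    exact hcfib b hb β

end Quotient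

section Cutoff

variable {E : Type*} [NormedAddCommGroup E] [NormedSpace ℝ E] [FiniteDimensional ℝ E]
  {H : Type*} [TopologicalSpace H] {I : ModelWithCorners ℝ E H}
  {M : Type*} [TopologicalSpace M] [ChartedSpace H M] [IsManifold I ∞ M] [T2Space M]

theorem exists_cutoff {U : Set M} (hU : IsOpen U) {x : M} (hx : x ∈ U) :
    ∃ χ : M → ℝ, ContMDiff I 𝓘(ℝ, ℝ) ∞ χ ∧ (∀ᶠ y in 𝓝 x, χ y = 1) ∧ tsupport χ ⊆ U := by
  obtain ⟨χ, -, hχ⟩ := (SmoothBumpFunction.nhds_basis_tsupport (I := I) x).mem_iff.1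
    (hU.mem_nhds hx)
  exact ⟨χ, χ.contMDiff, χ.eventuallyEq_one, hχ⟩

theorem contMDiff_cutoff_smul {E' : Type*} [NormedAddCommGroup E'] [NormedSpace ℝ E']
    {H' : Type*} [TopologicalSpace H'] {I' : ModelWithCorners ℝ E' H'}
    {N : Type*} [TopologicalSpace N] [ChartedSpace H' N] {q : N → M}
    {W : Type*} [NormedAddCommGroup W] [NormedSpace ℝ W] {χ : M → ℝ} {U : Set M} (hU : IsOpen U)
    (hχ : ContMDiff I 𝓘(ℝ, ℝ) ∞ χ) (hχU : tsupport χ ⊆ U)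
    (hq : ContMDiff I' I ∞ q) {F : N → W} (hF : ContMDiffOn I' 𝓘(ℝ, W) ∞ F (q ⁻¹' U)) :
    ContMDiff I' 𝓘(ℝ, W) ∞ (fun z => χ (q z) • F z) := by
  intro z
  by_cases hz : q z ∈ U
  · exact ((hχ.comp hq) z).smul (hF.contMDiffAt ((hU.preimage hq.continuous).mem_nhds hz))
  · have h1 : ∀ᶠ z' in 𝓝 z, χ (q z') = 0 := by
      have h2 := (isClosed_tsupport χ).isOpen_compl.preimage hq.continuous
      filter_upwards [h2.mem_nhds (x := z) (fun h => hz (hχU h))] with z' hz'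
      exact image_eq_zero_of_notMem_tsupport hz'
    have h3 : ContMDiffAt I' 𝓘(ℝ, W) ∞ (fun _ : N => (0 : W)) z := contMDiffAt_const
    refine h3.congr_of_eventuallyEq ?_
    filter_upwards [h1] with z' hz'
    rw [hz', zero_smul]

/-- A smooth function on an open neighbourhood of `x` agrees near `x` with a smooth function on
the whole manifold. -/
theorem exists_contMDiff_eventuallyEq {W : Type*} [NormedAddCommGroup W] [NormedSpace ℝ W]
    {U : Set M} (hU : IsOpen U) {x : M} (hx : x ∈ U) {F : M → W}
    (hF : ContMDiffOn I 𝓘(ℝ, W) ∞ F U) :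
    ∃ f : M → W, ContMDiff I 𝓘(ℝ, W) ∞ f ∧ f =ᶠ[𝓝 x] F := by
  obtain ⟨χ, hχ, hχ1, hχU⟩ := exists_cutoff (I := I) hU hx
  refine ⟨fun z => χ z • F z, contMDiff_cutoff_smul hU hχ hχU contMDiff_id hF, ?_⟩
  filter_upwards [hχ1] with y hy
  rw [hy, one_smul]

theorem diff_congr {f g : M → ℝ} {x : M} (h : f =ᶠ[𝓝 x] g) : diff I f x = diff I g x :=
  h.mfderiv_eq

theorem diff_comp {E' : Type*} [NormedAddCommGroup E'] [NormedSpace ℝ E']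
    {H' : Type*} [TopologicalSpace H'] {I' : ModelWithCorners ℝ E' H'}
    {N : Type*} [TopologicalSpace N] [ChartedSpace H' N] {q : N → M} {f : M → ℝ} {z : N}
    (hf : MDifferentiableAt I 𝓘(ℝ, ℝ) f (q z)) (hq : MDifferentiableAt I' I q z) :
    diff I' (f ∘ q) z = (diff I f (q z)).comp (mfderiv I' I q z) :=
  mfderiv_comp z hf hq

theorem exists_diff_eq [I.Boundaryless] (x : M) (α : Cotangent I x) :
    ∃ f : M → ℝ, ContMDiff I 𝓘(ℝ, ℝ) ∞ f ∧ diff I f x = α := by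
  let c := extChartAt I x
  let α' : E →L[ℝ] ℝ := α
  have h1 : ContMDiffOn I 𝓘(ℝ, ℝ) ∞ (fun y => α' (c y)) (chartAt H x).source :=
    α'.contMDiff.comp_contMDiffOn (contMDiffOn_extChartAt (I := I) (x := x))
  obtain ⟨f, hf, hfe⟩ := exists_contMDiff_eventuallyEq (chartAt H x).open_source
    (mem_chart_source H x) h1
  refine ⟨f, hf, ?_⟩
  rw [diff_congr hfe, diff_eq_fderiv_comp (mem_extChartAt_source (I := I) x)
    ((h1.contMDiffAt ((chartAt H x).open_source.mem_nhds (mem_chart_source H x))).mdifferentiableAt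
      (by simp))]
  have h2 : (fun y => α' (c y)) ∘ c.symm =ᶠ[𝓝 (c x)] α' := by
    filter_upwards [extChartAt_target_mem_nhds (I := I) x] with u hu
    exact congrArg α' (c.right_inv hu)
  have h4 := mfderiv_extChartAt_self (I := I) (x := x)
  exact (congrArg₂ ContinuousLinearMap.comp (h2.fderiv_eq.trans α'.fderiv) h4).trans α'.comp_id

end Cutoff

section PoissonMap

variable {E : Type*} [NormedAddCommGroup E] [NormedSpace ℝ E]
  {H : Type*} [TopologicalSpace H] {I : ModelWithCorners ℝ E H}
  {M : Type*} [TopologicalSpace M] [ChartedSpace H M]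
  {E' : Type*} [NormedAddCommGroup E'] [NormedSpace ℝ E'] [FiniteDimensional ℝ E']
  {H' : Type*} [TopologicalSpace H'] {I' : ModelWithCorners ℝ E' H'} [I'.Boundaryless]
  {M' : Type*} [TopologicalSpace M'] [ChartedSpace H' M'] [IsManifold I' ∞ M'] [T2Space M']

theorem IsPoissonMap.tensor_apply {w : BilinField I M} {w' : BilinField I' M'} {φ : M → M'}
    (h : IsPoissonMap w w' φ) (x : M) (α β : Cotangent I' (φ x)) :
    w' (φ x) α β = w x (α.comp (mfderiv I I' φ x)) (β.comp (mfderiv I I' φ x)) := by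
  obtain ⟨f, hf, rfl⟩ := exists_diff_eq (φ x) α
  obtain ⟨g, hg, rfl⟩ := exists_diff_eq (φ x) β
  have h1 := h.2 f g hf hg x
  have hφ : MDifferentiableAt I I' φ x := (h.1 x).mdifferentiableAt (by simp)
  rw [bracket, bracket, diff_comp ((hf _).mdifferentiableAt (by simp)) hφ,
    diff_comp ((hg _).mdifferentiableAt (by simp)) hφ] at h1
  exact h1.symm

theorem isPoissonMap_of_tensor {w : BilinField I M} {w' : BilinField I' M'} {φ : M → M'}
    (hφ : ContMDiff I I' ∞ φ)
    (h : ∀ (x : M) (α β : Cotangent I' (φ x)),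
      w' (φ x) α β = w x (α.comp (mfderiv I I' φ x)) (β.comp (mfderiv I I' φ x))) :
    IsPoissonMap w w' φ := by
  refine ⟨hφ, fun f g hf hg x => ?_⟩
  have h1 : MDifferentiableAt I I' φ x := (hφ x).mdifferentiableAt (by simp)
  rw [bracket, bracket, diff_comp ((hf _).mdifferentiableAt (by simp)) h1,
    diff_comp ((hg _).mdifferentiableAt (by simp)) h1, h]

end PoissonMap

theorem PoissonStructure.ext_tensor {E : Type*} [NormedAddCommGroup E] [NormedSpace ℝ E]
    {H : Type*} [TopologicalSpace H] {I : ModelWithCorners ℝ E H}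
    {M : Type*} [TopologicalSpace M] [ChartedSpace H M] {w w' : PoissonStructure I M}
    (h : w.tensor = w'.tensor) : w = w' := by
  cases w; cases w'; cases h; rfl

section Reduction

variable {EG : Type*} [NormedAddCommGroup EG] [NormedSpace ℝ EG]
  {G : Type*} [Group G] [TopologicalSpace G] [ChartedSpace EG G] [LieGroup 𝓘(ℝ, EG) ∞ G]
  {EP : Type*} [NormedAddCommGroup EP] [NormedSpace ℝ EP] [FiniteDimensional ℝ EP]
  {P : Type*} [TopologicalSpace P] [ChartedSpace EP P] [IsManifold 𝓘(ℝ, EP) ∞ P]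
  [MulAction Gᵐᵒᵖ P]
  {EB : Type*} [NormedAddCommGroup EB] [NormedSpace ℝ EB]
  {B : Type*} [TopologicalSpace B] [ChartedSpace EB B]
  {p : P → B}
  {EZ : Type*} [NormedAddCommGroup EZ] [NormedSpace ℝ EZ] [FiniteDimensional ℝ EZ]
  [ChartedSpace EZ (CotangentQuotient G EP P)]
  [IsManifold 𝓘(ℝ, EZ) ∞ (CotangentQuotient G EP P)]

theorem IsPrincipalBundle.contMDiff_cotangentLift_right
    (hp : IsPrincipalBundle (EG := EG) (EP := EP) (EB := EB) G p) (g : G) :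
    ContMDiff (cotangentModel EP) (cotangentModel EP) ∞
      (cotangentLift g : CotangentBundle EP P → CotangentBundle EP P) :=
  hp.contMDiff_cotangentLift.comp (contMDiff_id.prodMk contMDiff_const)

/-- The canonical bivector of `T*P`, pushed forward along `T*P → T*P/G`. -/
theorem canonicalPoisson_comp_quotientMap
    (hp : IsPrincipalBundle (EG := EG) (EP := EP) (EB := EB) G p)
    (hρ : IsSmoothSubmersion (I := cotangentModel EP) (I' := 𝓘(ℝ, EZ)) (quotientMap G EP P))
    {a a' : CotangentBundle EP P} (h : quotientMap G EP P a = quotientMap G EP P a')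
    (α β : EZ →L[ℝ] ℝ) :
    modelPoisson EP
        (α ∘L (show EP × (EP →L[ℝ] ℝ) →L[ℝ] EZ from
          mfderiv (cotangentModel EP) 𝓘(ℝ, EZ) (quotientMap G EP P) a))
        (β ∘L (show EP × (EP →L[ℝ] ℝ) →L[ℝ] EZ from
          mfderiv (cotangentModel EP) 𝓘(ℝ, EZ) (quotientMap G EP P) a)) =
      modelPoisson EP
        (α ∘L (show EP × (EP →L[ℝ] ℝ) →L[ℝ] EZ from
          mfderiv (cotangentModel EP) 𝓘(ℝ, EZ) (quotientMap G EP P) a'))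
        (β ∘L (show EP × (EP →L[ℝ] ℝ) →L[ℝ] EZ from
          mfderiv (cotangentModel EP) 𝓘(ℝ, EZ) (quotientMap G EP P) a')) := by
  obtain ⟨g, rfl⟩ := hp.quotientMap_eq_iff.1 h
  have hg : MDifferentiableAt (cotangentModel EP) (cotangentModel EP)
      (cotangentLift g : CotangentBundle EP P → CotangentBundle EP P) a :=
    (hp.contMDiff_cotangentLift_right g a).mdifferentiableAt (by simp)
  have h1 : mfderiv (cotangentModel EP) 𝓘(ℝ, EZ) (quotientMap G EP P) a =
      (mfderiv (cotangentModel EP) 𝓘(ℝ, EZ) (quotientMap G EP P) (cotangentLift g a)).comp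
        (mfderiv (cotangentModel EP) (cotangentModel EP) (cotangentLift g) a) := by
    have h2 := mfderiv_comp a ((hρ.1 (cotangentLift g a)).mdifferentiableAt (by simp)) hg
    have h3 : quotientMap G EP P ∘ cotangentLift g = quotientMap G EP P :=
      funext fun b => IsPrincipalBundle.quotientMap_cotangentLift g b
    rw [h3] at h2
    exact h2
  have h4 := canonicalPoisson_diffLift (hp.contMDiff_rightMul g) (hp.contMDiff_rightMul g⁻¹)
    (fun y => rightMul_inv_rightMul g y) (fun y => rightMul_rightMul_inv g y) (a := a) hg
    (α ∘L (show EP × (EP →L[ℝ] ℝ) →L[ℝ] EZ from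
      mfderiv (cotangentModel EP) 𝓘(ℝ, EZ) (quotientMap G EP P) (cotangentLift g a)))
    (β ∘L (show EP × (EP →L[ℝ] ℝ) →L[ℝ] EZ from
      mfderiv (cotangentModel EP) 𝓘(ℝ, EZ) (quotientMap G EP P) (cotangentLift g a)))
  rw [h1]
  exact h4

/-- The Poisson tensor of `T*P/G`. -/
def quotientTensor : BilinField 𝓘(ℝ, EZ) (CotangentQuotient G EP P) := fun z =>
  let L : EP × (EP →L[ℝ] ℝ) →L[ℝ] EZ := mfderiv (cotangentModel EP) 𝓘(ℝ, EZ) (quotientMap G EP P)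
    (Function.surjInv quotientMap_surjective z)
  let T : (EZ →L[ℝ] ℝ) →ₗ[ℝ] (EP × (EP →L[ℝ] ℝ) →L[ℝ] ℝ) :=
    { toFun := fun α => α ∘L L
      map_add' := fun _ _ => rfl
      map_smul' := fun _ _ => rfl }
  (modelPoisson EP).compl₁₂ T T

theorem quotientTensor_apply
    (hp : IsPrincipalBundle (EG := EG) (EP := EP) (EB := EB) G p)
    (hρ : IsSmoothSubmersion (I := cotangentModel EP) (I' := 𝓘(ℝ, EZ)) (quotientMap G EP P))
    (a : CotangentBundle EP P) (α β : Cotangent 𝓘(ℝ, EZ) (quotientMap G EP P a)) :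
    quotientTensor (quotientMap G EP P a) α β = canonicalPoisson EP P a
      (α.comp (mfderiv (cotangentModel EP) 𝓘(ℝ, EZ) (quotientMap G EP P) a))
      (β.comp (mfderiv (cotangentModel EP) 𝓘(ℝ, EZ) (quotientMap G EP P) a)) :=
  canonicalPoisson_comp_quotientMap hp hρ (Function.surjInv_eq quotientMap_surjective _) α β

variable [T2Space (CotangentQuotient G EP P)]

theorem bracket_quotientTensor_comp
    (hp : IsPrincipalBundle (EG := EG) (EP := EP) (EB := EB) G p)
    (hρ : IsSmoothSubmersion (I := cotangentModel EP) (I' := 𝓘(ℝ, EZ)) (quotientMap G EP P))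
    {f g : CotangentQuotient G EP P → ℝ} (hf : ContMDiff 𝓘(ℝ, EZ) 𝓘(ℝ, ℝ) ∞ f)
    (hg : ContMDiff 𝓘(ℝ, EZ) 𝓘(ℝ, ℝ) ∞ g) :
    bracket (I := 𝓘(ℝ, EZ)) quotientTensor f g ∘ quotientMap G EP P =
      bracket (canonicalPoisson EP P) (f ∘ quotientMap G EP P) (g ∘ quotientMap G EP P) :=
  funext fun a => ((isPoissonMap_of_tensor hρ.1 (quotientTensor_apply hp hρ)).2 f g hf hg a).symm

/-- The Poisson structure of the Sternberg-Weinstein phase space `T*P/G`. -/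
def quotientPoisson (hp : IsPrincipalBundle (EG := EG) (EP := EP) (EB := EB) G p)
    (hρ : IsSmoothSubmersion (I := cotangentModel EP) (I' := 𝓘(ℝ, EZ)) (quotientMap G EP P)) :
    PoissonStructure 𝓘(ℝ, EZ) (CotangentQuotient G EP P) where
  tensor := quotientTensor
  skew := fun z α β => modelPoisson_skew _ _
  smooth := fun f g hf hg => by
    refine contMDiff_of_comp_submersion hρ quotientMap_surjective ?_
    rw [bracket_quotientTensor_comp hp hρ hf hg]
    exact contMDiff_canonical_bracket (hf.comp hρ.1) (hg.comp hρ.1)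
  jacobi := fun f g h hf hg hh z => by
    have hs : ∀ {f g : CotangentQuotient G EP P → ℝ}, ContMDiff 𝓘(ℝ, EZ) 𝓘(ℝ, ℝ) ∞ f →
        ContMDiff 𝓘(ℝ, EZ) 𝓘(ℝ, ℝ) ∞ g →
        ContMDiff 𝓘(ℝ, EZ) 𝓘(ℝ, ℝ) ∞ (bracket (I := 𝓘(ℝ, EZ)) quotientTensor f g) := fun hf hg => by
      refine contMDiff_of_comp_submersion hρ quotientMap_surjective ?_
      rw [bracket_quotientTensor_comp hp hρ hf hg]
      exact contMDiff_canonical_bracket (hf.comp hρ.1) (hg.comp hρ.1)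
    obtain ⟨a, rfl⟩ := quotientMap_surjective z
    have h1 := canonical_jacobi (hf.comp hρ.1) (hg.comp hρ.1) (hh.comp hρ.1) a
    rw [← bracket_quotientTensor_comp hp hρ hg hh, ← bracket_quotientTensor_comp hp hρ hh hf,
      ← bracket_quotientTensor_comp hp hρ hf hg,
      ← bracket_quotientTensor_comp hp hρ hf (hs hg hh),
      ← bracket_quotientTensor_comp hp hρ hg (hs hh hf),
      ← bracket_quotientTensor_comp hp hρ hh (hs hf hg)] at h1
    exact h1

theorem existsUnique_quotientPoisson
    (hp : IsPrincipalBundle (EG := EG) (EP := EP) (EB := EB) G p)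
    (hρ : IsSmoothSubmersion (I := cotangentModel EP) (I' := 𝓘(ℝ, EZ)) (quotientMap G EP P)) :
    ∃! ϖ : PoissonStructure 𝓘(ℝ, EZ) (CotangentQuotient G EP P),
      IsPoissonMap (canonicalPoisson EP P) ϖ.tensor (quotientMap G EP P) := by
  refine ⟨quotientPoisson hp hρ, isPoissonMap_of_tensor hρ.1 (quotientTensor_apply hp hρ),
    fun ϖ hϖ => PoissonStructure.ext_tensor (funext fun z => ?_)⟩
  obtain ⟨a, rfl⟩ := quotientMap_surjective z
  refine LinearMap.ext fun α => LinearMap.ext fun β => ?_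
  exact (hϖ.tensor_apply a α β).trans (quotientTensor_apply hp hρ a α β).symm

end Reduction

section LinearAlgebra

variable {V₁ : Type*} [NormedAddCommGroup V₁] [NormedSpace ℝ V₁]
  {V₂ : Type*} [NormedAddCommGroup V₂] [NormedSpace ℝ V₂] [FiniteDimensional ℝ V₂]
  {V₃ : Type*} [NormedAddCommGroup V₃] [NormedSpace ℝ V₃] [FiniteDimensional ℝ V₃]

/-- A splitting of `V₃` into the images of `D` and `V`, where `V` is defined on the dual of a space
`V₂` that projects onto the domain of `D`. -/
structure IsSplitting (D : V₁ →L[ℝ] V₃) (V : (V₂ →L[ℝ] ℝ) →L[ℝ] V₃) (S : V₂ →L[ℝ] V₁)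
    (R : V₃ →L[ℝ] V₁) : Prop where
  R_D : ∀ x, R (D x) = x
  R_V : ∀ γ, R (V γ) = 0
  V_injective : Function.Injective V
  S_surjective : Function.Surjective S
  exists_eq : ∀ X, ∃ x γ, X = D x + V γ

namespace IsSplitting

variable {D : V₁ →L[ℝ] V₃} {V : (V₂ →L[ℝ] ℝ) →L[ℝ] V₃} {S : V₂ →L[ℝ] V₁} {R : V₃ →L[ℝ] V₁}
  (h : IsSplitting D V S R)
  {w : (V₃ →L[ℝ] ℝ) →ₗ[ℝ] (V₃ →L[ℝ] ℝ) →ₗ[ℝ] ℝ}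
  (hw : ∀ α β, w α β = β (V ((α ∘L D) ∘L S)) - α (V ((β ∘L D) ∘L S)))
include h

theorem covector_ext {α β : V₃ →L[ℝ] ℝ} (h1 : ∀ x, α (D x) = β (D x))
    (h2 : ∀ γ, α (V γ) = β (V γ)) : α = β := by
  ext X
  obtain ⟨x, γ, rfl⟩ := h.exists_eq X
  rw [map_add, map_add, h1, h2]

theorem exists_covector (u : V₂) : ∃ α : V₃ →L[ℝ] ℝ, (∀ x, α (D x) = 0) ∧ ∀ γ, α (V γ) = γ u := by
  obtain ⟨L, hL⟩ := LinearMap.exists_leftInverse_of_injective V.toLinearMap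
    (LinearMap.ker_eq_bot.2 h.V_injective)
  have hL' : ∀ γ, L (V γ) = γ := fun γ => LinearMap.congr_fun hL γ
  let α : V₃ →ₗ[ℝ] ℝ :=
    { toFun := fun X => L (X - D (R X)) u
      map_add' := fun X Y => by
        simp only [map_add, map_sub, add_apply, sub_apply]
        ring
      map_smul' := fun c X => by simp [mul_sub] }
  refine ⟨LinearMap.toContinuousLinearMap α, fun x => ?_, fun γ => ?_⟩
  · change L (D x - D (R (D x))) u = 0
    rw [h.R_D, sub_self, map_zero, zero_apply]
  · change L (V γ - D (R (V γ))) u = γ u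
    rw [h.R_V, map_zero, sub_zero, hL']

include hw

theorem sharp_eq {α : V₃ →L[ℝ] ℝ} {u : V₂} (hu : ∀ γ, α (V γ) = γ u) {X : V₃}
    (hX : ∀ β, β X = w β α) : X = D (S u) - V ((α ∘L D) ∘L S) := by
  refine eq_of_forall_covector fun β => ?_
  rw [hX, hw, hu, map_sub]
  rfl

theorem sharp_mem_range_iff {α : V₃ →L[ℝ] ℝ} {X : V₃} (hX : ∀ β, β X = w β α) :
    X ∈ Set.range D ↔ ∀ x, α (D x) = 0 := by
  obtain ⟨u, hu⟩ := exists_eval (α.toLinearMap ∘ₗ V.toLinearMap)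
  have h1 := h.sharp_eq hw hu hX
  constructor
  · rintro ⟨x, hx⟩ x'
    have h2 : V ((α ∘L D) ∘L S) = D (S u - x) := by
      rw [map_sub, hx, h1]; abel
    have h3 := congrArg R h2
    rw [h.R_V, h.R_D] at h3
    rw [← h3, map_zero] at h2
    have h4 := h.V_injective (h2.trans (map_zero V).symm)
    obtain ⟨v, rfl⟩ := h.S_surjective x'
    exact DFunLike.congr_fun h4 v
  · intro hα
    have h2 : (α ∘L D) ∘L S = 0 := by ext v; exact hα _
    rw [h2, map_zero, sub_zero] at h1
    exact ⟨S u, h1.symm⟩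

/-- The image of `D` is a Lagrangian subspace of the image of `w`. -/
theorem mem_range_iff (sharp : (V₃ →L[ℝ] ℝ) → V₃) (hs : ∀ α β, β (sharp α) = w β α) (v : V₃) :
    v ∈ Set.range D ↔ ∃ α, sharp α = v ∧ ∀ β, sharp β ∈ Set.range D → w α β = 0 := by
  constructor
  · rintro ⟨x, rfl⟩
    obtain ⟨u, rfl⟩ := h.S_surjective x
    obtain ⟨α, hα, hαu⟩ := h.exists_covector u
    refine ⟨α, ?_, fun β hβ => ?_⟩
    · have h2 : (α ∘L D) ∘L S = 0 := by ext v; exact hα _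
      rw [h.sharp_eq hw hαu (hs α), h2, map_zero, sub_zero]
    · have h1 := (h.sharp_mem_range_iff hw (hs β)).1 hβ
      have h2 : (α ∘L D) ∘L S = 0 := by ext v; exact hα _
      have h3 : (β ∘L D) ∘L S = 0 := by ext v; exact h1 _
      rw [hw, h2, h3, map_zero, map_zero, map_zero, sub_zero]
  · rintro ⟨α, rfl, hα⟩
    obtain ⟨u, hu⟩ := exists_eval (α.toLinearMap ∘ₗ V.toLinearMap)
    have h1 := h.sharp_eq hw hu (hs α)
    have h2 : V ((α ∘L D) ∘L S) = 0 := by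
      refine eq_of_forall_covector fun δ => ?_
      let β : V₃ →L[ℝ] ℝ := δ - (δ ∘L D) ∘L R
      have hβ : ∀ x, β (D x) = 0 := fun x => by
        change δ (D x) - δ (D (R (D x))) = 0
        rw [h.R_D, sub_self]
      have h3 := hα β ((h.sharp_mem_range_iff hw (hs β)).2 hβ)
      have h4 : (β ∘L D) ∘L S = 0 := by ext v; exact hβ _
      rw [hw, h4, map_zero, map_zero, sub_zero] at h3
      change δ _ - δ (D (R _)) = 0 at h3
      rwa [h.R_V, map_zero, map_zero, sub_zero, ← map_zero δ] at h3
    rw [h2, sub_zero] at h1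
    exact ⟨S u, h1.symm⟩

end IsSplitting

end LinearAlgebra

section ZeroSection

variable {EG : Type*} [NormedAddCommGroup EG] [NormedSpace ℝ EG]
  {G : Type*} [Group G] [TopologicalSpace G] [ChartedSpace EG G] [LieGroup 𝓘(ℝ, EG) ∞ G]
  {EP : Type*} [NormedAddCommGroup EP] [NormedSpace ℝ EP] [FiniteDimensional ℝ EP]
  {P : Type*} [TopologicalSpace P] [ChartedSpace EP P] [IsManifold 𝓘(ℝ, EP) ∞ P]
  [MulAction Gᵐᵒᵖ P]
  {EB : Type*} [NormedAddCommGroup EB] [NormedSpace ℝ EB] [FiniteDimensional ℝ EB]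
  {B : Type*} [TopologicalSpace B] [ChartedSpace EB B] [IsManifold 𝓘(ℝ, EB) ∞ B]
  {p : P → B}
  {EZ : Type*} [NormedAddCommGroup EZ] [NormedSpace ℝ EZ] [FiniteDimensional ℝ EZ]
  [ChartedSpace EZ (CotangentQuotient G EP P)]
  [IsManifold 𝓘(ℝ, EZ) ∞ (CotangentQuotient G EP P)]

theorem IsPrincipalBundle.isSmoothSubmersion
    (hp : IsPrincipalBundle (EG := EG) (EP := EP) (EB := EB) G p) :
    IsSmoothSubmersion (I := 𝓘(ℝ, EP)) (I' := 𝓘(ℝ, EB)) p := by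
  refine ⟨hp.smooth_proj, fun y => ?_⟩
  obtain ⟨U, s, h, hU, hb, hs, hps, -, -, -, hhy⟩ := hp.exists_slice (p y)
  have h1 : rightMul (h y) (s (p y)) = y := hhy y hb
  have h2 : ContMDiffAt 𝓘(ℝ, EB) 𝓘(ℝ, EP) ∞ (fun b => rightMul (h y) (s b)) (p y) :=
    (hp.contMDiff_rightMul (h y) _).comp (p y) (hs.contMDiffAt (hU.mem_nhds hb))
  have h3 := surjective_mfderiv_of_section (I := 𝓘(ℝ, EP)) (I' := 𝓘(ℝ, EB)) (f := p)
    (σ := fun b => rightMul (h y) (s b)) (y := p y)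
    ((hp.smooth_proj _).mdifferentiableAt (by simp)) (h2.mdifferentiableAt (by simp)) (by
      filter_upwards [hU.mem_nhds hb] with b hb'
      rw [hp.proj_rightMul, hps b hb'])
  rwa [h1] at h3

theorem IsPrincipalBundle.quotientMap_zero_eq
    (hp : IsPrincipalBundle (EG := EG) (EP := EP) (EB := EB) G p) {y y' : P} (h : p y = p y') :
    quotientMap G EP P ⟨y, 0⟩ = quotientMap G EP P ⟨y', 0⟩ := by
  obtain ⟨g, rfl⟩ := hp.exists_rightMul_eq h
  refine Quot.sound ⟨g, ?_⟩
  exact cotangent_ext (EP := EP) rfl (ContinuousLinearMap.zero_comp _).symm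

theorem contMDiff_quotientMap_zero
    (hp : IsPrincipalBundle (EG := EG) (EP := EP) (EB := EB) G p)
    (hρ : IsSmoothSubmersion (I := cotangentModel EP) (I' := 𝓘(ℝ, EZ)) (quotientMap G EP P)) :
    ContMDiff 𝓘(ℝ, EB) 𝓘(ℝ, EZ) ∞
      (fun b => quotientMap G EP P ⟨Function.surjInv hp.surjective b, 0⟩) := by
  refine contMDiff_of_comp_submersion hp.isSmoothSubmersion hp.surjective ?_
  have h1 : (fun b => quotientMap G EP P ⟨Function.surjInv hp.surjective b, 0⟩) ∘ p =
      fun y => quotientMap G EP P ⟨y, 0⟩ :=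
    funext fun y => hp.quotientMap_zero_eq (Function.surjInv_eq hp.surjective (p y))
  rw [h1]
  exact hρ.1.comp contMDiff_cotangent_zero

/-- The zero section `B → T*P/G`. -/
def zeroSection (hp : IsPrincipalBundle (EG := EG) (EP := EP) (EB := EB) G p)
    (hρ : IsSmoothSubmersion (I := cotangentModel EP) (I' := 𝓘(ℝ, EZ)) (quotientMap G EP P)) :
    C^∞⟮𝓘(ℝ, EB), B; 𝓘(ℝ, EZ), CotangentQuotient G EP P⟯ :=
  ⟨_, contMDiff_quotientMap_zero hp hρ⟩

variable (hp : IsPrincipalBundle (EG := EG) (EP := EP) (EB := EB) G p)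
  (hρ : IsSmoothSubmersion (I := cotangentModel EP) (I' := 𝓘(ℝ, EZ)) (quotientMap G EP P))

theorem zeroSection_apply (y : P) : zeroSection hp hρ (p y) = quotientMap G EP P ⟨y, 0⟩ :=
  hp.quotientMap_zero_eq (Function.surjInv_eq hp.surjective (p y))

theorem quotientProj_zeroSection (b : B) : quotientProj hp (zeroSection hp hρ b) = b := by
  obtain ⟨y, rfl⟩ := hp.surjective b
  rw [zeroSection_apply]
  rfl

variable (EZ G) in
/-- The derivative at `0` of the linear coordinates `β ↦ ρ(β)` on the fibre of `T*P/G`. -/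
def verticalDeriv (y : P) : (EP →L[ℝ] ℝ) →L[ℝ] EZ :=
  (show EP × (EP →L[ℝ] ℝ) →L[ℝ] EZ from
    mfderiv (cotangentModel EP) 𝓘(ℝ, EZ) (quotientMap G EP P) ⟨y, 0⟩) ∘L
    ContinuousLinearMap.inr ℝ EP (EP →L[ℝ] ℝ)

include hρ in
theorem hasMFDerivAt_quotientMap_fiber (y : P) :
    HasMFDerivAt 𝓘(ℝ, EP →L[ℝ] ℝ) 𝓘(ℝ, EZ)
      (fun β : EP →L[ℝ] ℝ => quotientMap G EP P ⟨y, β⟩) 0 (verticalDeriv G EZ y) :=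
  HasMFDerivAt.comp (0 : EP →L[ℝ] ℝ)
    ((hρ.1 (⟨y, 0⟩ : CotangentBundle EP P)).mdifferentiableAt (by simp)).hasMFDerivAt
    (hasMFDerivAt_cotangent_fiber y 0)

theorem mfderiv_quotientMap_inl (y : P) :
    (show EP × (EP →L[ℝ] ℝ) →L[ℝ] EZ from
      mfderiv (cotangentModel EP) 𝓘(ℝ, EZ) (quotientMap G EP P) ⟨y, 0⟩) ∘L
      ContinuousLinearMap.inl ℝ EP (EP →L[ℝ] ℝ) =
    (show EB →L[ℝ] EZ from mfderiv 𝓘(ℝ, EB) 𝓘(ℝ, EZ) (zeroSection hp hρ) (p y)) ∘L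
      (show EP →L[ℝ] EB from mfderiv 𝓘(ℝ, EP) 𝓘(ℝ, EB) p y) := by
  have h1 := HasMFDerivAt.comp y
    ((hρ.1 (⟨y, 0⟩ : CotangentBundle EP P)).mdifferentiableAt (by simp)).hasMFDerivAt
    (hasMFDerivAt_cotangent_zero y)
  have h2 := HasMFDerivAt.comp y
    (((zeroSection hp hρ).contMDiff (p y)).mdifferentiableAt (by simp)).hasMFDerivAt
    ((hp.smooth_proj y).mdifferentiableAt (by simp)).hasMFDerivAt
  have h3 : (zeroSection hp hρ) ∘ p =
      quotientMap G EP P ∘ fun y : P => (⟨y, 0⟩ : CotangentBundle EP P) :=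
    funext fun y => zeroSection_apply hp hρ y
  rw [h3] at h2
  exact hasMFDerivAt_unique h1 h2

theorem isSplitting_zeroSection (y : P) :
    IsSplitting
      (show EB →L[ℝ] EZ from mfderiv 𝓘(ℝ, EB) 𝓘(ℝ, EZ) (zeroSection hp hρ) (p y))
      (verticalDeriv G EZ y)
      (show EP →L[ℝ] EB from mfderiv 𝓘(ℝ, EP) 𝓘(ℝ, EB) p y)
      (show EZ →L[ℝ] EB from mfderiv 𝓘(ℝ, EZ) 𝓘(ℝ, EB) (quotientProj hp)
        (zeroSection hp hρ (p y))) := by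
  have hq : MDifferentiableAt 𝓘(ℝ, EZ) 𝓘(ℝ, EB) (quotientProj hp) (zeroSection hp hρ (p y)) :=
    (contMDiff_quotientProj hp hρ _).mdifferentiableAt (by simp)
  have hq' : MDifferentiableAt 𝓘(ℝ, EZ) 𝓘(ℝ, EB) (quotientProj hp)
      (quotientMap G EP P ⟨y, 0⟩) :=
    (contMDiff_quotientProj hp hρ _).mdifferentiableAt (by simp)
  constructor
  · intro x
    have h1 := HasMFDerivAt.comp (p y) hq.hasMFDerivAt
      (((zeroSection hp hρ).contMDiff (p y)).mdifferentiableAt (by simp)).hasMFDerivAt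
    have h2 : quotientProj hp ∘ zeroSection hp hρ = id :=
      funext fun b => quotientProj_zeroSection hp hρ b
    rw [h2] at h1
    exact DFunLike.congr_fun (hasMFDerivAt_unique h1 (hasMFDerivAt_id (p y))) x
  · intro γ
    have h1 := HasMFDerivAt.comp (0 : EP →L[ℝ] ℝ) hq'.hasMFDerivAt
      (hasMFDerivAt_quotientMap_fiber hρ y)
    have h2 : quotientProj hp ∘ (fun β : EP →L[ℝ] ℝ => quotientMap G EP P ⟨y, β⟩) =
      fun _ => p y := rfl
    rw [h2] at h1
    have h3 := DFunLike.congr_fun (hasMFDerivAt_unique h1 (hasMFDerivAt_const (p y) 0)) γ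
    rw [zeroSection_apply]
    exact h3
  · obtain ⟨m⟩ := exists_localModel hp hρ (p y)
    obtain ⟨A, hA⟩ := m.F_fiber y m.mem_U
    have hFd : MDifferentiableAt 𝓘(ℝ, EZ) 𝓘(ℝ, EP →L[ℝ] ℝ) m.F (quotientMap G EP P ⟨y, 0⟩) :=
      (m.smooth_F.contMDiffAt ((m.isOpen_U.preimage
        (contMDiff_quotientProj hp hρ).continuous).mem_nhds m.mem_U)).mdifferentiableAt (by simp)
    have h1 := HasMFDerivAt.comp (0 : EP →L[ℝ] ℝ) hFd.hasMFDerivAt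
      (hasMFDerivAt_quotientMap_fiber hρ y)
    let C : (EP →L[ℝ] ℝ) →L[ℝ] (EP →L[ℝ] ℝ) := (ContinuousLinearMap.compL ℝ EP EP ℝ).flip A
    have h2 : m.F ∘ (fun β : EP →L[ℝ] ℝ => quotientMap G EP P ⟨y, β⟩) = C := funext hA
    rw [h2] at h1
    have h3 := hasMFDerivAt_unique h1 C.hasMFDerivAt
    have h4 : Function.Injective C := by
      intro β β' hβ
      refine hp.quotientMap_fiber_injective (y := y) ?_
      rw [← m.R_F (quotientMap G EP P ⟨y, β⟩) m.mem_U,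
        ← m.R_F (quotientMap G EP P ⟨y, β'⟩) m.mem_U, hA, hA]
      exact congrArg (fun γ => m.R (p y, γ)) hβ
    intro β β' hβ
    refine h4 ?_
    have h5 := DFunLike.congr_fun h3 β
    have h6 := DFunLike.congr_fun h3 β'
    exact h5.symm.trans ((congrArg _ hβ).trans h6)
  · exact hp.isSmoothSubmersion.2 y
  · intro X
    obtain ⟨v, hv⟩ := hρ.2 (⟨y, 0⟩ : CotangentBundle EP P) X
    let v' : EP × (EP →L[ℝ] ℝ) := v
    refine ⟨mfderiv 𝓘(ℝ, EP) 𝓘(ℝ, EB) p y v'.1, v'.2, ?_⟩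
    have h1 := DFunLike.congr_fun (mfderiv_quotientMap_inl hp hρ y) v'.1
    rw [← hv]
    refine Eq.trans ?_ (congrArg (· + verticalDeriv G EZ y v'.2) h1)
    let T : EP × (EP →L[ℝ] ℝ) →L[ℝ] EZ :=
      mfderiv (cotangentModel EP) 𝓘(ℝ, EZ) (quotientMap G EP P) ⟨y, 0⟩
    exact (congrArg T (show v' = (v'.1, 0) + (0, v'.2) by simp)).trans (map_add T _ _)

variable [T2Space (CotangentQuotient G EP P)]

theorem tensor_zeroSection {w : BilinField 𝓘(ℝ, EZ) (CotangentQuotient G EP P)}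
    (hw : IsPoissonMap (canonicalPoisson EP P) w (quotientMap G EP P)) (y : P)
    (α β : EZ →L[ℝ] ℝ) :
    w (zeroSection hp hρ (p y)) α β =
      β (verticalDeriv G EZ y ((α ∘L (show EB →L[ℝ] EZ from
          mfderiv 𝓘(ℝ, EB) 𝓘(ℝ, EZ) (zeroSection hp hρ) (p y))) ∘L
          (show EP →L[ℝ] EB from mfderiv 𝓘(ℝ, EP) 𝓘(ℝ, EB) p y)))
      - α (verticalDeriv G EZ y ((β ∘L (show EB →L[ℝ] EZ from
          mfderiv 𝓘(ℝ, EB) 𝓘(ℝ, EZ) (zeroSection hp hρ) (p y))) ∘L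
          (show EP →L[ℝ] EB from mfderiv 𝓘(ℝ, EP) 𝓘(ℝ, EB) p y))) := by
  rw [ContinuousLinearMap.comp_assoc, ContinuousLinearMap.comp_assoc,
    ← mfderiv_quotientMap_inl hp hρ y, zeroSection_apply]
  exact hw.tensor_apply _ α β

theorem zeroSection_lagrangian {w : BilinField 𝓘(ℝ, EZ) (CotangentQuotient G EP P)}
    (hw : IsPoissonMap (canonicalPoisson EP P) w (quotientMap G EP P)) (b : B)
    (v : TangentSpace 𝓘(ℝ, EZ) (zeroSection hp hρ b)) :
    v ∈ Set.range (mfderiv 𝓘(ℝ, EB) 𝓘(ℝ, EZ) (zeroSection hp hρ) b) ↔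
      ∃ α : Cotangent 𝓘(ℝ, EZ) (zeroSection hp hρ b), sharp w (zeroSection hp hρ b) α = v ∧
        ∀ β : Cotangent 𝓘(ℝ, EZ) (zeroSection hp hρ b), sharp w (zeroSection hp hρ b) β ∈
          Set.range (mfderiv 𝓘(ℝ, EB) 𝓘(ℝ, EZ) (zeroSection hp hρ) b) →
          w (zeroSection hp hρ b) α β = 0 := by
  obtain ⟨y, rfl⟩ := hp.surjective b
  exact (isSplitting_zeroSection hp hρ y).mem_range_iff (tensor_zeroSection hp hρ hw y)
    (sharp w (zeroSection hp hρ (p y)))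
    (fun α β => apply_sharp w (zeroSection hp hρ (p y)) β α) v

end ZeroSection

section Leaf

variable {EG : Type*} [NormedAddCommGroup EG] [NormedSpace ℝ EG]
  {G : Type*} [Group G] [TopologicalSpace G] [ChartedSpace EG G] [LieGroup 𝓘(ℝ, EG) ∞ G]
  {EP : Type*} [NormedAddCommGroup EP] [NormedSpace ℝ EP] [FiniteDimensional ℝ EP]
  {P : Type*} [TopologicalSpace P] [ChartedSpace EP P] [IsManifold 𝓘(ℝ, EP) ∞ P]
  [MulAction Gᵐᵒᵖ P]
  {EB : Type*} [NormedAddCommGroup EB] [NormedSpace ℝ EB] [FiniteDimensional ℝ EB]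
  {B : Type*} [TopologicalSpace B] [ChartedSpace EB B] [IsManifold 𝓘(ℝ, EB) ∞ B]
  {p : P → B}
  {EZ : Type*} [NormedAddCommGroup EZ] [NormedSpace ℝ EZ] [FiniteDimensional ℝ EZ]
  [ChartedSpace EZ (CotangentQuotient G EP P)]
  [IsManifold 𝓘(ℝ, EZ) ∞ (CotangentQuotient G EP P)]
  {hp : IsPrincipalBundle (EG := EG) (EP := EP) (EB := EB) G p}
  (hρ : IsSmoothSubmersion (I := cotangentModel EP) (I' := 𝓘(ℝ, EZ)) (quotientMap G EP P))

namespace LocalModel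

theorem F_zeroSection {b₀ : B} (m : LocalModel EZ hp b₀) {b : B} (hb : b ∈ m.U) :
    m.F (zeroSection hp hρ b) = 0 := by
  obtain ⟨y, rfl⟩ := hp.surjective b
  obtain ⟨A, hA⟩ := m.F_fiber y hb
  rw [zeroSection_apply]
  exact (hA 0).trans (ContinuousLinearMap.zero_comp A)

theorem contMDiffAt_chart_section {b₀ : B} (m : LocalModel EZ hp b₀) {b : B} (hb : b ∈ m.U) :
    ContMDiffAt 𝓘(ℝ, EB) 𝓘(ℝ, EP) ∞ (fun b => extChartAt 𝓘(ℝ, EP) (m.s b₀) (m.s b)) b :=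
  ContMDiffAt.comp b (contMDiffAt_extChartAt' (by simpa using m.mem_source b hb))
    (m.smooth_s.contMDiffAt (m.isOpen_U.mem_nhds hb))

/-- The derivative at `b` of the section `s`, in coordinates around `b₀` and `s b₀`. -/
def derivSection {b₀ : B} (m : LocalModel EZ hp b₀) (b : B) : EB →L[ℝ] EP :=
  fderiv ℝ ((fun b => extChartAt 𝓘(ℝ, EP) (m.s b₀) (m.s b)) ∘ (extChartAt 𝓘(ℝ, EB) b₀).symm)
    (extChartAt 𝓘(ℝ, EB) b₀ b)

theorem contDiffAt_section {b₀ : B} (m : LocalModel EZ hp b₀) {b : B} (hb : b ∈ m.U)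
    (hb' : b ∈ (extChartAt 𝓘(ℝ, EB) b₀).source) :
    ContDiffAt ℝ ∞ ((fun b => extChartAt 𝓘(ℝ, EP) (m.s b₀) (m.s b)) ∘
      (extChartAt 𝓘(ℝ, EB) b₀).symm) (extChartAt 𝓘(ℝ, EB) b₀ b) :=
  contDiffAt_comp_extChartAt_symm ((extChartAt 𝓘(ℝ, EB) b₀).map_source hb')
    (by rw [(extChartAt 𝓘(ℝ, EB) b₀).left_inv hb']; exact m.contMDiffAt_chart_section hb)

theorem contMDiffAt_derivSection {b₀ : B} (m : LocalModel EZ hp b₀) {b : B} (hb : b ∈ m.U)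
    (hb' : b ∈ (extChartAt 𝓘(ℝ, EB) b₀).source) :
    ContMDiffAt 𝓘(ℝ, EB) 𝓘(ℝ, EB →L[ℝ] EP) ∞ m.derivSection b := by
  have h1 := (m.contDiffAt_section hb hb').fderiv_right (m := ∞) (by simp)
  exact h1.contMDiffAt.comp b (contMDiffAt_extChartAt' (by simpa using hb'))

theorem mfderiv_proj_derivSection {b₀ : B} (m : LocalModel EZ hp b₀) {b : B} (hb : b ∈ m.U)
    (hb' : b ∈ (extChartAt 𝓘(ℝ, EB) b₀).source) (v : EB) :
    mfderiv 𝓘(ℝ, EP) 𝓘(ℝ, EB) p (m.s b) (mfderiv 𝓘(ℝ, EP) 𝓘(ℝ, EP)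
      (extChartAt 𝓘(ℝ, EP) (m.s b₀)).symm (extChartAt 𝓘(ℝ, EP) (m.s b₀) (m.s b))
      (m.derivSection b v)) =
    mfderiv 𝓘(ℝ, EB) 𝓘(ℝ, EB) (extChartAt 𝓘(ℝ, EB) b₀).symm (extChartAt 𝓘(ℝ, EB) b₀ b) v := by
  set φ := extChartAt 𝓘(ℝ, EP) (m.s b₀)
  set ψ := extChartAt 𝓘(ℝ, EB) b₀
  have hbt : ψ b ∈ ψ.target := ψ.map_source hb'
  have h0 : ψ.symm (ψ b) = b := ψ.left_inv hb'
  have h1 : HasMFDerivAt 𝓘(ℝ, EB) 𝓘(ℝ, EP) ((fun b => φ (m.s b)) ∘ ψ.symm) (ψ b)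
      (m.derivSection b) :=
    ((m.contDiffAt_section hb hb').differentiableAt (by simp)).hasFDerivAt.hasMFDerivAt
  have h2 : HasMFDerivAt 𝓘(ℝ, EP) 𝓘(ℝ, EP) φ.symm (((fun b => φ (m.s b)) ∘ ψ.symm) (ψ b))
      (mfderiv 𝓘(ℝ, EP) 𝓘(ℝ, EP) φ.symm (φ (m.s b))) := by
    rw [Function.comp_apply, h0]
    exact (mdifferentiableAt_extChartAt_symm_self
      (φ.map_source (m.mem_source b hb))).hasMFDerivAt
  have h3 : HasMFDerivAt 𝓘(ℝ, EP) 𝓘(ℝ, EB) p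
      (φ.symm (((fun b => φ (m.s b)) ∘ ψ.symm) (ψ b)))
      (mfderiv 𝓘(ℝ, EP) 𝓘(ℝ, EB) p (m.s b)) := by
    rw [Function.comp_apply, h0, φ.left_inv (m.mem_source b hb)]
    exact ((hp.smooth_proj _).mdifferentiableAt (by simp)).hasMFDerivAt
  have h4 := HasMFDerivAt.comp (ψ b) h3 (HasMFDerivAt.comp (ψ b) h2 h1)
  have h5 : p ∘ φ.symm ∘ (fun b => φ (m.s b)) ∘ ψ.symm =ᶠ[𝓝 (ψ b)] ψ.symm := by
    have h6 : ContinuousAt ψ.symm (ψ b) :=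
      (mdifferentiableAt_extChartAt_symm_self hbt).continuousAt
    filter_upwards [h6.preimage_mem_nhds (m.isOpen_U.mem_nhds (h0.symm ▸ hb))] with u hu
    simp only [Function.comp_apply]
    rw [φ.left_inv (m.mem_source _ hu), m.proj_s _ hu]
  have h7 := h4.congr_of_eventuallyEq h5.symm
  have h8 := (mdifferentiableAt_extChartAt_symm_self hbt).hasMFDerivAt
  exact DFunLike.congr_fun (hasMFDerivAt_unique h7 h8) v

end LocalModel

variable [T2Space B] [T2Space (CotangentQuotient G EP P)]

/-- The constant vector fields in a chart of `B` are, along the zero section, Hamiltonian vector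
fields of `T*P/G`. -/
theorem exists_hamiltonian_translation {w : BilinField 𝓘(ℝ, EZ) (CotangentQuotient G EP P)}
    (hw : IsPoissonMap (canonicalPoisson EP P) w (quotientMap G EP P)) (b₀ : B) :
    ∃ (U : Set B) (f : EB → CotangentQuotient G EP P → ℝ), U ∈ 𝓝 b₀ ∧
      U ⊆ (extChartAt 𝓘(ℝ, EB) b₀).source ∧
      (∀ v, ContMDiff 𝓘(ℝ, EZ) 𝓘(ℝ, ℝ) ∞ (f v)) ∧
      ∀ v, ∀ b ∈ U, sharp w (zeroSection hp hρ b) (diff 𝓘(ℝ, EZ) (f v) (zeroSection hp hρ b)) =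
        mfderiv 𝓘(ℝ, EB) 𝓘(ℝ, EZ) (zeroSection hp hρ) b
          (mfderiv 𝓘(ℝ, EB) 𝓘(ℝ, EB) (extChartAt 𝓘(ℝ, EB) b₀).symm
            (extChartAt 𝓘(ℝ, EB) b₀ b) v) := by
  obtain ⟨m⟩ := exists_localModel hp hρ b₀
  set ψ := extChartAt 𝓘(ℝ, EB) b₀ with hψ
  have hU : IsOpen (m.U ∩ ψ.source) := m.isOpen_U.inter (isOpen_extChartAt_source _)
  obtain ⟨χ, hχ, hχ1, hχU⟩ := exists_cutoff (I := 𝓘(ℝ, EB)) hU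
    ⟨m.mem_U, mem_extChartAt_source b₀⟩
  let f : EB → CotangentQuotient G EP P → ℝ := fun v z =>
    χ (quotientProj hp z) • m.F z (m.derivSection (quotientProj hp z) v)
  have hf : ∀ v, ContMDiff 𝓘(ℝ, EZ) 𝓘(ℝ, ℝ) ∞ (f v) := by
    intro v
    refine contMDiff_cutoff_smul hU hχ hχU (contMDiff_quotientProj hp hρ) ?_
    intro z hz
    have h1 : ContMDiffAt 𝓘(ℝ, EZ) 𝓘(ℝ, EB →L[ℝ] EP) ∞
        (fun z => m.derivSection (quotientProj hp z)) z :=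
      (m.contMDiffAt_derivSection hz.1 hz.2).comp z (contMDiff_quotientProj hp hρ z)
    have h2 : ContMDiffAt 𝓘(ℝ, EZ) 𝓘(ℝ, EP →L[ℝ] ℝ) ∞ m.F z :=
      m.smooth_F.contMDiffAt ((m.isOpen_U.preimage
        (contMDiff_quotientProj hp hρ).continuous).mem_nhds hz.1)
    exact (h2.clm_apply (h1.clm_apply contMDiffAt_const)).contMDiffWithinAt
  refine ⟨(m.U ∩ ψ.source) ∩ {b | χ b = 1}, f,
    Filter.inter_mem (hU.mem_nhds ⟨m.mem_U, mem_extChartAt_source b₀⟩) hχ1,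
    fun b hb => hb.1.2, hf, ?_⟩
  have key : ∀ v, ∀ y : P, p y ∈ m.U → p y ∈ ψ.source → χ (p y) = 1 → y = m.s (p y) →
      sharp w (zeroSection hp hρ (p y)) (diff 𝓘(ℝ, EZ) (f v) (zeroSection hp hρ (p y))) =
        mfderiv 𝓘(ℝ, EB) 𝓘(ℝ, EZ) (zeroSection hp hρ) (p y) (mfderiv 𝓘(ℝ, EP) 𝓘(ℝ, EB) p y
          (mfderiv 𝓘(ℝ, EP) 𝓘(ℝ, EP) (extChartAt 𝓘(ℝ, EP) (m.s b₀)).symm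
            (extChartAt 𝓘(ℝ, EP) (m.s b₀) (m.s (p y))) (m.derivSection (p y) v))) := by
    intro v y hyU hyψ hyχ hys
    set u : EP := mfderiv 𝓘(ℝ, EP) 𝓘(ℝ, EP) (extChartAt 𝓘(ℝ, EP) (m.s b₀)).symm
            (extChartAt 𝓘(ℝ, EP) (m.s b₀) (m.s (p y))) (m.derivSection (p y) v) with hu
    let df : EZ →L[ℝ] ℝ := diff 𝓘(ℝ, EZ) (f v) (zeroSection hp hρ (p y))
    have hd : ∀ z, HasMFDerivAt 𝓘(ℝ, EZ) 𝓘(ℝ, ℝ) (f v) z (diff 𝓘(ℝ, EZ) (f v) z) := fun z =>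
      ((hf v z).mdifferentiableAt (by simp)).hasMFDerivAt
    have h1 : ∀ γ : EP →L[ℝ] ℝ, df (verticalDeriv G EZ y γ) = γ u := by
      intro γ
      have h2 := HasMFDerivAt.comp (0 : EP →L[ℝ] ℝ) (hd (quotientMap G EP P ⟨y, 0⟩))
        (hasMFDerivAt_quotientMap_fiber hρ y)
      have h3 : f v ∘ (fun β : EP →L[ℝ] ℝ => quotientMap G EP P ⟨y, β⟩) =
          ContinuousLinearMap.apply ℝ ℝ u := by
        funext β
        have h4 : m.F (quotientMap G EP P ⟨y, β⟩) = β ∘L (show EP →L[ℝ] EP from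
            mfderiv 𝓘(ℝ, EP) 𝓘(ℝ, EP) (extChartAt 𝓘(ℝ, EP) (m.s b₀)).symm
            (extChartAt 𝓘(ℝ, EP) (m.s b₀) (m.s (p y)))) := by
          rw [hys, m.proj_s _ hyU]
          exact m.F_slice _ hyU β
        change χ (p y) • m.F (quotientMap G EP P ⟨y, β⟩) (m.derivSection (p y) v) = β u
        rw [h4, hyχ, one_smul]
        rfl
      rw [h3] at h2
      have h5 := DFunLike.congr_fun
        (hasMFDerivAt_unique h2 (ContinuousLinearMap.apply ℝ ℝ u).hasMFDerivAt) γ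
      refine Eq.trans ?_ h5
      change (diff 𝓘(ℝ, EZ) (f v) (zeroSection hp hρ (p y)) : EZ →L[ℝ] ℝ) _ =
        (diff 𝓘(ℝ, EZ) (f v) (quotientMap G EP P ⟨y, 0⟩) : EZ →L[ℝ] ℝ) _
      rw [zeroSection_apply]
      rfl
    have h6 : df ∘L (show EB →L[ℝ] EZ from
        mfderiv 𝓘(ℝ, EB) 𝓘(ℝ, EZ) (zeroSection hp hρ) (p y)) = 0 := by
      have h2 := HasMFDerivAt.comp (p y) (hd (zeroSection hp hρ (p y)))
        (((zeroSection hp hρ).contMDiff (p y)).mdifferentiableAt (by simp)).hasMFDerivAt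
      have h3 : f v ∘ zeroSection hp hρ =ᶠ[𝓝 (p y)] fun _ => 0 := by
        filter_upwards [m.isOpen_U.mem_nhds hyU] with b hb
        change χ _ • m.F _ _ = 0
        rw [m.F_zeroSection hρ hb, zero_apply, smul_zero]
      exact hasMFDerivAt_unique (h2.congr_of_eventuallyEq h3.symm)
        (hasMFDerivAt_const (0 : ℝ) (p y))
    have h7 := (isSplitting_zeroSection hp hρ y).sharp_eq (tensor_zeroSection hp hρ hw y)
      (α := df) h1 (fun β => apply_sharp w (zeroSection hp hρ (p y)) β df)
    rw [h6, ContinuousLinearMap.zero_comp, map_zero, sub_zero] at h7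
    exact h7
  rintro v b ⟨⟨hbU, hbψ⟩, hbχ⟩
  have hpb : p (m.s b) = b := m.proj_s b hbU
  have h1 := key v (m.s b) (by rwa [hpb]) (by rwa [hpb]) (by rwa [hpb]) (by rw [hpb])
  rw [hpb] at h1
  exact h1.trans (congrArg _ (m.mfderiv_proj_derivSection hbU hbψ v))

theorem exists_hamiltonianStep_nhds {w : BilinField 𝓘(ℝ, EZ) (CotangentQuotient G EP P)}
    (hw : IsPoissonMap (canonicalPoisson EP P) w (quotientMap G EP P)) (b₀ : B) :
    ∃ U ∈ 𝓝 b₀, ∀ b ∈ U, ∀ b' ∈ U,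
      HamiltonianStep w (zeroSection hp hρ b) (zeroSection hp hρ b') := by
  obtain ⟨U, f, hU, hUψ, hf, hsharp⟩ := exists_hamiltonian_translation (hp := hp) hρ hw b₀
  set ψ := extChartAt 𝓘(ℝ, EB) b₀ with hψ
  have h1 : ψ.target ∩ ψ.symm ⁻¹' U ∈ 𝓝 (ψ b₀) := by
    refine Filter.inter_mem (extChartAt_target_mem_nhds b₀) ?_
    refine (continuousAt_extChartAt_symm (I := 𝓘(ℝ, EB)) b₀).preimage_mem_nhds ?_
    rwa [extChartAt_to_inv]
  obtain ⟨r, hr, hball⟩ := Metric.mem_nhds_iff.1 h1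
  refine ⟨ψ.source ∩ ψ ⁻¹' Metric.ball (ψ b₀) r, Filter.inter_mem (extChartAt_source_mem_nhds b₀)
    ((continuousAt_extChartAt (I := 𝓘(ℝ, EB)) b₀).preimage_mem_nhds
      (Metric.ball_mem_nhds _ hr)), ?_⟩
  rintro b ⟨hb, hbr⟩ b' ⟨hb', hbr'⟩
  set v := ψ b' - ψ b with hv
  refine ⟨f v, hf v, fun t => zeroSection hp hρ (ψ.symm (ψ b + t • v)), ?_, ?_, ?_⟩
  · simp only [zero_smul, add_zero]
    rw [ψ.left_inv hb]
  · simp only [one_smul, hv, add_sub_cancel]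
    rw [ψ.left_inv hb']
  · intro t ht
    have hu : ψ b + t • v ∈ Metric.ball (ψ b₀) r :=
      (convex_ball (ψ b₀) r).add_smul_sub_mem hbr hbr' ht
    obtain ⟨hut, huU⟩ := hball hu
    have h2 := hsharp v _ huU
    rw [ψ.right_inv hut] at h2
    have h3 : HasMFDerivAt 𝓘(ℝ, ℝ) 𝓘(ℝ, EB) (fun t : ℝ => ψ b + t • v) t
        ((1 : ℝ →L[ℝ] ℝ).smulRight v) := by
      have h4 : HasDerivAt (fun t : ℝ => ψ b + t • v) v t := by
        simpa using ((hasDerivAt_id t).smul_const v).const_add (ψ b)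
      exact h4.hasFDerivAt.hasMFDerivAt
    have h5 := (mdifferentiableAt_extChartAt_symm_self hut).hasMFDerivAt
    have h6 := (((zeroSection hp hρ).contMDiff
      (ψ.symm (ψ b + t • v))).mdifferentiableAt (by simp)).hasMFDerivAt
    have h7 := HasMFDerivAt.comp t h6 (HasMFDerivAt.comp t h5 h3)
    refine HasMFDerivAt.hasMFDerivWithinAt (h7.congr_mfderiv (ContinuousLinearMap.ext_ring ?_))
    have h8 : ((1 : ℝ →L[ℝ] ℝ).smulRight v) 1 = v := by simp
    exact (congrArg (fun v' => mfderiv 𝓘(ℝ, EB) 𝓘(ℝ, EZ) (zeroSection hp hρ) _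
      (mfderiv 𝓘(ℝ, EB) 𝓘(ℝ, EB) ψ.symm (ψ b + t • v) v')) h8).trans
      (h2.symm.trans (one_smul ℝ _).symm)

theorem zeroSection_leaf {w : BilinField 𝓘(ℝ, EZ) (CotangentQuotient G EP P)}
    (hw : IsPoissonMap (canonicalPoisson EP P) w (quotientMap G EP P)) (x y : B)
    (hy : y ∈ connectedComponent x) :
    zeroSection hp hρ y ∈ symplecticLeaf w (zeroSection hp hρ x) := by
  refine isPreconnected_connectedComponent.induction₂'
    (fun b b' => zeroSection hp hρ b' ∈ symplecticLeaf w (zeroSection hp hρ b)) (fun b _ => ?_)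
    (fun a b c _ _ _ hab hbc => Relation.ReflTransGen.trans hab hbc) mem_connectedComponent hy
  obtain ⟨U, hU, hstep⟩ := exists_hamiltonianStep_nhds (hp := hp) hρ hw b
  filter_upwards [mem_nhdsWithin_of_mem_nhds hU] with b' hb'
  have hb := mem_of_mem_nhds hU
  exact ⟨Relation.ReflTransGen.single (hstep b hb b' hb'),
    Relation.ReflTransGen.single (hstep b' hb' b hb)⟩

theorem isLagrangianInLeaf_zeroSection {w : BilinField 𝓘(ℝ, EZ) (CotangentQuotient G EP P)}
    (hw : IsPoissonMap (canonicalPoisson EP P) w (quotientMap G EP P)) :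
    IsLagrangianInLeaf 𝓘(ℝ, EB) B w (zeroSection hp hρ) where
  smooth := (zeroSection hp hρ).contMDiff
  immersion := by
    intro b
    obtain ⟨y, rfl⟩ := hp.surjective b
    exact Function.LeftInverse.injective (isSplitting_zeroSection hp hρ y).R_D
  embedding := Topology.IsEmbedding.of_leftInverse (f := quotientProj hp)
    (quotientProj_zeroSection hp hρ) (contMDiff_quotientProj hp hρ).continuous
    (zeroSection hp hρ).contMDiff.continuous
  leaf := zeroSection_leaf hρ hw
  lagrangian := zeroSection_lagrangian hp hρ hw

end Leaf

theorem IsSplitting.eq_of_D_eq {V₁ V₂ V₃ : Type*} [NormedAddCommGroup V₁] [NormedSpace ℝ V₁]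
    [NormedAddCommGroup V₂] [NormedSpace ℝ V₂] [NormedAddCommGroup V₃] [NormedSpace ℝ V₃]
    {D : V₁ →L[ℝ] V₃} {V : (V₂ →L[ℝ] ℝ) →L[ℝ] V₃} {S : V₂ →L[ℝ] V₁} {R : V₃ →L[ℝ] V₁}
    (h : IsSplitting D V S R) {u : V₁} {β β' : V₂ →L[ℝ] ℝ} (hu : D u = V β - V β') : β = β' := by
  have h1 := congrArg R hu
  rw [h.R_D, map_sub, h.R_V, h.R_V, sub_zero] at h1
  rw [h1, map_zero] at hu
  exact h.V_injective (sub_eq_zero.1 hu.symm)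

section VectorBundles

variable {EX : Type*} [NormedAddCommGroup EX] [NormedSpace ℝ EX]
  {X : Type*} [TopologicalSpace X] [ChartedSpace EX X] [IsManifold 𝓘(ℝ, EX) ∞ X]
  {F : Type*} [NormedAddCommGroup F] [NormedSpace ℝ F] {E : X → Type*}
  [∀ x, AddCommMonoid (E x)] [∀ x, Module ℝ (E x)] [TopologicalSpace (Bundle.TotalSpace F E)]
  [∀ x, TopologicalSpace (E x)] [FiberBundle F E] [VectorBundle ℝ F E]
  [ContMDiffVectorBundle ∞ F E 𝓘(ℝ, EX)]

theorem surjective_mfderiv_bundle_proj (v : Bundle.TotalSpace F E) :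
    Function.Surjective (mfderiv (𝓘(ℝ, EX).prod 𝓘(ℝ, F)) 𝓘(ℝ, EX)
      (Bundle.TotalSpace.proj : Bundle.TotalSpace F E → X) v) := by
  let e := trivializationAt F E v.proj
  have hv : v ∈ e.source := FiberBundle.mem_trivializationAt_proj_source
  have he : ∀ x ∈ e.baseSet, (x, (e v).2) ∈ e.target := fun x hx => e.mem_target.2 hx
  let σ : X → Bundle.TotalSpace F E := fun x => e.toOpenPartialHomeomorph.symm (x, (e v).2)
  have hσ : σ v.proj = v := by
    have h1 : (v.proj, (e v).2) = e v := e.mk_proj_snd hv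
    simp only [σ]
    rw [h1]
    exact e.symm_apply_apply hv
  have hb : v.proj ∈ e.baseSet := FiberBundle.mem_baseSet_trivializationAt' v.proj
  have hσs : ContMDiffAt 𝓘(ℝ, EX) (𝓘(ℝ, EX).prod 𝓘(ℝ, F)) ∞ σ v.proj := by
    have h1 : ContMDiffAt (𝓘(ℝ, EX).prod 𝓘(ℝ, F)) (𝓘(ℝ, EX).prod 𝓘(ℝ, F)) ∞
        e.toOpenPartialHomeomorph.symm (v.proj, (e v).2) :=
      (Bundle.Trivialization.contMDiffOn_symm (n := ∞) (IB := 𝓘(ℝ, EX)) e).contMDiffAt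
        (e.open_target.mem_nhds (he _ hb))
    exact h1.comp v.proj (contMDiffAt_id.prodMk contMDiffAt_const)
  have h2 := surjective_mfderiv_of_section (I := 𝓘(ℝ, EX).prod 𝓘(ℝ, F)) (I' := 𝓘(ℝ, EX))
    (f := (Bundle.TotalSpace.proj : Bundle.TotalSpace F E → X)) (σ := σ) (y := v.proj)
    ((Bundle.contMDiff_proj (n := ∞) E _).mdifferentiableAt (by simp))
    (hσs.mdifferentiableAt (by simp)) (by
      filter_upwards [e.open_baseSet.mem_nhds hb] with x hx
      exact e.proj_symm_apply (he x hx))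
  rwa [hσ] at h2

theorem contMDiff_fiber_line (x : X) (v v' : E x) :
    ContMDiff 𝓘(ℝ, ℝ) (𝓘(ℝ, EX).prod 𝓘(ℝ, F)) ∞
      (fun t : ℝ => (⟨x, v + t • v'⟩ : Bundle.TotalSpace F E)) := by
  intro t
  rw [Bundle.contMDiffAt_totalSpace]
  refine ⟨contMDiffAt_const, ?_⟩
  simp only
  let L := (trivializationAt F E x).linearMapAt ℝ x
  have hx : x ∈ (trivializationAt F E x).baseSet := FiberBundle.mem_baseSet_trivializationAt' x
  have h1 : (fun t : ℝ => (trivializationAt F E x ⟨x, v + t • v'⟩).2) =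
      fun t : ℝ => L v + t • L v' := by
    funext t
    rw [← map_smul, ← map_add]
    exact congrFun ((trivializationAt F E x).coe_linearMapAt_of_mem (R := ℝ) hx).symm _
  rw [h1]
  exact ((contDiff_const (c := L v)).add (contDiff_id.smul contDiff_const)).contMDiff t

end VectorBundles

section NormalBundles

variable {EX : Type*} [NormedAddCommGroup EX] [NormedSpace ℝ EX]
  {X : Type*} [TopologicalSpace X] [ChartedSpace EX X] [IsManifold 𝓘(ℝ, EX) ∞ X]
  {EZ : Type*} [NormedAddCommGroup EZ] [NormedSpace ℝ EZ] [FiniteDimensional ℝ EZ]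
  {Z : Type*} [TopologicalSpace Z] [ChartedSpace EZ Z] [IsManifold 𝓘(ℝ, EZ) ∞ Z]
  (i : C^∞⟮𝓘(ℝ, EX), X; 𝓘(ℝ, EZ), Z⟯)

/-- The restriction `TZ|_X`. -/
abbrev RestrictedTangent : Type _ :=
  Bundle.TotalSpace EZ (i *ᵖ (TangentSpace 𝓘(ℝ, EZ) : Z → Type _))

theorem contMDiff_pullback_lift :
    ContMDiff (𝓘(ℝ, EX).prod 𝓘(ℝ, EZ)) (𝓘(ℝ, EZ).prod 𝓘(ℝ, EZ)) ∞
      (fun v : RestrictedTangent i => (⟨i v.proj, v.snd⟩ : TangentBundle 𝓘(ℝ, EZ) Z)) := by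
  intro v
  rw [Bundle.contMDiffAt_totalSpace]
  refine ⟨i.contMDiff.contMDiffAt.comp v (Bundle.contMDiff_proj _ v), ?_⟩
  have h1 : ContMDiffAt (𝓘(ℝ, EX).prod 𝓘(ℝ, EZ)) (𝓘(ℝ, EX).prod 𝓘(ℝ, EZ)) ∞
      (id : RestrictedTangent i → RestrictedTangent i) v := contMDiffAt_id
  exact (Bundle.contMDiffAt_totalSpace.1 h1).2

/-- The derivative of a vector-valued function, restricted to `TZ|_X`, is smooth. -/
theorem contMDiff_mfderiv_restricted {W : Type*} [NormedAddCommGroup W] [NormedSpace ℝ W]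
    {f : Z → W} (hf : ContMDiff 𝓘(ℝ, EZ) 𝓘(ℝ, W) ∞ f) :
    ContMDiff (𝓘(ℝ, EX).prod 𝓘(ℝ, EZ)) 𝓘(ℝ, W) ∞
      (fun v : RestrictedTangent i =>
        (show EZ →L[ℝ] W from mfderiv 𝓘(ℝ, EZ) 𝓘(ℝ, W) f (i v.proj)) v.snd) :=
  (contMDiff_snd_tangentBundle_modelSpace W 𝓘(ℝ, W)).comp
    ((hf.contMDiff_tangentMap (m := ∞) (by simp)).comp (contMDiff_pullback_lift i))

variable {i}

theorem normalProj_eq_iff {x x' : X} {v v' : EZ} :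
    normalProj i ⟨x, v⟩ = normalProj i ⟨x', v'⟩ ↔
      x = x' ∧ ∃ u : EX, (show EX →L[ℝ] EZ from mfderiv 𝓘(ℝ, EX) 𝓘(ℝ, EZ) i x) u = v - v' := by
  constructor
  · intro h
    have hx : x = x' := congrArg NormalBundle.base h
    subst hx
    refine ⟨rfl, ?_⟩
    have h1 := (NormalBundle.mk.injEq _ _ _ _).mp h
    exact (Submodule.Quotient.eq (tangentRange i x)).1 (eq_of_heq h1.2)
  · rintro ⟨rfl, h⟩
    have h1 := (Submodule.Quotient.eq (tangentRange i x)).2 h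
    exact congrArg (NormalBundle.mk x) h1

theorem normalProj_surjective : Function.Surjective (normalProj i) := by
  rintro ⟨x, v⟩
  obtain ⟨v', rfl⟩ := Submodule.Quotient.mk_surjective _ v
  exact ⟨⟨x, v'⟩, rfl⟩

end NormalBundles

section Linearization

variable {EG : Type*} [NormedAddCommGroup EG] [NormedSpace ℝ EG]
  {G : Type*} [Group G] [TopologicalSpace G] [ChartedSpace EG G] [LieGroup 𝓘(ℝ, EG) ∞ G]
  {EP : Type*} [NormedAddCommGroup EP] [NormedSpace ℝ EP] [FiniteDimensional ℝ EP]
  {P : Type*} [TopologicalSpace P] [ChartedSpace EP P] [IsManifold 𝓘(ℝ, EP) ∞ P]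
  [MulAction Gᵐᵒᵖ P]
  {EB : Type*} [NormedAddCommGroup EB] [NormedSpace ℝ EB] [FiniteDimensional ℝ EB]
  {B : Type*} [TopologicalSpace B] [ChartedSpace EB B] [IsManifold 𝓘(ℝ, EB) ∞ B]
  {p : P → B}
  {EZ : Type*} [NormedAddCommGroup EZ] [NormedSpace ℝ EZ] [FiniteDimensional ℝ EZ]
  [ChartedSpace EZ (CotangentQuotient G EP P)]
  [IsManifold 𝓘(ℝ, EZ) ∞ (CotangentQuotient G EP P)]
  (hp : IsPrincipalBundle (EG := EG) (EP := EP) (EB := EB) G p)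
  (hρ : IsSmoothSubmersion (I := cotangentModel EP) (I' := 𝓘(ℝ, EZ)) (quotientMap G EP P))

include hρ in
theorem verticalDeriv_cotangentLift (g : G) (a : CotangentBundle EP P) :
    verticalDeriv G EZ (EP := EP) (cotangentLift g a).proj (cotangentLift g a).snd =
      verticalDeriv G EZ (EP := EP) a.proj a.snd := by
  let C : (EP →L[ℝ] ℝ) →L[ℝ] (EP →L[ℝ] ℝ) := (ContinuousLinearMap.compL ℝ EP EP ℝ).flip
    (show EP →L[ℝ] EP from mfderiv 𝓘(ℝ, EP) 𝓘(ℝ, EP) (rightMul g⁻¹ : P → P) (rightMul g a.proj))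
  have h0 : HasMFDerivAt 𝓘(ℝ, EP →L[ℝ] ℝ) 𝓘(ℝ, EZ)
      (fun β : EP →L[ℝ] ℝ => quotientMap G EP P ⟨rightMul g a.proj, β⟩) (C 0)
      (verticalDeriv G EZ (rightMul g a.proj)) := by
    rw [map_zero]
    exact hasMFDerivAt_quotientMap_fiber hρ (rightMul g a.proj)
  have h1 := HasMFDerivAt.comp (0 : EP →L[ℝ] ℝ) h0 C.hasMFDerivAt
  have h2 : (fun β : EP →L[ℝ] ℝ => quotientMap G EP P ⟨rightMul g a.proj, β⟩) ∘ C =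
      fun β : EP →L[ℝ] ℝ => quotientMap G EP P ⟨a.proj, β⟩ :=
    funext fun β => IsPrincipalBundle.quotientMap_cotangentLift g ⟨a.proj, β⟩
  rw [h2] at h1
  exact DFunLike.congr_fun (hasMFDerivAt_unique h1 (hasMFDerivAt_quotientMap_fiber hρ a.proj)) a.snd

/-- The linearization `ρ(α) ↦ [d/dt ρ(tα)]` of `T*P/G` at the zero section. -/
def linearization : CotangentQuotient G EP P → NormalBundle (zeroSection hp hρ) :=
  Quot.lift (fun a => normalProj (zeroSection hp hρ) 
    ⟨p a.proj, verticalDeriv G EZ (EP := EP) a.proj a.snd⟩) (by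
    rintro a _ ⟨g, rfl⟩
    refine normalProj_eq_iff.2 ⟨(hp.proj_rightMul g a.proj).symm, 0, ?_⟩
    rw [map_zero, verticalDeriv_cotangentLift hρ, sub_self])

theorem linearization_base (z : CotangentQuotient G EP P) :
    (linearization hp hρ z).base = quotientProj hp z := by
  obtain ⟨a, rfl⟩ := quotientMap_surjective z
  rfl

theorem normalProj_splitting (y : P) (u : EB) (β : EP →L[ℝ] ℝ) :
    normalProj (zeroSection hp hρ) ⟨p y, (show EB →L[ℝ] EZ from
      mfderiv 𝓘(ℝ, EB) 𝓘(ℝ, EZ) (zeroSection hp hρ) (p y)) u + verticalDeriv G EZ y β⟩ =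
      linearization hp hρ (quotientMap G EP P ⟨y, β⟩) :=
  normalProj_eq_iff.2 ⟨rfl, u, (add_sub_cancel_right _ _).symm⟩

theorem linearization_bijective : Function.Bijective (linearization hp hρ) := by
  constructor
  · intro z z' h
    obtain ⟨⟨y, β⟩, rfl⟩ := quotientMap_surjective z
    have hb : quotientProj hp z' = p y := by
      rw [← linearization_base hp hρ z', ← h]
      rfl
    obtain ⟨β', rfl⟩ := hp.exists_fiber_point y z' hb
    obtain ⟨-, u, hu⟩ := normalProj_eq_iff.1 h
    have hs := isSplitting_zeroSection hp hρ y
    have h2 := hs.eq_of_D_eq hu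
    exact congrArg (fun β : EP →L[ℝ] ℝ => quotientMap G EP P ⟨y, β⟩) h2
  · intro n
    obtain ⟨⟨b, v⟩, rfl⟩ := normalProj_surjective n
    obtain ⟨y, rfl⟩ := hp.surjective b
    obtain ⟨u, β, huβ⟩ := (isSplitting_zeroSection hp hρ y).exists_eq v
    refine ⟨quotientMap G EP P ⟨y, β⟩, ?_⟩
    rw [← normalProj_splitting hp hρ y u β, ← huβ]

/-- The linearization as a bijection. -/
def linearizationEquiv : CotangentQuotient G EP P ≃ NormalBundle (zeroSection hp hρ) :=
  Equiv.ofBijective _ (linearization_bijective hp hρ)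

/-- The projection of the restricted tangent bundle onto the normal bundle, identified with
`T*P/G`. -/
def normalQuotient (v : RestrictedTangent (zeroSection hp hρ)) : CotangentQuotient G EP P :=
  (linearizationEquiv hp hρ).symm (normalProj (zeroSection hp hρ) v)

theorem linearization_normalQuotient (v : RestrictedTangent (zeroSection hp hρ)) :
    linearization hp hρ (normalQuotient hp hρ v) = normalProj (zeroSection hp hρ) v :=
  (linearizationEquiv hp hρ).apply_symm_apply _

theorem normalQuotient_splitting (y : P) (u : EB) (β : EP →L[ℝ] ℝ) :
    normalQuotient hp hρ ⟨p y, (show EB →L[ℝ] EZ from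
      mfderiv 𝓘(ℝ, EB) 𝓘(ℝ, EZ) (zeroSection hp hρ) (p y)) u + verticalDeriv G EZ y β⟩ =
      quotientMap G EP P ⟨y, β⟩ := by
  rw [normalQuotient, normalProj_splitting]
  exact (linearizationEquiv hp hρ).symm_apply_apply (quotientMap G EP P ⟨y, β⟩)

theorem normalQuotient_surjective : Function.Surjective (normalQuotient hp hρ) :=
  (linearizationEquiv hp hρ).symm.surjective.comp normalProj_surjective

theorem quotientProj_normalQuotient (v : RestrictedTangent (zeroSection hp hρ)) :
    quotientProj hp (normalQuotient hp hρ v) = v.proj := by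
  rw [← linearization_base hp hρ, linearization_normalQuotient]
  rfl

namespace LocalModel

variable {hp}

include hρ in
theorem contMDiffAt_F {b₀ : B} (m : LocalModel EZ hp b₀) {z : CotangentQuotient G EP P}
    (hz : quotientProj hp z ∈ m.U) : ContMDiffAt 𝓘(ℝ, EZ) 𝓘(ℝ, EP →L[ℝ] ℝ) ∞ m.F z :=
  m.smooth_F.contMDiffAt ((m.isOpen_U.preimage (contMDiff_quotientProj hp hρ).continuous).mem_nhds
    hz)

theorem mfderiv_F_splitting {b₀ : B} (m : LocalModel EZ hp b₀) {y : P} (hy : p y ∈ m.U) (u : EB)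
    (β : EP →L[ℝ] ℝ) :
    (show EZ →L[ℝ] (EP →L[ℝ] ℝ) from mfderiv 𝓘(ℝ, EZ) 𝓘(ℝ, EP →L[ℝ] ℝ) m.F
        (zeroSection hp hρ (p y)))
      ((show EB →L[ℝ] EZ from
        mfderiv 𝓘(ℝ, EB) 𝓘(ℝ, EZ) (zeroSection hp hρ) (p y)) u + verticalDeriv G EZ y β) =
      m.F (quotientMap G EP P ⟨y, β⟩) := by
  have hF : HasMFDerivAt 𝓘(ℝ, EZ) 𝓘(ℝ, EP →L[ℝ] ℝ) m.F (zeroSection hp hρ (p y))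
      (mfderiv 𝓘(ℝ, EZ) 𝓘(ℝ, EP →L[ℝ] ℝ) m.F (zeroSection hp hρ (p y))) :=
    ((m.contMDiffAt_F hρ
      (by rw [quotientProj_zeroSection]; exact hy)).mdifferentiableAt (by simp)).hasMFDerivAt
  have hF' : HasMFDerivAt 𝓘(ℝ, EZ) 𝓘(ℝ, EP →L[ℝ] ℝ) m.F (quotientMap G EP P ⟨y, 0⟩)
      (mfderiv 𝓘(ℝ, EZ) 𝓘(ℝ, EP →L[ℝ] ℝ) m.F (zeroSection hp hρ (p y))) := by
    rw [← zeroSection_apply hp hρ]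
    exact hF
  have h1 : (show EZ →L[ℝ] (EP →L[ℝ] ℝ) from mfderiv 𝓘(ℝ, EZ) 𝓘(ℝ, EP →L[ℝ] ℝ) m.F
      (zeroSection hp hρ (p y))) ((show EB →L[ℝ] EZ from
        mfderiv 𝓘(ℝ, EB) 𝓘(ℝ, EZ) (zeroSection hp hρ) (p y)) u) = 0 := by
    have h2 := HasMFDerivAt.comp (p y) hF
      (((zeroSection hp hρ).contMDiff (p y)).mdifferentiableAt (by simp)).hasMFDerivAt
    have h3 : m.F ∘ zeroSection hp hρ =ᶠ[𝓝 (p y)] fun _ => 0 := by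
      filter_upwards [m.isOpen_U.mem_nhds hy] with b hb
      exact m.F_zeroSection hρ hb
    exact DFunLike.congr_fun (hasMFDerivAt_unique (h2.congr_of_eventuallyEq h3.symm)
      (hasMFDerivAt_const (0 : EP →L[ℝ] ℝ) (p y))) u
  have h2 : (show EZ →L[ℝ] (EP →L[ℝ] ℝ) from mfderiv 𝓘(ℝ, EZ) 𝓘(ℝ, EP →L[ℝ] ℝ) m.F
      (zeroSection hp hρ (p y))) (verticalDeriv G EZ y β) = m.F (quotientMap G EP P ⟨y, β⟩) := by
    obtain ⟨A, hA⟩ := m.F_fiber y hy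
    let C : (EP →L[ℝ] ℝ) →L[ℝ] (EP →L[ℝ] ℝ) := (ContinuousLinearMap.compL ℝ EP EP ℝ).flip A
    have h2 := HasMFDerivAt.comp (0 : EP →L[ℝ] ℝ) hF' (hasMFDerivAt_quotientMap_fiber hρ y)
    have h3 : m.F ∘ (fun β : EP →L[ℝ] ℝ => quotientMap G EP P ⟨y, β⟩) = C := funext hA
    rw [h3] at h2
    exact (DFunLike.congr_fun (hasMFDerivAt_unique h2 C.hasMFDerivAt) β).trans (hA β).symm
  rw [map_add, h1, h2, zero_add]

theorem F_normalQuotient {b₀ : B} (m : LocalModel EZ hp b₀)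
    (v : RestrictedTangent (zeroSection hp hρ)) (hv : v.proj ∈ m.U) :
    m.F (normalQuotient hp hρ v) =
      (show EZ →L[ℝ] (EP →L[ℝ] ℝ) from mfderiv 𝓘(ℝ, EZ) 𝓘(ℝ, EP →L[ℝ] ℝ) m.F
        (zeroSection hp hρ v.proj)) v.snd := by
  obtain ⟨b, v⟩ := v
  obtain ⟨y, rfl⟩ := hp.surjective b
  obtain ⟨u, β, huβ⟩ := (isSplitting_zeroSection hp hρ y).exists_eq v
  change EZ at v
  subst huβ
  rw [normalQuotient_splitting]
  exact (m.mfderiv_F_splitting hρ hv u β).symm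

theorem normalQuotient_eq {b₀ : B} (m : LocalModel EZ hp b₀)
    (v : RestrictedTangent (zeroSection hp hρ)) (hv : v.proj ∈ m.U) :
    normalQuotient hp hρ v = m.R (v.proj,
      (show EZ →L[ℝ] (EP →L[ℝ] ℝ) from mfderiv 𝓘(ℝ, EZ) 𝓘(ℝ, EP →L[ℝ] ℝ) m.F
        (zeroSection hp hρ v.proj)) v.snd) := by
  rw [← m.F_normalQuotient hρ v hv]
  have h1 := m.R_F (normalQuotient hp hρ v) (by rwa [quotientProj_normalQuotient])
  rw [quotientProj_normalQuotient] at h1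
  exact h1.symm

end LocalModel

theorem contMDiff_normalQuotient [T2Space B] :
    ContMDiff (𝓘(ℝ, EB).prod 𝓘(ℝ, EZ)) 𝓘(ℝ, EZ) ∞ (normalQuotient hp hρ) := by
  intro v
  obtain ⟨m⟩ := exists_localModel hp hρ v.proj
  obtain ⟨χ, hχ, hχ1, hχU⟩ := exists_cutoff (I := 𝓘(ℝ, EB)) m.isOpen_U m.mem_U
  have h1 := contMDiff_cutoff_smul m.isOpen_U hχ hχU (contMDiff_quotientProj hp hρ) m.smooth_F
  have h2 := contMDiff_mfderiv_restricted (zeroSection hp hρ) h1 v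
  have hproj : ContMDiffAt (𝓘(ℝ, EB).prod 𝓘(ℝ, EZ)) 𝓘(ℝ, EB) ∞
      (fun v : RestrictedTangent (zeroSection hp hρ) => v.proj) v :=
    Bundle.contMDiff_proj (n := ∞)
      (zeroSection hp hρ *ᵖ (TangentSpace 𝓘(ℝ, EZ) : CotangentQuotient G EP P → Type _)) v
  have h3 := (m.smooth_R.contMDiffAt ((m.isOpen_U.prod isOpen_univ).mem_nhds
    (show (v.proj, _) ∈ m.U ×ˢ Set.univ from ⟨m.mem_U, trivial⟩))).comp v (hproj.prodMk h2)
  refine h3.congr_of_eventuallyEq ?_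
  filter_upwards [hproj.continuousAt.preimage_mem_nhds
    (Filter.inter_mem (m.isOpen_U.mem_nhds m.mem_U) (eventually_eventually_nhds.2 hχ1))]
    with v' hv'
  rw [m.normalQuotient_eq hρ v' hv'.1]
  have h4 : (fun z => χ (quotientProj hp z) • m.F z) =ᶠ[𝓝 (zeroSection hp hρ v'.proj)] m.F := by
    have h5 : ContinuousAt (quotientProj hp) (zeroSection hp hρ v'.proj) :=
      (contMDiff_quotientProj hp hρ).continuous.continuousAt
    rw [ContinuousAt, quotientProj_zeroSection] at h5
    filter_upwards [h5.eventually hv'.2] with z hz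
    rw [hz, one_smul]
  exact congrArg (fun L : EZ →L[ℝ] (EP →L[ℝ] ℝ) => m.R (v'.proj, L v'.snd)) h4.mfderiv_eq.symm

theorem isSmoothSubmersion_normalQuotient [T2Space B] :
    IsSmoothSubmersion (I := 𝓘(ℝ, EB).prod 𝓘(ℝ, EZ)) (I' := 𝓘(ℝ, EZ)) (normalQuotient hp hρ) := by
  refine ⟨contMDiff_normalQuotient hp hρ, fun v => ?_⟩
  obtain ⟨m⟩ := exists_localModel hp hρ v.proj
  set z := normalQuotient hp hρ v with hz
  have hN := ((contMDiff_normalQuotient hp hρ v).mdifferentiableAt (by simp)).hasMFDerivAt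
  have hzU : quotientProj hp z ∈ m.U := by rw [hz, quotientProj_normalQuotient]; exact m.mem_U
  have hπ := ((contMDiff_quotientProj hp hρ z).mdifferentiableAt (by simp)).hasMFDerivAt
  have hF := ((m.contMDiffAt_F hρ hzU).mdifferentiableAt (by simp)).hasMFDerivAt
  let dN : EB × EZ →L[ℝ] EZ := mfderiv (𝓘(ℝ, EB).prod 𝓘(ℝ, EZ)) 𝓘(ℝ, EZ) (normalQuotient hp hρ) v
  let dπ : EZ →L[ℝ] EB := mfderiv 𝓘(ℝ, EZ) 𝓘(ℝ, EB) (quotientProj hp) z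
  let dF : EZ →L[ℝ] (EP →L[ℝ] ℝ) := mfderiv 𝓘(ℝ, EZ) 𝓘(ℝ, EP →L[ℝ] ℝ) m.F z
  have hinj : ∀ Y : EZ, dπ Y = 0 → dF Y = 0 → Y = 0 := by
    intro Y h1 h2
    have hR : HasMFDerivAt (𝓘(ℝ, EB).prod 𝓘(ℝ, EP →L[ℝ] ℝ)) 𝓘(ℝ, EZ) m.R
        (quotientProj hp z, m.F z) _ :=
      ((m.smooth_R.contMDiffAt ((m.isOpen_U.prod isOpen_univ).mem_nhds
        ⟨hzU, trivial⟩)).mdifferentiableAt (by simp)).hasMFDerivAt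
    have h3 := HasMFDerivAt.comp z hR (hπ.prodMk hF)
    have h4 : (m.R ∘ fun z => (quotientProj hp z, m.F z)) =ᶠ[𝓝 z] id := by
      filter_upwards [(m.isOpen_U.preimage (contMDiff_quotientProj hp hρ).continuous).mem_nhds hzU]
        with z' hz'
      exact m.R_F z' hz'
    have h5 := DFunLike.congr_fun
      (hasMFDerivAt_unique (h3.congr_of_eventuallyEq h4.symm) (hasMFDerivAt_id z)) Y
    let dR : EB × (EP →L[ℝ] ℝ) →L[ℝ] EZ := mfderiv (𝓘(ℝ, EB).prod 𝓘(ℝ, EP →L[ℝ] ℝ)) 𝓘(ℝ, EZ) m.R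
        (quotientProj hp z, m.F z)
    have h6 : dR (dπ Y, dF Y) = Y := h5
    rw [← h6, h1, h2]
    exact map_zero dR
  have hπN : ∀ ζ, dπ (dN ζ) = mfderiv (𝓘(ℝ, EB).prod 𝓘(ℝ, EZ)) 𝓘(ℝ, EB)
      (Bundle.TotalSpace.proj : RestrictedTangent (zeroSection hp hρ) → B) v ζ := by
    intro ζ
    have h1 := HasMFDerivAt.comp v hπ hN
    have h2 : quotientProj hp ∘ normalQuotient hp hρ = Bundle.TotalSpace.proj :=
      funext (quotientProj_normalQuotient hp hρ)
    rw [h2] at h1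
    exact DFunLike.congr_fun h1.mfderiv.symm ζ
  have hproj := surjective_mfderiv_bundle_proj (EX := EB) (F := EZ) v
  intro Y
  change EZ at Y
  obtain ⟨ζ, hζ⟩ := hproj (dπ Y)
  change EB × EZ at ζ
  have hY' : dπ (Y - dN ζ) = 0 := by
    have h1 : dπ (dN ζ) = dπ Y := (hπN ζ).trans hζ
    rw [map_sub, h1, sub_self]
  obtain ⟨v', hv'⟩ : ∃ v' : EZ, (show EZ →L[ℝ] (EP →L[ℝ] ℝ) from
      mfderiv 𝓘(ℝ, EZ) 𝓘(ℝ, EP →L[ℝ] ℝ) m.F (zeroSection hp hρ v.proj)) v' = dF (Y - dN ζ) := by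
    obtain ⟨y, hy⟩ := hp.surjective v.proj
    have hyU : p y ∈ m.U := by rw [hy]; exact m.mem_U
    obtain ⟨β, hβ⟩ := hp.exists_fiber_point y (m.R (p y, dF (Y - dN ζ))) (m.proj_R _ hyU _)
    refine ⟨verticalDeriv G EZ y β, ?_⟩
    have h1 := m.mfderiv_F_splitting hρ hyU 0 β
    rw [hβ, m.F_R _ hyU, map_zero, zero_add, hy] at h1
    exact h1
  let v₂ : EZ := v.snd
  let c : ℝ → RestrictedTangent (zeroSection hp hρ) := fun t => ⟨v.proj, v₂ + t • v'⟩
  have hc0 : c 0 = v := by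
    have h1 : v₂ + (0 : ℝ) • v' = v₂ := by simp
    exact congrArg (fun u : EZ => (⟨v.proj, u⟩ : RestrictedTangent (zeroSection hp hρ))) h1
  have hcs : ContMDiff 𝓘(ℝ, ℝ) (𝓘(ℝ, EB).prod 𝓘(ℝ, EZ)) ∞ c := contMDiff_fiber_line (EX := EB) (F := EZ)
    (E := (zeroSection hp hρ *ᵖ (TangentSpace 𝓘(ℝ, EZ) : CotangentQuotient G EP P → Type _)))
    v.proj v.snd v'
  have hc := ((hcs 0).mdifferentiableAt (by simp)).hasMFDerivAt
  let dc : ℝ →L[ℝ] EB × EZ := mfderiv 𝓘(ℝ, ℝ) (𝓘(ℝ, EB).prod 𝓘(ℝ, EZ)) c 0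
  have hN' : HasMFDerivAt (𝓘(ℝ, EB).prod 𝓘(ℝ, EZ)) 𝓘(ℝ, EZ) (normalQuotient hp hρ) (c 0) dN := by
    rw [hc0]; exact hN
  have hNc := HasMFDerivAt.comp (0 : ℝ) hN' hc
  have hNc0 : normalQuotient hp hρ (c 0) = z := by rw [hc0]
  have hπ' : HasMFDerivAt 𝓘(ℝ, EZ) 𝓘(ℝ, EB) (quotientProj hp)
      ((normalQuotient hp hρ ∘ c) 0) dπ := by
    rw [Function.comp_apply, hNc0]; exact hπ
  have hF' : HasMFDerivAt 𝓘(ℝ, EZ) 𝓘(ℝ, EP →L[ℝ] ℝ) m.F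
      ((normalQuotient hp hρ ∘ c) 0) dF := by
    rw [Function.comp_apply, hNc0]; exact hF
  have h1 : dπ (dN (dc 1)) = 0 := by
    have h2 := HasMFDerivAt.comp (0 : ℝ) hπ' hNc
    have h3 : quotientProj hp ∘ normalQuotient hp hρ ∘ c = fun _ => v.proj :=
      funext fun t => quotientProj_normalQuotient hp hρ (c t)
    rw [h3] at h2
    exact DFunLike.congr_fun (hasMFDerivAt_unique h2 (hasMFDerivAt_const v.proj 0)) 1
  have h2 : dF (dN (dc 1)) = dF (Y - dN ζ) := by
    let L : EZ →L[ℝ] (EP →L[ℝ] ℝ) :=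
      mfderiv 𝓘(ℝ, EZ) 𝓘(ℝ, EP →L[ℝ] ℝ) m.F (zeroSection hp hρ v.proj)
    have h2 := HasMFDerivAt.comp (0 : ℝ) hF' hNc
    have h3 : m.F ∘ normalQuotient hp hρ ∘ c = fun t : ℝ => L v₂ + t • L v' := by
      funext t
      refine (m.F_normalQuotient hρ (c t) m.mem_U).trans ?_
      exact (map_add L v₂ (t • v')).trans (congrArg _ (map_smul L t v'))
    rw [h3] at h2
    have h4 : HasDerivAt (fun t : ℝ => L v₂ + t • L v') (L v') 0 := by
      simpa using ((hasDerivAt_id (0 : ℝ)).smul_const (L v')).const_add (L v₂)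
    have h5 := DFunLike.congr_fun (hasMFDerivAt_unique h2 h4.hasFDerivAt.hasMFDerivAt) 1
    refine Eq.trans h5 (Eq.trans ?_ hv')
    exact one_smul ℝ (L v')
  refine ⟨ζ + dc 1, ?_⟩
  have h3 := hinj (dN (dc 1) - (Y - dN ζ)) (by rw [map_sub, h1, hY', sub_zero])
    (by rw [map_sub, h2, sub_self])
  refine (map_add dN ζ (dc 1)).trans ?_
  rw [sub_eq_zero.1 h3]
  exact add_sub_cancel _ _

end Linearization

section Forms

variable {E : Type*} [NormedAddCommGroup E] [NormedSpace ℝ E] [FiniteDimensional ℝ E]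
  {M : Type*} [TopologicalSpace M] [ChartedSpace E M] [IsManifold 𝓘(ℝ, E) ∞ M]

theorem formInChart_comp_mfderiv (α : ∀ x : M, Cotangent 𝓘(ℝ, E) x) {x₀ x : M}
    (hx : x ∈ (extChartAt 𝓘(ℝ, E) x₀).source) :
    formInChart α x₀ (extChartAt 𝓘(ℝ, E) x₀ x) ∘L
      (show E →L[ℝ] E from mfderiv 𝓘(ℝ, E) 𝓘(ℝ, E) (extChartAt 𝓘(ℝ, E) x₀) x) = α x := by
  ext v
  have h1 := mfderiv_symm_extChartAt_apply hx v
  have h2 : ∀ x', x' = x → ∀ v, (α x' : E →L[ℝ] ℝ) v = (α x : E →L[ℝ] ℝ) v := by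
    rintro _ rfl v; rfl
  exact (h2 _ ((extChartAt 𝓘(ℝ, E) x₀).left_inv hx) _).trans (congrArg (α x : E →L[ℝ] ℝ) h1)

theorem formInChart_self (α : ∀ x : M, Cotangent 𝓘(ℝ, E) x) (x₀ : M) :
    formInChart α x₀ (extChartAt 𝓘(ℝ, E) x₀ x₀) = α x₀ := by
  have h1 := formInChart_comp_mfderiv α (mem_extChartAt_source (I := 𝓘(ℝ, E)) x₀)
  have h2 := mfderiv_extChartAt_self (I := 𝓘(ℝ, E)) (x := x₀)
  refine Eq.trans ?_ h1
  exact ((congrArg (ContinuousLinearMap.comp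
    (formInChart α x₀ (extChartAt 𝓘(ℝ, E) x₀ x₀))) h2).trans
    (ContinuousLinearMap.comp_id (formInChart α x₀ (extChartAt 𝓘(ℝ, E) x₀ x₀)))).symm

theorem IsSmoothForm.contMDiffAt_formInChart {α : ∀ x : M, Cotangent 𝓘(ℝ, E) x}
    (hα : IsSmoothForm α) (x₀ : M) :
    ContMDiffAt 𝓘(ℝ, E) 𝓘(ℝ, E →L[ℝ] ℝ) ∞
      (fun x => formInChart α x₀ (extChartAt 𝓘(ℝ, E) x₀ x)) x₀ := by
  let a : CotangentBundle E M := ⟨x₀, α x₀⟩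
  have h1 : ContMDiffAt 𝓘(ℝ, E) 𝓘(ℝ, E →L[ℝ] ℝ) ∞
      (fun x => (extChartAt (cotangentModel E) a ⟨x, α x⟩).2) x₀ :=
    (contDiff_snd.contMDiff _).comp x₀ ((contMDiffAt_extChartAt (x := a)).comp x₀ (hα x₀))
  refine h1.congr_of_eventuallyEq ?_
  filter_upwards [extChartAt_source_mem_nhds (I := 𝓘(ℝ, E)) x₀] with x hx
  refine Eq.trans ?_ (congrArg Prod.snd (extChartAt_cotangent_apply (a := a)
    (b := (⟨x, α x⟩ : CotangentBundle E M)) hx)).symm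
  have h2 : ∀ x', x' = x → (α x' : E →L[ℝ] ℝ) = α x := by rintro _ rfl; rfl
  exact congrArg (fun γ : E →L[ℝ] ℝ => γ ∘L (show E →L[ℝ] E from mfderiv 𝓘(ℝ, E) 𝓘(ℝ, E)
    (extChartAt 𝓘(ℝ, E) x₀).symm (extChartAt 𝓘(ℝ, E) x₀ x)))
    (h2 _ ((extChartAt 𝓘(ℝ, E) x₀).left_inv hx))

theorem IsSmoothForm.contDiffAt_formInChart {α : ∀ x : M, Cotangent 𝓘(ℝ, E) x}
    (hα : IsSmoothForm α) (x₀ : M) :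
    ContDiffAt ℝ ∞ (formInChart α x₀) (extChartAt 𝓘(ℝ, E) x₀ x₀) := by
  have h1 := contDiffAt_comp_extChartAt_symm (I := 𝓘(ℝ, E))
    (mem_extChartAt_target (I := 𝓘(ℝ, E)) x₀)
    (f := fun x => formInChart α x₀ (extChartAt 𝓘(ℝ, E) x₀ x)) (by
      rw [extChartAt_to_inv]
      exact hα.contMDiffAt_formInChart x₀)
  refine h1.congr_of_eventuallyEq ?_
  filter_upwards [extChartAt_target_mem_nhds (I := 𝓘(ℝ, E)) x₀] with u hu
  exact congrArg (formInChart α x₀) ((extChartAt 𝓘(ℝ, E) x₀).right_inv hu).symm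

theorem formInChart_diff {f : M → ℝ} (hf : ContMDiff 𝓘(ℝ, E) 𝓘(ℝ, ℝ) ∞ f) {x₀ : M} {u : E}
    (hu : u ∈ (extChartAt 𝓘(ℝ, E) x₀).target) :
    formInChart (diff 𝓘(ℝ, E) f) x₀ u = fderiv ℝ (f ∘ (extChartAt 𝓘(ℝ, E) x₀).symm) u := by
  have h1 := HasMFDerivAt.comp u ((hf ((extChartAt 𝓘(ℝ, E) x₀).symm u)).mdifferentiableAt
    (by simp)).hasMFDerivAt (mdifferentiableAt_extChartAt_symm_self hu).hasMFDerivAt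
  have h2 := h1.mfderiv
  rw [mfderiv_eq_fderiv] at h2
  exact h2.symm

theorem isSmoothForm_diff {f : M → ℝ} (hf : ContMDiff 𝓘(ℝ, E) 𝓘(ℝ, ℝ) ∞ f) :
    IsSmoothForm (diff 𝓘(ℝ, E) f) := by
  intro x₀
  let a : CotangentBundle E M := ⟨x₀, 0⟩
  let c := extChartAt 𝓘(ℝ, E) x₀
  have h1 : ContDiffAt ℝ ∞ (fderiv ℝ (f ∘ c.symm)) (c x₀) :=
    (contDiffAt_comp_extChartAt_symm (mem_extChartAt_target (I := 𝓘(ℝ, E)) x₀)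
      (hf _)).fderiv_right (by simp)
  have h2 : ContMDiffAt 𝓘(ℝ, E) 𝓘(ℝ, E →L[ℝ] ℝ) ∞ (fun x => fderiv ℝ (f ∘ c.symm) (c x)) x₀ :=
    h1.contMDiffAt.comp x₀ (contMDiffAt_extChartAt (x := x₀))
  have h3 : ContMDiffAt 𝓘(ℝ, E × (E →L[ℝ] ℝ)) (cotangentModel E) ∞
      (extChartAt (cotangentModel E) a).symm (c x₀, fderiv ℝ (f ∘ c.symm) (c x₀)) :=
    contMDiffAt_extChartAt_symm_self
      ((extChartAt_cotangent_target a _).2 (mem_extChartAt_target (I := 𝓘(ℝ, E)) x₀))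
  have h4 := ContMDiffAt.comp (I' := 𝓘(ℝ, E × (E →L[ℝ] ℝ))) x₀ h3
    ((contMDiffAt_extChartAt (x := x₀)).prodMk_space h2)
  refine h4.congr_of_eventuallyEq ?_
  filter_upwards [extChartAt_source_mem_nhds (I := 𝓘(ℝ, E)) x₀] with x hx
  refine Eq.trans ?_ (extChartAt_cotangent_symm_apply (a := a)
    (z := (c x, fderiv ℝ (f ∘ c.symm) (c x))) (c.map_source hx)).symm
  refine cotangent_ext (EP := E) (c.left_inv hx).symm ?_
  have h5 : ∀ x', x' = x → (diff 𝓘(ℝ, E) f x : E →L[ℝ] ℝ) = fderiv ℝ (f ∘ c.symm) (c x) ∘L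
      (show E →L[ℝ] E from mfderiv 𝓘(ℝ, E) 𝓘(ℝ, E) c x') := by
    rintro _ rfl
    exact diff_eq_fderiv_comp hx ((hf _).mdifferentiableAt (by simp))
  exact h5 _ (c.left_inv hx)

theorem extDerivForm_diff {f : M → ℝ} (hf : ContMDiff 𝓘(ℝ, E) 𝓘(ℝ, ℝ) ∞ f) (x : M)
    (u v : TangentSpace 𝓘(ℝ, E) x) : extDerivForm (diff 𝓘(ℝ, E) f) x u v = 0 := by
  have h1 : formInChart (diff 𝓘(ℝ, E) f) x =ᶠ[𝓝 (extChartAt 𝓘(ℝ, E) x x)]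
      fderiv ℝ (f ∘ (extChartAt 𝓘(ℝ, E) x).symm) := by
    filter_upwards [extChartAt_target_mem_nhds (I := 𝓘(ℝ, E)) x] with u hu
    exact formInChart_diff hf hu
  have h2 := (contDiffAt_comp_extChartAt_symm (mem_extChartAt_target (I := 𝓘(ℝ, E)) x)
    (hf _)).isSymmSndFDerivAt (by simpa using ENat.LEInfty.out)
  have h3 := h2.eq u v
  change (fderiv ℝ (formInChart (diff 𝓘(ℝ, E) f) x) (extChartAt 𝓘(ℝ, E) x x) : E →L[ℝ] E →L[ℝ] ℝ)
    u v - (fderiv ℝ (formInChart (diff 𝓘(ℝ, E) f) x) (extChartAt 𝓘(ℝ, E) x x) :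
    E →L[ℝ] E →L[ℝ] ℝ) v u = 0
  rw [h1.fderiv_eq]
  exact sub_eq_zero.2 h3

theorem formBracket_diff (w : BilinField 𝓘(ℝ, E) M) {f g : M → ℝ}
    (hf : ContMDiff 𝓘(ℝ, E) 𝓘(ℝ, ℝ) ∞ f) (hg : ContMDiff 𝓘(ℝ, E) 𝓘(ℝ, ℝ) ∞ g) (x : M)
    (v : TangentSpace 𝓘(ℝ, E) x) :
    formBracket w (diff 𝓘(ℝ, E) f) (diff 𝓘(ℝ, E) g) x v = diff 𝓘(ℝ, E) (bracket w f g) x v := by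
  rw [formBracket, extDerivForm_diff hf, extDerivForm_diff hg, sub_zero, zero_add]
  rfl

variable [T2Space M]

/-- The coordinate representation of a Poisson tensor is differentiable. -/
theorem PoissonStructure.exists_tensor_in_chart (w : PoissonStructure 𝓘(ℝ, E) M) (x₀ : M) :
    ∃ (n : ℕ) (T : Fin n → Fin n → E → ℝ) (l : Fin n → (E →L[ℝ] ℝ) →L[ℝ] ℝ),
      (∀ k j, DifferentiableAt ℝ (T k j) (extChartAt 𝓘(ℝ, E) x₀ x₀)) ∧
      ∀ᶠ x in 𝓝 x₀, ∀ a b : E →L[ℝ] ℝ,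
        ∑ k, ∑ j, T k j (extChartAt 𝓘(ℝ, E) x₀ x) * (l k a * l j b) =
        w.tensor x
          (a ∘L (show E →L[ℝ] E from mfderiv 𝓘(ℝ, E) 𝓘(ℝ, E) (extChartAt 𝓘(ℝ, E) x₀) x))
          (b ∘L (show E →L[ℝ] E from mfderiv 𝓘(ℝ, E) 𝓘(ℝ, E) (extChartAt 𝓘(ℝ, E) x₀) x)) := by
  let c := extChartAt 𝓘(ℝ, E) x₀
  have hc : ContMDiffOn 𝓘(ℝ, E) 𝓘(ℝ, E) ∞ c (chartAt E x₀).source :=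
    contMDiffOn_extChartAt (I := 𝓘(ℝ, E)) (x := x₀)
  obtain ⟨C, hC, hCc⟩ := exists_contMDiff_eventuallyEq (I := 𝓘(ℝ, E)) (chartAt E x₀).open_source
    (mem_chart_source E x₀) hc
  let e := Module.finBasis ℝ (E →L[ℝ] ℝ)
  let f : Fin (Module.finrank ℝ (E →L[ℝ] ℝ)) → M → ℝ := fun k x => e k (C x)
  have hf : ∀ k, ContMDiff 𝓘(ℝ, E) 𝓘(ℝ, ℝ) ∞ (f k) := fun k => (e k).contMDiff.comp hC
  refine ⟨_, fun k j u => bracket w.tensor (f k) (f j) (c.symm u),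
    fun k => LinearMap.toContinuousLinearMap (e.coord k), fun k j => ?_, ?_⟩
  · exact (contDiffAt_comp_extChartAt_symm (mem_extChartAt_target (I := 𝓘(ℝ, E)) x₀)
      (w.smooth _ _ (hf k) (hf j) _)).differentiableAt (by simp)
  · filter_upwards [hCc.eventuallyEq_nhds, extChartAt_source_mem_nhds (I := 𝓘(ℝ, E)) x₀]
      with x hx hxs a b
    let dc : E →L[ℝ] E := mfderiv 𝓘(ℝ, E) 𝓘(ℝ, E) c x
    let wx : (E →L[ℝ] ℝ) →ₗ[ℝ] (E →L[ℝ] ℝ) →ₗ[ℝ] ℝ := w.tensor x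
    have hdf : ∀ k, diff 𝓘(ℝ, E) (f k) x = e k ∘L dc := by
      intro k
      have h1 : HasMFDerivAt 𝓘(ℝ, E) 𝓘(ℝ, E) C x dc := by
        have h2 := ((hC x).mdifferentiableAt (by simp)).hasMFDerivAt
        rwa [hx.mfderiv_eq] at h2
      exact (HasMFDerivAt.comp x (e k).hasMFDerivAt h1).mfderiv
    have hsum : ∀ a : E →L[ℝ] ℝ, a ∘L dc = ∑ k, e.coord k a • (e k ∘L dc) := by
      intro a
      ext v
      have h1 := congrArg (fun γ : E →L[ℝ] ℝ => γ (dc v)) (e.sum_repr a)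
      simp only [sum_apply, smul_apply] at h1
      simp only [sum_apply, smul_apply]
      exact h1.symm
    refine Eq.trans ?_ (congrArg₂ (fun s t => wx s t) (hsum a) (hsum b)).symm
    rw [Finset.sum_comm]
    simp only [map_sum, map_smul, LinearMap.sum_apply, LinearMap.smul_apply]
    refine Finset.sum_congr rfl fun k _ => ?_
    refine (Finset.sum_congr rfl fun j _ => ?_).trans (Finset.smul_sum ..).symm
    have h3 : bracket w.tensor (f j) (f k) (c.symm (c x)) = wx (e j ∘L dc) (e k ∘L dc) := by
      rw [c.left_inv hxs, bracket, hdf, hdf]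
      rfl
    rw [h3]
    simp only [LinearMap.coe_toContinuousLinearMap', smul_eq_mul]
    ring

theorem exists_hasFDerivAt_tensor {V : Type*} [NormedAddCommGroup V] [NormedSpace ℝ V] {n : ℕ}
    {T : Fin n → Fin n → E → ℝ} (l : Fin n → V →L[ℝ] ℝ) {u : E}
    (hT : ∀ k j, DifferentiableAt ℝ (T k j) u) :
    ∃ K : E → V → V → ℝ, ∀ {A B : E → V} {DA DB : E →L[ℝ] V},
      HasFDerivAt A DA u → HasFDerivAt B DB u →
      ∃ D : E →L[ℝ] ℝ,
        HasFDerivAt (fun u => ∑ k, ∑ j, T k j u * (l k (A u) * l j (B u))) D u ∧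
        ∀ v, D v = ∑ k, ∑ j, T k j u * (l k (A u) * l j (DB v))
          + (∑ k, ∑ j, T k j u * (l k (DA v) * l j (B u)) + K v (A u) (B u)) := by
  refine ⟨fun v a b => ∑ k, ∑ j, fderiv ℝ (T k j) u v * (l k a * l j b),
    fun {A B DA DB} hA hB => ⟨_, HasFDerivAt.fun_sum fun k _ => HasFDerivAt.fun_sum fun j _ =>
      (hT k j).hasFDerivAt.mul (((l k).hasFDerivAt.comp u hA).mul ((l j).hasFDerivAt.comp u hB)),
      fun v => ?_⟩⟩
  simp only [sum_apply, ← Finset.sum_add_distrib]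
  refine Finset.sum_congr rfl fun k _ => Finset.sum_congr rfl fun j _ => ?_
  simp only [add_apply, smul_apply, smul_eq_mul, Function.comp_apply,
    ContinuousLinearMap.comp_apply]
  ring

theorem formBracket_eq (w : PoissonStructure 𝓘(ℝ, E) M) (x₀ : M) :
    ∃ K : E → (E →L[ℝ] ℝ) → (E →L[ℝ] ℝ) → ℝ,
      ∀ α β : (∀ x : M, Cotangent 𝓘(ℝ, E) x), IsSmoothForm α → IsSmoothForm β → ∀ v : E,
      formBracket w.tensor α β x₀ v =
        (fderiv ℝ (formInChart α x₀) (extChartAt 𝓘(ℝ, E) x₀ x₀) : E →L[ℝ] E →L[ℝ] ℝ)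
          (sharp w.tensor x₀ (β x₀)) v
        - (fderiv ℝ (formInChart β x₀) (extChartAt 𝓘(ℝ, E) x₀ x₀) : E →L[ℝ] E →L[ℝ] ℝ)
          (sharp w.tensor x₀ (α x₀)) v + K v (α x₀) (β x₀) := by
  obtain ⟨n, T, l, hT, hTw⟩ := w.exists_tensor_in_chart x₀
  obtain ⟨K, hK⟩ := exists_hasFDerivAt_tensor l hT
  let c := extChartAt 𝓘(ℝ, E) x₀
  refine ⟨K, fun α β hα hβ v => ?_⟩
  set A := formInChart α x₀ with hA
  set B := formInChart β x₀ with hB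
  let DA : E →L[ℝ] E →L[ℝ] ℝ := fderiv ℝ A (c x₀)
  let DB : E →L[ℝ] E →L[ℝ] ℝ := fderiv ℝ B (c x₀)
  have hAd : HasFDerivAt A DA (c x₀) :=
    ((hα.contDiffAt_formInChart x₀).differentiableAt (by simp)).hasFDerivAt
  have hBd : HasFDerivAt B DB (c x₀) :=
    ((hβ.contDiffAt_formInChart x₀).differentiableAt (by simp)).hasFDerivAt
  have hA0 : A (c x₀) = α x₀ := formInChart_self α x₀
  have hB0 : B (c x₀) = β x₀ := formInChart_self β x₀
  obtain ⟨D, hd, hD⟩ := hK hAd hBd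
  have hcd : HasMFDerivAt 𝓘(ℝ, E) 𝓘(ℝ, E) c x₀ (ContinuousLinearMap.id ℝ E) := by
    have h1 := (mdifferentiableAt_extChartAt (I := 𝓘(ℝ, E)) (mem_chart_source E x₀)).hasMFDerivAt
    have h2 := mfderiv_extChartAt_self (I := 𝓘(ℝ, E)) (x := x₀)
    rw [h2] at h1
    exact h1
  have hd' := HasMFDerivAt.comp x₀ hd.hasMFDerivAt hcd
  have he : (fun x => w.tensor x (α x) (β x)) =ᶠ[𝓝 x₀]
      (fun u => ∑ k, ∑ j, T k j u * (l k (A u) * l j (B u))) ∘ c := by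
    filter_upwards [hTw, extChartAt_source_mem_nhds (I := 𝓘(ℝ, E)) x₀] with x hx hxs
    let wx : (E →L[ℝ] ℝ) →ₗ[ℝ] (E →L[ℝ] ℝ) →ₗ[ℝ] ℝ := w.tensor x
    exact ((hx (A (c x)) (B (c x))).trans (congrArg₂ (fun s t => wx s t)
      (formInChart_comp_mfderiv α hxs) (formInChart_comp_mfderiv β hxs))).symm
  let w₀ : (E →L[ℝ] ℝ) →ₗ[ℝ] (E →L[ℝ] ℝ) →ₗ[ℝ] ℝ := w.tensor x₀
  have hW0 : ∀ a b : E →L[ℝ] ℝ, ∑ k, ∑ j, T k j (c x₀) * (l k a * l j b) = w₀ a b := by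
    intro a b
    have h1 := hTw.self_of_nhds a b
    have h2 := mfderiv_extChartAt_self (I := 𝓘(ℝ, E)) (x := x₀)
    rw [h2] at h1
    exact h1
  have h5 := DFunLike.congr_fun (hd'.congr_of_eventuallyEq he).mfderiv v
  have h6 : (diff 𝓘(ℝ, E) (fun x => w.tensor x (α x) (β x)) x₀ : E →L[ℝ] ℝ) v =
      w₀ (A (c x₀)) (DB v) + (w₀ (DA v) (B (c x₀)) + K v (A (c x₀)) (B (c x₀))) := by
    rw [← hW0, ← hW0, ← hD]
    exact h5
  let Xα : E := sharp w.tensor x₀ (α x₀)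
  let Xβ : E := sharp w.tensor x₀ (β x₀)
  have h7 : w₀ (DA v) (B (c x₀)) = DA v Xβ := by
    rw [hB0]
    exact (apply_sharp w.tensor x₀ (DA v) (β x₀)).symm
  have h8 : w₀ (A (c x₀)) (DB v) = - DB v Xα := by
    rw [hA0]
    exact (w.skew x₀ (α x₀) (DB v)).trans
      (congrArg Neg.neg (apply_sharp w.tensor x₀ (DB v) (α x₀)).symm)
  rw [h7, h8] at h6
  change DA Xβ v - DA v Xβ - (DB Xα v - DB v Xα) +
    (diff 𝓘(ℝ, E) (fun x => w.tensor x (α x) (β x)) x₀ : E →L[ℝ] ℝ) v =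
    DA Xβ v - DB Xα v + K v (α x₀) (β x₀)
  rw [h6, hA0, hB0]
  ring

section Submanifold

variable {E' : Type*} [NormedAddCommGroup E'] [NormedSpace ℝ E']
  {X : Type*} [TopologicalSpace X] [ChartedSpace E' X] [IsManifold 𝓘(ℝ, E') ∞ X]

theorem fderiv_formInChart_congr {i : X → M} {x : X} (hi : MDifferentiableAt 𝓘(ℝ, E') 𝓘(ℝ, E) i x)
    {α α' : ∀ x : M, Cotangent 𝓘(ℝ, E) x} (hα : IsSmoothForm α) (hα' : IsSmoothForm α')
    (h : ∀ x, α (i x) = α' (i x)) (u : E') :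
    fderiv ℝ (formInChart α (i x)) (extChartAt 𝓘(ℝ, E) (i x) (i x))
      ((show E' →L[ℝ] E from mfderiv 𝓘(ℝ, E') 𝓘(ℝ, E) i x) u) =
    fderiv ℝ (formInChart α' (i x)) (extChartAt 𝓘(ℝ, E) (i x) (i x))
      ((show E' →L[ℝ] E from mfderiv 𝓘(ℝ, E') 𝓘(ℝ, E) i x) u) := by
  have hcd : HasMFDerivAt 𝓘(ℝ, E) 𝓘(ℝ, E) (extChartAt 𝓘(ℝ, E) (i x)) (i x)
      (ContinuousLinearMap.id ℝ E) := by
    have h1 := (mdifferentiableAt_extChartAt (I := 𝓘(ℝ, E))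
      (mem_chart_source E (i x))).hasMFDerivAt
    have h2 := mfderiv_extChartAt_self (I := 𝓘(ℝ, E)) (x := i x)
    rw [h2] at h1
    exact h1
  have key : ∀ {α : ∀ x : M, Cotangent 𝓘(ℝ, E) x}, IsSmoothForm α →
      HasMFDerivAt 𝓘(ℝ, E') 𝓘(ℝ, E →L[ℝ] ℝ)
        (formInChart α (i x) ∘ extChartAt 𝓘(ℝ, E) (i x) ∘ i) x
        (fderiv ℝ (formInChart α (i x)) (extChartAt 𝓘(ℝ, E) (i x) (i x)) ∘L
          (ContinuousLinearMap.id ℝ E ∘L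
            (show E' →L[ℝ] E from mfderiv 𝓘(ℝ, E') 𝓘(ℝ, E) i x))) := fun hα =>
    HasMFDerivAt.comp x ((hα.contDiffAt_formInChart (i x)).differentiableAt
      (by simp)).hasFDerivAt.hasMFDerivAt (HasMFDerivAt.comp x hcd hi.hasMFDerivAt)
  have he : formInChart α (i x) ∘ extChartAt 𝓘(ℝ, E) (i x) ∘ i =ᶠ[𝓝 x]
      formInChart α' (i x) ∘ extChartAt 𝓘(ℝ, E) (i x) ∘ i := by
    filter_upwards [hi.continuousAt.preimage_mem_nhds
      (extChartAt_source_mem_nhds (I := 𝓘(ℝ, E)) (i x))] with x' hx'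
    have h1 : (extChartAt 𝓘(ℝ, E) (i x)).symm (extChartAt 𝓘(ℝ, E) (i x) (i x')) = i x' :=
      (extChartAt 𝓘(ℝ, E) (i x)).left_inv hx'
    have h2 : ∀ z, z = i x' → (α z : E →L[ℝ] ℝ) = α' z := by
      rintro _ rfl
      exact h x'
    exact congrArg (fun γ : E →L[ℝ] ℝ => γ ∘L (show E →L[ℝ] E from mfderiv 𝓘(ℝ, E) 𝓘(ℝ, E)
      (extChartAt 𝓘(ℝ, E) (i x)).symm (extChartAt 𝓘(ℝ, E) (i x) (i x')))) (h2 _ h1)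
  exact DFunLike.congr_fun
    (hasMFDerivAt_unique (key hα) ((key hα').congr_of_eventuallyEq he)) u

/-- Along a submanifold `X`, the bracket of two forms with Hamiltonian vectors tangent to `X`
depends only on the restrictions of the forms to `X`. -/
theorem formBracket_congr (w : PoissonStructure 𝓘(ℝ, E) M) {i : X → M} {x : X}
    (hi : MDifferentiableAt 𝓘(ℝ, E') 𝓘(ℝ, E) i x)
    {α α' β β' : ∀ x : M, Cotangent 𝓘(ℝ, E) x} (hα : IsSmoothForm α) (hα' : IsSmoothForm α')
    (hβ : IsSmoothForm β) (hβ' : IsSmoothForm β')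
    (hαα : ∀ x, α (i x) = α' (i x)) (hββ : ∀ x, β (i x) = β' (i x))
    (hαr : sharp w.tensor (i x) (α (i x)) ∈ Set.range (mfderiv 𝓘(ℝ, E') 𝓘(ℝ, E) i x))
    (hβr : sharp w.tensor (i x) (β (i x)) ∈ Set.range (mfderiv 𝓘(ℝ, E') 𝓘(ℝ, E) i x))
    (v : TangentSpace 𝓘(ℝ, E) (i x)) :
    formBracket w.tensor α β (i x) v = formBracket w.tensor α' β' (i x) v := by
  obtain ⟨K, hK⟩ := formBracket_eq w (i x)
  obtain ⟨u, hu⟩ := hαr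
  obtain ⟨u', hu'⟩ := hβr
  rw [hK α β hα hβ v, hK α' β' hα' hβ' v, ← hαα, ← hββ, ← hu, ← hu']
  have h1 := DFunLike.congr_fun (fderiv_formInChart_congr hi hα hα' hαα u') v
  have h2 := DFunLike.congr_fun (fderiv_formInChart_congr hi hβ hβ' hββ u) v
  exact congrArg₂ (fun s t : ℝ => s - t + K v (α (i x)) (β (i x))) h1 h2

end Submanifold

end Forms

section Pairing

variable {EX : Type*} [NormedAddCommGroup EX] [NormedSpace ℝ EX]
  {X : Type*} [TopologicalSpace X] [ChartedSpace EX X] [IsManifold 𝓘(ℝ, EX) ∞ X]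
  {EZ : Type*} [NormedAddCommGroup EZ] [NormedSpace ℝ EZ] [FiniteDimensional ℝ EZ]
  {Z : Type*} [TopologicalSpace Z] [ChartedSpace EZ Z] [IsManifold 𝓘(ℝ, EZ) ∞ Z] [T2Space Z]

theorem IsSmoothForm.contMDiff_pairing (i : C^∞⟮𝓘(ℝ, EX), X; 𝓘(ℝ, EZ), Z⟯)
    {α : ∀ z : Z, Cotangent 𝓘(ℝ, EZ) z} (hα : IsSmoothForm α) :
    ContMDiff (𝓘(ℝ, EX).prod 𝓘(ℝ, EZ)) 𝓘(ℝ, ℝ) ∞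
      (fun v : RestrictedTangent i => (show EZ →L[ℝ] ℝ from α (i v.proj)) v.snd) := by
  intro v
  set x₀ := i v.proj with hx₀
  obtain ⟨C, hC, hCc⟩ := exists_contMDiff_eventuallyEq (I := 𝓘(ℝ, EZ)) (chartAt EZ x₀).open_source
    (mem_chart_source EZ x₀) (contMDiffOn_extChartAt (I := 𝓘(ℝ, EZ)) (x := x₀))
  have hproj : ContMDiffAt (𝓘(ℝ, EX).prod 𝓘(ℝ, EZ)) 𝓘(ℝ, EZ) ∞
      (fun v : RestrictedTangent i => i v.proj) v :=
    i.contMDiff.contMDiffAt.comp v (Bundle.contMDiff_proj (n := ∞)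
      (i *ᵖ (TangentSpace 𝓘(ℝ, EZ) : Z → Type _)) v)
  have h1 := (hα.contMDiffAt_formInChart x₀).comp v hproj
  have h2 := h1.clm_apply (contMDiff_mfderiv_restricted i hC v)
  refine h2.congr_of_eventuallyEq ?_
  filter_upwards [hproj.continuousAt.eventually hCc.eventuallyEq_nhds,
    hproj.continuousAt.preimage_mem_nhds (extChartAt_source_mem_nhds (I := 𝓘(ℝ, EZ)) x₀)]
    with v' hv' hv''
  have h3 := DFunLike.congr_fun (formInChart_comp_mfderiv α hv'') v'.snd
  refine h3.symm.trans ?_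
  exact congrArg (fun L : EZ →L[ℝ] EZ => formInChart α x₀ (extChartAt 𝓘(ℝ, EZ) x₀ (i v'.proj))
    (L v'.snd)) hv'.mfderiv_eq.symm

theorem fiberLinear_normalProj {i : C^∞⟮𝓘(ℝ, EX), X; 𝓘(ℝ, EZ), Z⟯}
    {α : ∀ z : Z, Cotangent 𝓘(ℝ, EZ) z} (hα : Annihilates i α) (v : RestrictedTangent i) :
    fiberLinear i α hα (normalProj i v) = (show EZ →L[ℝ] ℝ from α (i v.proj)) v.snd := rfl

end Pairing

section LinearFunctions

variable {EG : Type*} [NormedAddCommGroup EG] [NormedSpace ℝ EG]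
  {G : Type*} [Group G] [TopologicalSpace G] [ChartedSpace EG G] [LieGroup 𝓘(ℝ, EG) ∞ G]
  {EP : Type*} [NormedAddCommGroup EP] [NormedSpace ℝ EP] [FiniteDimensional ℝ EP]
  {P : Type*} [TopologicalSpace P] [ChartedSpace EP P] [IsManifold 𝓘(ℝ, EP) ∞ P]
  [MulAction Gᵐᵒᵖ P]
  {EB : Type*} [NormedAddCommGroup EB] [NormedSpace ℝ EB] [FiniteDimensional ℝ EB]
  {B : Type*} [TopologicalSpace B] [ChartedSpace EB B] [IsManifold 𝓘(ℝ, EB) ∞ B] [T2Space B]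
  {p : P → B}
  {EZ : Type*} [NormedAddCommGroup EZ] [NormedSpace ℝ EZ] [FiniteDimensional ℝ EZ]
  [ChartedSpace EZ (CotangentQuotient G EP P)]
  [IsManifold 𝓘(ℝ, EZ) ∞ (CotangentQuotient G EP P)] [T2Space (CotangentQuotient G EP P)]
  {hp : IsPrincipalBundle (EG := EG) (EP := EP) (EB := EB) G p}
  {hρ : IsSmoothSubmersion (I := cotangentModel EP) (I' := 𝓘(ℝ, EZ)) (quotientMap G EP P)}
  {α β : ∀ z : CotangentQuotient G EP P, Cotangent 𝓘(ℝ, EZ) z}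
  (hα : Annihilates (zeroSection hp hρ) α) (hβ : Annihilates (zeroSection hp hρ) β)

/-- The function on `T*P/G` that corresponds to the fibrewise linear function given by `α` on the
normal bundle of the zero section. -/
def linearFunction : CotangentQuotient G EP P → ℝ :=
  fiberLinear (zeroSection hp hρ) α hα ∘ linearization hp hρ

theorem linearFunction_quotientMap (y : P) (γ : EP →L[ℝ] ℝ) :
    linearFunction hα (quotientMap G EP P ⟨y, γ⟩) =
      (show EZ →L[ℝ] ℝ from α (zeroSection hp hρ (p y))) (verticalDeriv G EZ y γ) := rfl

theorem contMDiff_linearFunction (hαs : IsSmoothForm α) :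
    ContMDiff 𝓘(ℝ, EZ) 𝓘(ℝ, ℝ) ∞ (linearFunction hα) := by
  refine contMDiff_of_comp_submersion (isSmoothSubmersion_normalQuotient hp hρ)
    (normalQuotient_surjective hp hρ) ?_
  have h1 : linearFunction hα ∘ normalQuotient hp hρ =
      fun v => (show EZ →L[ℝ] ℝ from α (zeroSection hp hρ v.proj)) v.snd := by
    funext v
    rw [Function.comp_apply, linearFunction, Function.comp_apply, linearization_normalQuotient]
    exact fiberLinear_normalProj hα v
  rw [h1]
  exact hαs.contMDiff_pairing (zeroSection hp hρ)

/-- A function that vanishes on the zero section and is homogeneous of degree one on the fibres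
has the derivative at the zero section that is given by the function itself. -/
theorem diff_zeroSection {f : CotangentQuotient G EP P → ℝ}
    (hf : ContMDiff 𝓘(ℝ, EZ) 𝓘(ℝ, ℝ) ∞ f) {y : P}
    (h0 : ∀ b, f (zeroSection hp hρ b) = 0)
    (h1 : ∀ (t : ℝ) (γ : EP →L[ℝ] ℝ), f (quotientMap G EP P ⟨y, t • γ⟩) =
      t * f (quotientMap G EP P ⟨y, γ⟩)) (u : EB) (γ : EP →L[ℝ] ℝ) :
    (show EZ →L[ℝ] ℝ from diff 𝓘(ℝ, EZ) f (zeroSection hp hρ (p y)))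
      ((show EB →L[ℝ] EZ from
        mfderiv 𝓘(ℝ, EB) 𝓘(ℝ, EZ) (zeroSection hp hρ) (p y)) u + verticalDeriv G EZ y γ) =
      f (quotientMap G EP P ⟨y, γ⟩) := by
  let df : EZ →L[ℝ] ℝ := diff 𝓘(ℝ, EZ) f (zeroSection hp hρ (p y))
  have hd : HasMFDerivAt 𝓘(ℝ, EZ) 𝓘(ℝ, ℝ) f (zeroSection hp hρ (p y)) df :=
    ((hf _).mdifferentiableAt (by simp)).hasMFDerivAt
  have hd' : HasMFDerivAt 𝓘(ℝ, EZ) 𝓘(ℝ, ℝ) f (quotientMap G EP P ⟨y, 0⟩) df := by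
    rw [← zeroSection_apply hp hρ]
    exact hd
  have h2 : df ((show EB →L[ℝ] EZ from
        mfderiv 𝓘(ℝ, EB) 𝓘(ℝ, EZ) (zeroSection hp hρ) (p y)) u) = 0 := by
    have h3 := HasMFDerivAt.comp (p y) hd
      (((zeroSection hp hρ).contMDiff (p y)).mdifferentiableAt (by simp)).hasMFDerivAt
    have h4 : f ∘ zeroSection hp hρ = fun _ => 0 := funext h0
    rw [h4] at h3
    exact DFunLike.congr_fun (hasMFDerivAt_unique h3 (hasMFDerivAt_const (0 : ℝ) (p y))) u
  have h5 : df (verticalDeriv G EZ y γ) = f (quotientMap G EP P ⟨y, γ⟩) := by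
    let l : ℝ →L[ℝ] (EP →L[ℝ] ℝ) := (1 : ℝ →L[ℝ] ℝ).smulRight γ
    have hv : HasMFDerivAt 𝓘(ℝ, EP →L[ℝ] ℝ) 𝓘(ℝ, EZ)
        (fun β : EP →L[ℝ] ℝ => quotientMap G EP P ⟨y, β⟩) (l 0) (verticalDeriv G EZ y) := by
      rw [map_zero]
      exact hasMFDerivAt_quotientMap_fiber hρ y
    have h3 := HasMFDerivAt.comp (0 : ℝ) hv l.hasMFDerivAt
    have hd'' : HasMFDerivAt 𝓘(ℝ, EZ) 𝓘(ℝ, ℝ) f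
        (((fun β : EP →L[ℝ] ℝ => quotientMap G EP P ⟨y, β⟩) ∘ l) 0) df := by
      rw [Function.comp_apply, map_zero]
      exact hd'
    have h4 := HasMFDerivAt.comp (0 : ℝ) hd'' h3
    have h6 : f ∘ (fun β : EP →L[ℝ] ℝ => quotientMap G EP P ⟨y, β⟩) ∘ l =
        fun t : ℝ => t * f (quotientMap G EP P ⟨y, γ⟩) := by
      funext t
      have : l t = t • γ := by simp [l]
      rw [Function.comp_apply, Function.comp_apply, this]
      exact h1 t γ
    rw [h6] at h4
    have h7 : HasDerivAt (fun t : ℝ => t * f (quotientMap G EP P ⟨y, γ⟩))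
        (f (quotientMap G EP P ⟨y, γ⟩)) 0 := by
      simpa using (hasDerivAt_id (0 : ℝ)).mul_const (f (quotientMap G EP P ⟨y, γ⟩))
    have h8 := DFunLike.congr_fun (hasMFDerivAt_unique h4 h7.hasFDerivAt.hasMFDerivAt) 1
    have h9 : l 1 = γ := by simp [l]
    refine Eq.trans (congrArg (fun γ => df (verticalDeriv G EZ y γ)) h9.symm) (h8.trans ?_)
    exact one_smul ℝ _
  exact (map_add df _ _).trans (by rw [h2, h5, zero_add])

theorem linearFunction_smul (y : P) (t : ℝ) (γ : EP →L[ℝ] ℝ) :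
    linearFunction hα (quotientMap G EP P ⟨y, t • γ⟩) =
      t * linearFunction hα (quotientMap G EP P ⟨y, γ⟩) := by
  rw [linearFunction_quotientMap, linearFunction_quotientMap, map_smul, map_smul, smul_eq_mul]

theorem linearFunction_zeroSection (b : B) : linearFunction hα (zeroSection hp hρ b) = 0 := by
  obtain ⟨y, rfl⟩ := hp.surjective b
  rw [zeroSection_apply]
  have h1 := linearFunction_smul hα y 0 0
  rwa [zero_mul, zero_smul] at h1

include hα in
theorem Annihilates.apply_eq_zero (b : B) (u : EB) :
    (show EZ →L[ℝ] ℝ from α (zeroSection hp hρ b)) ((show EB →L[ℝ] EZ from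
        mfderiv 𝓘(ℝ, EB) 𝓘(ℝ, EZ) (zeroSection hp hρ) b) u) = 0 :=
  hα b ⟨u, rfl⟩

theorem diff_linearFunction (hαs : IsSmoothForm α) (b : B) :
    diff 𝓘(ℝ, EZ) (linearFunction hα) (zeroSection hp hρ b) = α (zeroSection hp hρ b) := by
  obtain ⟨y, rfl⟩ := hp.surjective b
  have h1 := diff_zeroSection (contMDiff_linearFunction hα hαs) (linearFunction_zeroSection hα)
    (linearFunction_smul hα y)
  refine (isSplitting_zeroSection hp hρ y).covector_ext (fun u => ?_) (fun γ => ?_)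
  · have h2 := h1 u 0
    rw [map_zero, add_zero] at h2
    have h3 : linearFunction hα (quotientMap G EP P ⟨y, 0⟩) = 0 := by
      rw [← zeroSection_apply hp hρ, linearFunction_zeroSection]
    exact (h2.trans h3).trans (hα.apply_eq_zero (p y) u).symm
  · have h2 := h1 0 γ
    rw [map_zero, zero_add] at h2
    exact h2

variable {w : PoissonStructure 𝓘(ℝ, EZ) (CotangentQuotient G EP P)}
  (hw : IsPoissonMap (canonicalPoisson EP P) w.tensor (quotientMap G EP P))
include hw hρ

theorem bracket_base_base {h k : B → ℝ} (hh : ContMDiff 𝓘(ℝ, EB) 𝓘(ℝ, ℝ) ∞ h)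
    (hk : ContMDiff 𝓘(ℝ, EB) 𝓘(ℝ, ℝ) ∞ k) (z : CotangentQuotient G EP P) :
    bracket w.tensor (h ∘ quotientProj hp) (k ∘ quotientProj hp) z = 0 := by
  obtain ⟨a, rfl⟩ := quotientMap_surjective z
  rw [← hw.2 _ _ (hh.comp (contMDiff_quotientProj hp hρ))
    (hk.comp (contMDiff_quotientProj hp hρ)) a]
  exact canonical_bracket_proj_proj (((hh.comp hp.smooth_proj) _).mdifferentiableAt (by simp))
    (((hk.comp hp.smooth_proj) _).mdifferentiableAt (by simp))

theorem bracket_linear_base (hαs : IsSmoothForm α) {h : B → ℝ}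
    (hh : ContMDiff 𝓘(ℝ, EB) 𝓘(ℝ, ℝ) ∞ h) (z : CotangentQuotient G EP P) {u : EB}
    (hu : (show EB →L[ℝ] EZ from mfderiv 𝓘(ℝ, EB) 𝓘(ℝ, EZ) (zeroSection hp hρ) (quotientProj hp z)) u
      = - sharp w.tensor (zeroSection hp hρ (quotientProj hp z))
        (α (zeroSection hp hρ (quotientProj hp z)))) :
    bracket w.tensor (linearFunction hα) (h ∘ quotientProj hp) z =
      (show EB →L[ℝ] ℝ from diff 𝓘(ℝ, EB) h (quotientProj hp z)) u := by
  obtain ⟨⟨y, γ⟩, rfl⟩ := quotientMap_surjective z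
  have hs := isSplitting_zeroSection hp hρ y
  let a : EZ →L[ℝ] ℝ := α (zeroSection hp hρ (p y))
  let V : (EP →L[ℝ] ℝ) →L[ℝ] EZ := verticalDeriv G EZ y
  obtain ⟨ξ, hξ⟩ := exists_eval (a.toLinearMap ∘ₗ V.toLinearMap)
  have h1 := hs.sharp_eq (tensor_zeroSection hp hρ hw y) (α := a) hξ
    (fun β => apply_sharp w.tensor (zeroSection hp hρ (p y)) β a)
  have h2 : a ∘L (show EB →L[ℝ] EZ from
      mfderiv 𝓘(ℝ, EB) 𝓘(ℝ, EZ) (zeroSection hp hρ) (p y)) = 0 := by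
    ext v
    exact hα.apply_eq_zero (p y) v
  rw [h2, ContinuousLinearMap.zero_comp, map_zero, sub_zero] at h1
  let S : EP →L[ℝ] EB := mfderiv 𝓘(ℝ, EP) 𝓘(ℝ, EB) p y
  have h3 : u = - S ξ := by
    refine Function.LeftInverse.injective hs.R_D ?_
    rw [map_neg]
    exact hu.trans (congrArg Neg.neg h1)
  have h4 := canonical_bracket_linear_proj (f := linearFunction hα ∘ quotientMap G EP P)
    (h := h ∘ p) (a := (⟨y, γ⟩ : CotangentBundle EP P))
    ((((contMDiff_linearFunction hα hαs).comp hρ.1) _).mdifferentiableAt (by simp))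
    (((hh.comp hp.smooth_proj) _).mdifferentiableAt (by simp)) (ξ := ξ) hξ
  have h5 : diff 𝓘(ℝ, EP) (h ∘ p) y = (diff 𝓘(ℝ, EB) h (p y)).comp
      (mfderiv 𝓘(ℝ, EP) 𝓘(ℝ, EB) p y) :=
    diff_comp ((hh _).mdifferentiableAt (by simp)) ((hp.smooth_proj _).mdifferentiableAt (by simp))
  rw [← hw.2 _ _ (contMDiff_linearFunction hα hαs) (hh.comp (contMDiff_quotientProj hp hρ))]
  refine h4.trans ?_
  rw [h3]
  refine (congrArg (fun L : EP →L[ℝ] ℝ => - L ξ) h5).trans ?_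
  exact (map_neg (show EB →L[ℝ] ℝ from diff 𝓘(ℝ, EB) h (p y)) (S ξ)).symm

theorem bracket_linear_linear (hαs : IsSmoothForm α) (hβs : IsSmoothForm β)
    (v : RestrictedTangent (zeroSection hp hρ)) :
    bracket w.tensor (linearFunction hα) (linearFunction hβ) (normalQuotient hp hρ v) =
      formBracket w.tensor α β (zeroSection hp hρ v.proj) v.snd := by
  obtain ⟨b, v⟩ := v
  obtain ⟨y, rfl⟩ := hp.surjective b
  have hs := isSplitting_zeroSection hp hρ y
  obtain ⟨u, γ, huγ⟩ := hs.exists_eq v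
  change EZ at v
  subst huγ
  rw [normalQuotient_splitting]
  have hf := contMDiff_linearFunction hα hαs
  have hg := contMDiff_linearFunction hβ hβs
  have hrange : ∀ {α : ∀ z : CotangentQuotient G EP P, Cotangent 𝓘(ℝ, EZ) z},
      Annihilates (zeroSection hp hρ) α →
      sharp w.tensor (zeroSection hp hρ (p y)) (α (zeroSection hp hρ (p y))) ∈
        Set.range (mfderiv 𝓘(ℝ, EB) 𝓘(ℝ, EZ) (zeroSection hp hρ) (p y)) := fun {α} hα =>
    (hs.sharp_mem_range_iff (tensor_zeroSection hp hρ hw y)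
      (fun β => apply_sharp w.tensor (zeroSection hp hρ (p y)) β _)).2 (hα.apply_eq_zero (p y))
  have h1 := formBracket_congr w (i := zeroSection hp hρ) (x := p y)
    (((zeroSection hp hρ).contMDiff _).mdifferentiableAt (by simp)) hαs (isSmoothForm_diff hf)
    hβs (isSmoothForm_diff hg) (fun b => (diff_linearFunction hα hαs b).symm)
    (fun b => (diff_linearFunction hβ hβs b).symm) (hrange hα) (hrange hβ)
    ((show EB →L[ℝ] EZ from
        mfderiv 𝓘(ℝ, EB) 𝓘(ℝ, EZ) (zeroSection hp hρ) (p y)) u + verticalDeriv G EZ y γ)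
  refine Eq.trans ?_ (h1.trans (formBracket_diff w.tensor hf hg _ _)).symm
  have hF := w.smooth _ _ hf hg
  have hscale : ∀ {α : ∀ z : CotangentQuotient G EP P, Cotangent 𝓘(ℝ, EZ) z}
      (hα : Annihilates (zeroSection hp hρ) α) (t : ℝ) (a : CotangentBundle EP P),
      (linearFunction hα ∘ quotientMap G EP P) (fiberScale t a) =
        t * (linearFunction hα ∘ quotientMap G EP P) a :=
    fun hα t a => linearFunction_smul hα a.proj t a.snd
  have h2 : ∀ (y : P) (t : ℝ), t ≠ 0 → ∀ γ : EP →L[ℝ] ℝ,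
      bracket w.tensor (linearFunction hα) (linearFunction hβ) (quotientMap G EP P ⟨y, t • γ⟩) =
      t * bracket w.tensor (linearFunction hα) (linearFunction hβ)
        (quotientMap G EP P ⟨y, γ⟩) := by
    intro y t ht γ
    rw [← hw.2 _ _ hf hg, ← hw.2 _ _ hf hg]
    exact canonical_bracket_homogeneous (hf.comp hρ.1) (hg.comp hρ.1) ht (hscale hα t)
      (hscale hβ t) ⟨y, γ⟩
  have h3 : ∀ b, bracket w.tensor (linearFunction hα) (linearFunction hβ)
      (zeroSection hp hρ b) = 0 := by
    intro b
    obtain ⟨y, rfl⟩ := hp.surjective b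
    rw [zeroSection_apply]
    have h4 := h2 y 2 two_ne_zero 0
    rw [smul_zero] at h4
    exact (by intro r hr; linarith : ∀ r : ℝ, r = 2 * r → r = 0) _ h4
  have h4 : ∀ (t : ℝ) (γ : EP →L[ℝ] ℝ),
      bracket w.tensor (linearFunction hα) (linearFunction hβ) (quotientMap G EP P ⟨y, t • γ⟩) =
      t * bracket w.tensor (linearFunction hα) (linearFunction hβ)
        (quotientMap G EP P ⟨y, γ⟩) := by
    intro t γ
    by_cases ht : t = 0
    · rw [ht, zero_mul, zero_smul]
      exact (congrArg _ (zeroSection_apply hp hρ y)).symm.trans (h3 (p y))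
    · exact h2 y t ht γ
  exact (diff_zeroSection hF h3 h4 u γ).symm

end LinearFunctions

section Transport

variable {E : Type*} [NormedAddCommGroup E] [NormedSpace ℝ E]
  {M : Type*} [TopologicalSpace M] [ChartedSpace E M] [IsManifold 𝓘(ℝ, E) ∞ M]

/-- The structure of a manifold can be transported along a bijection. -/
theorem exists_isManifold_of_equiv {N : Type*} (e : M ≃ N) :
    ∃ (_ : TopologicalSpace N) (_ : ChartedSpace E N), IsManifold 𝓘(ℝ, E) ∞ N ∧
      ContMDiff 𝓘(ℝ, E) 𝓘(ℝ, E) ∞ e ∧ ContMDiff 𝓘(ℝ, E) 𝓘(ℝ, E) ∞ e.symm := by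
  let : TopologicalSpace N := TopologicalSpace.induced e.symm inferInstance
  let h : N ≃ₜ M := e.symm.toHomeomorphOfIsInducing ⟨rfl⟩
  let : ChartedSpace E N :=
    { atlas := (fun c => h.toOpenPartialHomeomorph.trans c) '' atlas E M
      chartAt := fun n => h.toOpenPartialHomeomorph.trans (chartAt E (h n))
      mem_chart_source := fun n => by simp
      chart_mem_atlas := fun n => ⟨_, chart_mem_atlas E (h n), rfl⟩ }
  have hchart : ∀ n : N, chartAt E n = h.toOpenPartialHomeomorph.trans (chartAt E (h n)) :=
    fun _ => rfl
  have hext : ∀ (n n' : N), extChartAt 𝓘(ℝ, E) n n' = extChartAt 𝓘(ℝ, E) (h n) (h n') :=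
    fun n n' => by simp [hchart]
  have hext' : ∀ (n : N) (u : E), h ((extChartAt 𝓘(ℝ, E) n).symm u) =
      (extChartAt 𝓘(ℝ, E) (h n)).symm u := fun n u => by simp [hchart]
  have hgr : HasGroupoid N (contDiffGroupoid ∞ 𝓘(ℝ, E)) := by
    refine ⟨?_⟩
    rintro _ _ ⟨c, hc, rfl⟩ ⟨c', hc', rfl⟩
    have h1 := (contDiffGroupoid ∞ 𝓘(ℝ, E)).compatible hc hc'
    refine (contDiffGroupoid ∞ 𝓘(ℝ, E)).mem_of_eqOnSource h1 ⟨?_, fun x _ => ?_⟩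
    · ext x
      simp
    · simp
  have hid : ∀ {x : E} {g : E → E}, g =ᶠ[𝓝 x] id →
      ContDiffWithinAt ℝ ∞ g (Set.range 𝓘(ℝ, E)) x := fun hg =>
    (contDiffAt_id.congr_of_eventuallyEq hg).contDiffWithinAt
  refine ⟨inferInstance, inferInstance, IsManifold.mk' _ _ _, fun m => ?_, fun n => ?_⟩
  · have hm : h (e m) = m := e.symm_apply_apply m
    rw [contMDiffAt_iff]
    refine ⟨h.symm.continuous.continuousAt, hid ?_⟩
    filter_upwards [extChartAt_target_mem_nhds (I := 𝓘(ℝ, E)) m] with u hu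
    have h1 : h (e ((extChartAt 𝓘(ℝ, E) m).symm u)) = (extChartAt 𝓘(ℝ, E) m).symm u :=
      e.symm_apply_apply _
    rw [Function.comp_apply, Function.comp_apply, hext, h1, hm]
    exact (extChartAt 𝓘(ℝ, E) m).right_inv hu
  · rw [contMDiffAt_iff]
    refine ⟨h.continuous.continuousAt, hid ?_⟩
    filter_upwards [extChartAt_target_mem_nhds (I := 𝓘(ℝ, E)) n] with u hu
    refine Eq.trans ?_ ((extChartAt 𝓘(ℝ, E) n).right_inv hu)
    exact (hext n _).symm

/-- A Poisson structure can be transported along a diffeomorphism. -/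
theorem exists_poissonStructure_of_diffeomorph [FiniteDimensional ℝ E] [T2Space M]
    {N : Type*} [TopologicalSpace N]
    [ChartedSpace E N] [IsManifold 𝓘(ℝ, E) ∞ N] (Φ : M ≃ₘ⟮𝓘(ℝ, E), 𝓘(ℝ, E)⟯ N)
    (w : PoissonStructure 𝓘(ℝ, E) M) :
    ∃ w' : PoissonStructure 𝓘(ℝ, E) N, ∀ (f g : N → ℝ), ContMDiff 𝓘(ℝ, E) 𝓘(ℝ, ℝ) ∞ f →
      ContMDiff 𝓘(ℝ, E) 𝓘(ℝ, ℝ) ∞ g → ∀ n : N,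
      bracket w'.tensor f g n = bracket w.tensor (f ∘ Φ) (g ∘ Φ) (Φ.symm n) := by
  have : T2Space N := Φ.toHomeomorph.t2Space
  let t : BilinField 𝓘(ℝ, E) N := fun n =>
    let L : E →L[ℝ] E := mfderiv 𝓘(ℝ, E) 𝓘(ℝ, E) Φ (Φ.symm n)
    let T : (E →L[ℝ] ℝ) →ₗ[ℝ] (E →L[ℝ] ℝ) :=
      { toFun := fun α => α ∘L L
        map_add' := fun _ _ => rfl
        map_smul' := fun _ _ => rfl }
    LinearMap.compl₁₂ (show (E →L[ℝ] ℝ) →ₗ[ℝ] (E →L[ℝ] ℝ) →ₗ[ℝ] ℝ from w.tensor (Φ.symm n)) T T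
  have ht : ∀ (f g : N → ℝ), ContMDiff 𝓘(ℝ, E) 𝓘(ℝ, ℝ) ∞ f →
      ContMDiff 𝓘(ℝ, E) 𝓘(ℝ, ℝ) ∞ g →
      bracket t f g = bracket w.tensor (f ∘ Φ) (g ∘ Φ) ∘ Φ.symm := by
    intro f g hf hg
    funext n
    have hd : ∀ f : N → ℝ, ContMDiff 𝓘(ℝ, E) 𝓘(ℝ, ℝ) ∞ f →
        diff 𝓘(ℝ, E) (f ∘ Φ) (Φ.symm n) =
          (diff 𝓘(ℝ, E) f n).comp (mfderiv 𝓘(ℝ, E) 𝓘(ℝ, E) Φ (Φ.symm n)) := by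
      intro f hf
      have h1 := diff_comp (q := Φ) (z := Φ.symm n) ((hf (Φ (Φ.symm n))).mdifferentiableAt (by simp))
        ((Φ.contMDiff (Φ.symm n)).mdifferentiableAt (by simp))
      rw [Φ.apply_symm_apply] at h1
      exact h1
    rw [Function.comp_apply, bracket, bracket, hd f hf, hd g hg]
    rfl
  have hsm : ∀ {f : N → ℝ}, ContMDiff 𝓘(ℝ, E) 𝓘(ℝ, ℝ) ∞ f →
      ContMDiff 𝓘(ℝ, E) 𝓘(ℝ, ℝ) ∞ (f ∘ Φ) := fun hf => hf.comp Φ.contMDiff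
  have hts : ∀ (f g : N → ℝ), ContMDiff 𝓘(ℝ, E) 𝓘(ℝ, ℝ) ∞ f →
      ContMDiff 𝓘(ℝ, E) 𝓘(ℝ, ℝ) ∞ g → ContMDiff 𝓘(ℝ, E) 𝓘(ℝ, ℝ) ∞ (bracket t f g) :=
    fun f g hf hg => by
      rw [ht f g hf hg]
      exact (w.smooth _ _ (hsm hf) (hsm hg)).comp Φ.symm.contMDiff
  have ht' : ∀ (f g : N → ℝ), ContMDiff 𝓘(ℝ, E) 𝓘(ℝ, ℝ) ∞ f →
      ContMDiff 𝓘(ℝ, E) 𝓘(ℝ, ℝ) ∞ g →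
      bracket t f g ∘ Φ = bracket w.tensor (f ∘ Φ) (g ∘ Φ) := fun f g hf hg => by
    rw [ht f g hf hg]
    funext m
    rw [Function.comp_apply, Function.comp_apply, Φ.symm_apply_apply]
  refine ⟨⟨t, fun n α β => w.skew _ _ _, hts, fun f g h hf hg hh n => ?_⟩,
    fun f g hf hg n => congrFun (ht f g hf hg) n⟩
  rw [ht _ _ hf (hts _ _ hg hh), ht _ _ hg (hts _ _ hh hf), ht _ _ hh (hts _ _ hf hg),
    ht' _ _ hg hh, ht' _ _ hh hf, ht' _ _ hf hg]
  exact w.jacobi _ _ _ (hsm hf) (hsm hg) (hsm hh) (Φ.symm n)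

end Transport

section Isomorphism

variable {EG : Type*} [NormedAddCommGroup EG] [NormedSpace ℝ EG]
  {G : Type*} [Group G] [TopologicalSpace G] [ChartedSpace EG G] [LieGroup 𝓘(ℝ, EG) ∞ G]
  {EP : Type*} [NormedAddCommGroup EP] [NormedSpace ℝ EP] [FiniteDimensional ℝ EP]
  {P : Type*} [TopologicalSpace P] [ChartedSpace EP P] [IsManifold 𝓘(ℝ, EP) ∞ P]
  [MulAction Gᵐᵒᵖ P]
  {EB : Type*} [NormedAddCommGroup EB] [NormedSpace ℝ EB] [FiniteDimensional ℝ EB]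
  {B : Type*} [TopologicalSpace B] [ChartedSpace EB B] [IsManifold 𝓘(ℝ, EB) ∞ B] [T2Space B]
  {p : P → B}
  {EZ : Type*} [NormedAddCommGroup EZ] [NormedSpace ℝ EZ] [FiniteDimensional ℝ EZ]
  [ChartedSpace EZ (CotangentQuotient G EP P)]
  [IsManifold 𝓘(ℝ, EZ) ∞ (CotangentQuotient G EP P)] [T2Space (CotangentQuotient G EP P)]
  {hp : IsPrincipalBundle (EG := EG) (EP := EP) (EB := EB) G p}
  {hρ : IsSmoothSubmersion (I := cotangentModel EP) (I' := 𝓘(ℝ, EZ)) (quotientMap G EP P)}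

theorem annihilates_diff {f : CotangentQuotient G EP P → ℝ}
    (hf : ContMDiff 𝓘(ℝ, EZ) 𝓘(ℝ, ℝ) ∞ f) (h0 : ∀ b, f (zeroSection hp hρ b) = 0) :
    Annihilates (zeroSection hp hρ) (diff 𝓘(ℝ, EZ) f) := by
  rintro b _ ⟨u, rfl⟩
  have h3 := HasMFDerivAt.comp b ((hf _).mdifferentiableAt (by simp)).hasMFDerivAt
    (((zeroSection hp hρ).contMDiff b).mdifferentiableAt (by simp)).hasMFDerivAt
  have h4 : f ∘ zeroSection hp hρ = fun _ => 0 := funext h0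
  rw [h4] at h3
  exact DFunLike.congr_fun (hasMFDerivAt_unique h3 (hasMFDerivAt_const (0 : ℝ) b)) u

theorem linearFunction_diff {f : CotangentQuotient G EP P → ℝ}
    (hf : ContMDiff 𝓘(ℝ, EZ) 𝓘(ℝ, ℝ) ∞ f) (h0 : ∀ b, f (zeroSection hp hρ b) = 0)
    (h1 : ∀ (y : P) (t : ℝ) (γ : EP →L[ℝ] ℝ), f (quotientMap G EP P ⟨y, t • γ⟩) =
      t * f (quotientMap G EP P ⟨y, γ⟩)) :
    linearFunction (annihilates_diff hf h0) = f := by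
  funext z
  obtain ⟨⟨y, γ⟩, rfl⟩ := quotientMap_surjective z
  have h2 := diff_zeroSection hf h0 (h1 y) 0 γ
  rw [map_zero, zero_add] at h2
  exact h2

variable (hp hρ) in
/-- The covectors of `T*P/G` are the differentials of the sums of functions on the base and of
functions that are linear on the fibres. -/
theorem exists_diff_add_eq (z : CotangentQuotient G EP P) (l : Cotangent 𝓘(ℝ, EZ) z) :
    ∃ (h : B → ℝ) (α : ∀ z : CotangentQuotient G EP P, Cotangent 𝓘(ℝ, EZ) z)
      (hα : Annihilates (zeroSection hp hρ) α), ContMDiff 𝓘(ℝ, EB) 𝓘(ℝ, ℝ) ∞ h ∧ IsSmoothForm α ∧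
      l = diff 𝓘(ℝ, EZ) (h ∘ quotientProj hp) z + diff 𝓘(ℝ, EZ) (linearFunction hα) z := by
  obtain ⟨m⟩ := exists_localModel hp hρ (quotientProj hp z)
  obtain ⟨χ, hχ, hχ1, hχU⟩ := exists_cutoff (I := 𝓘(ℝ, EB)) m.isOpen_U m.mem_U
  have hχ0 : ∀ b, b ∉ m.U → χ b = 0 := fun b hb =>
    image_eq_zero_of_notMem_tsupport fun h => hb (hχU h)
  let l' : EZ →L[ℝ] ℝ := l
  let dR : EB × (EP →L[ℝ] ℝ) →L[ℝ] EZ := mfderiv (𝓘(ℝ, EB).prod 𝓘(ℝ, EP →L[ℝ] ℝ)) 𝓘(ℝ, EZ) m.R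
    (quotientProj hp z, m.F z)
  let dπ : EZ →L[ℝ] EB := mfderiv 𝓘(ℝ, EZ) 𝓘(ℝ, EB) (quotientProj hp) z
  let dF : EZ →L[ℝ] (EP →L[ℝ] ℝ) := mfderiv 𝓘(ℝ, EZ) 𝓘(ℝ, EP →L[ℝ] ℝ) m.F z
  let l₁ : EB →L[ℝ] ℝ := (l' ∘L dR) ∘L ContinuousLinearMap.inl ℝ EB (EP →L[ℝ] ℝ)
  let l₂ : (EP →L[ℝ] ℝ) →L[ℝ] ℝ := (l' ∘L dR) ∘L ContinuousLinearMap.inr ℝ EB (EP →L[ℝ] ℝ)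
  have hπ := ((contMDiff_quotientProj hp hρ z).mdifferentiableAt (by simp)).hasMFDerivAt
  have hF := ((m.contMDiffAt_F hρ m.mem_U).mdifferentiableAt (by simp)).hasMFDerivAt
  have hdR : ∀ Y : EZ, dR (dπ Y, dF Y) = Y := by
    intro Y
    have hR : HasMFDerivAt (𝓘(ℝ, EB).prod 𝓘(ℝ, EP →L[ℝ] ℝ)) 𝓘(ℝ, EZ) m.R
        (quotientProj hp z, m.F z) _ :=
      ((m.smooth_R.contMDiffAt ((m.isOpen_U.prod isOpen_univ).mem_nhds
        ⟨m.mem_U, trivial⟩)).mdifferentiableAt (by simp)).hasMFDerivAt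
    have h3 := HasMFDerivAt.comp z hR (hπ.prodMk hF)
    have h4 : (m.R ∘ fun z => (quotientProj hp z, m.F z)) =ᶠ[𝓝 z] id := by
      filter_upwards [(m.isOpen_U.preimage (contMDiff_quotientProj hp hρ).continuous).mem_nhds
        m.mem_U] with z' hz'
      exact m.R_F z' hz'
    exact DFunLike.congr_fun
      (hasMFDerivAt_unique (h3.congr_of_eventuallyEq h4.symm) (hasMFDerivAt_id z)) Y
  obtain ⟨h, hh, hhd⟩ := exists_diff_eq (I := 𝓘(ℝ, EB)) (quotientProj hp z) l₁
  let f : CotangentQuotient G EP P → ℝ := fun z => l₂ (χ (quotientProj hp z) • m.F z)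
  have hf : ContMDiff 𝓘(ℝ, EZ) 𝓘(ℝ, ℝ) ∞ f := l₂.contMDiff.comp
    (contMDiff_cutoff_smul m.isOpen_U hχ hχU (contMDiff_quotientProj hp hρ) m.smooth_F)
  have hf0 : ∀ b, f (zeroSection hp hρ b) = 0 := by
    intro b
    by_cases hb : b ∈ m.U
    · simp only [f]
      rw [m.F_zeroSection hρ hb, smul_zero, map_zero]
    · simp only [f]
      rw [quotientProj_zeroSection, hχ0 b hb, zero_smul, map_zero]
  have hf1 : ∀ (y : P) (t : ℝ) (γ : EP →L[ℝ] ℝ), f (quotientMap G EP P ⟨y, t • γ⟩) =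
      t * f (quotientMap G EP P ⟨y, γ⟩) := by
    intro y t γ
    change l₂ (χ (p y) • _) = t * l₂ (χ (p y) • _)
    by_cases hy : p y ∈ m.U
    · obtain ⟨A, hA⟩ := m.F_fiber y hy
      rw [hA, hA, ContinuousLinearMap.smul_comp, smul_comm, map_smul, smul_eq_mul]
    · rw [hχ0 _ hy, zero_smul, zero_smul, map_zero, mul_zero]
  refine ⟨h, diff 𝓘(ℝ, EZ) f, annihilates_diff hf hf0, hh, isSmoothForm_diff hf, ?_⟩
  rw [linearFunction_diff hf hf0 hf1, diff_comp ((hh _).mdifferentiableAt (by simp))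
    ((contMDiff_quotientProj hp hρ z).mdifferentiableAt (by simp)), hhd]
  have hfe : f =ᶠ[𝓝 z] l₂ ∘ m.F := by
    filter_upwards [(contMDiff_quotientProj hp hρ).continuous.continuousAt.eventually hχ1]
      with z' hz'
    simp only [f]
    rw [hz', one_smul]
    rfl
  have hfd : diff 𝓘(ℝ, EZ) f z = l₂ ∘L dF :=
    (diff_congr hfe).trans (HasMFDerivAt.comp z l₂.hasMFDerivAt hF).mfderiv
  rw [hfd]
  refine ContinuousLinearMap.ext fun Y : EZ => ?_
  have h1 : l' Y = l' (dR (dπ Y, 0)) + l' (dR (0, dF Y)) := by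
    rw [← map_add, ← map_add, Prod.mk_add_mk, add_zero, zero_add, hdR]
  exact h1

theorem exists_approximation {w : PoissonStructure 𝓘(ℝ, EZ) (CotangentQuotient G EP P)}
    (hw : IsPoissonMap (canonicalPoisson EP P) w.tensor (quotientMap G EP P)) :
    Nonempty (Approximation w (zeroSection hp hρ)) := by
  obtain ⟨t, c, hm, hΦ, hΦ'⟩ := exists_isManifold_of_equiv (E := EZ) (linearizationEquiv hp hρ)
  let Φ : CotangentQuotient G EP P ≃ₘ⟮𝓘(ℝ, EZ), 𝓘(ℝ, EZ)⟯ NormalBundle (zeroSection hp hρ) :=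
    ⟨linearizationEquiv hp hρ, hΦ, hΦ'⟩
  obtain ⟨w', hw'⟩ := exists_poissonStructure_of_diffeomorph Φ w
  have hN := isSmoothSubmersion_normalQuotient hp hρ
  have hbase : ∀ n, quotientProj hp (Φ.symm n) = n.base := fun n => by
    rw [← linearization_base hp hρ]
    exact congrArg NormalBundle.base (Φ.apply_symm_apply n)
  have hb : ∀ {h : B → ℝ}, ContMDiff 𝓘(ℝ, EB) 𝓘(ℝ, ℝ) ∞ h → ContMDiff 𝓘(ℝ, EZ) 𝓘(ℝ, ℝ) ∞
      (fun n : NormalBundle (zeroSection hp hρ) => h n.base) := fun {h} hh => by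
    have h1 : (fun n : NormalBundle (zeroSection hp hρ) => h n.base) =
        (h ∘ quotientProj hp) ∘ Φ.symm := funext fun n => congrArg h (hbase n).symm
    rw [h1]
    exact (hh.comp (contMDiff_quotientProj hp hρ)).comp Φ.symm.contMDiff
  have hl : ∀ {α : ∀ z : CotangentQuotient G EP P, Cotangent 𝓘(ℝ, EZ) z}
      (hα : Annihilates (zeroSection hp hρ) α), IsSmoothForm α →
      ContMDiff 𝓘(ℝ, EZ) 𝓘(ℝ, ℝ) ∞ (fiberLinear (zeroSection hp hρ) α hα) := fun {α} hα hαs => by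
    have h1 : fiberLinear (zeroSection hp hρ) α hα = linearFunction hα ∘ Φ.symm :=
      funext fun n => congrArg (fiberLinear (zeroSection hp hρ) α hα) (Φ.apply_symm_apply n).symm
    rw [h1]
    exact (contMDiff_linearFunction hα hαs).comp Φ.symm.contMDiff
  have hbΦ : ∀ h : B → ℝ, (fun n : NormalBundle (zeroSection hp hρ) => h n.base) ∘ Φ =
      h ∘ quotientProj hp := fun h => funext fun z => congrArg h (linearization_base hp hρ z)
  refine ⟨{ topology := t, charts := c, manifold := hm, submersion := ⟨?_, fun v => ?_⟩,
            poisson := w', base_base := ?_, linear_base := ?_, linear_linear := ?_ }⟩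
  · have h1 : normalProj (zeroSection hp hρ) = Φ ∘ normalQuotient hp hρ :=
      funext fun v => (linearization_normalQuotient hp hρ v).symm
    rw [h1]
    exact Φ.contMDiff.comp hN.1
  · have h1 : normalProj (zeroSection hp hρ) = Φ ∘ normalQuotient hp hρ :=
      funext fun v => (linearization_normalQuotient hp hρ v).symm
    rw [h1, mfderiv_comp v ((Φ.contMDiff _).mdifferentiableAt (by simp))
      ((hN.1 v).mdifferentiableAt (by simp))]
    exact (Φ.mfderivToContinuousLinearEquiv (by simp) (normalQuotient hp hρ v)).surjective.comp
      (hN.2 v)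
  · intro h k hh hk n
    rw [hw' _ _ (hb hh) (hb hk), hbΦ, hbΦ]
    exact bracket_base_base (hρ := hρ) hw hh hk _
  · intro α hα h hαs hh n u hu
    rw [hw' _ _ (hl hα hαs) (hb hh), hbΦ]
    obtain ⟨z, rfl⟩ : ∃ z, Φ z = n := ⟨Φ.symm n, Φ.apply_symm_apply n⟩
    obtain ⟨⟨y, γ⟩, rfl⟩ := quotientMap_surjective z
    rw [Φ.symm_apply_apply]
    exact bracket_linear_base hα hw hαs hh (quotientMap G EP P ⟨y, γ⟩) hu
  · intro α β hα hβ hαs hβs x v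
    rw [hw' _ _ (hl hα hαs) (hl hβ hβs)]
    exact bracket_linear_linear hα hβ hw hαs hβs ⟨x, v⟩

end Isomorphism

theorem bilin_add_add {V W : Type*} [AddCommGroup V] [Module ℝ V] [AddCommGroup W] [Module ℝ W]
    (b : V →ₗ[ℝ] V →ₗ[ℝ] ℝ) (b' : W →ₗ[ℝ] W →ₗ[ℝ] ℝ) {T : V → W}
    (hT : ∀ x y, T (x + y) = T x + T y) {x y x' y' : V} (h1 : b x x' = b' (T x) (T x'))
    (h2 : b x y' = b' (T x) (T y')) (h3 : b y x' = b' (T y) (T x'))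
    (h4 : b y y' = b' (T y) (T y')) :
    b (x + y) (x' + y') = b' (T (x + y)) (T (x' + y')) := by
  simp only [hT, map_add, LinearMap.add_apply, h1, h2, h3, h4]

section Isomorphism

variable {EG : Type*} [NormedAddCommGroup EG] [NormedSpace ℝ EG]
  {G : Type*} [Group G] [TopologicalSpace G] [ChartedSpace EG G] [LieGroup 𝓘(ℝ, EG) ∞ G]
  {EP : Type*} [NormedAddCommGroup EP] [NormedSpace ℝ EP] [FiniteDimensional ℝ EP]
  {P : Type*} [TopologicalSpace P] [ChartedSpace EP P] [IsManifold 𝓘(ℝ, EP) ∞ P]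
  [MulAction Gᵐᵒᵖ P]
  {EB : Type*} [NormedAddCommGroup EB] [NormedSpace ℝ EB] [FiniteDimensional ℝ EB]
  {B : Type*} [TopologicalSpace B] [ChartedSpace EB B] [IsManifold 𝓘(ℝ, EB) ∞ B] [T2Space B]
  {p : P → B}
  {EZ : Type*} [NormedAddCommGroup EZ] [NormedSpace ℝ EZ] [FiniteDimensional ℝ EZ]
  [ChartedSpace EZ (CotangentQuotient G EP P)]
  [IsManifold 𝓘(ℝ, EZ) ∞ (CotangentQuotient G EP P)] [T2Space (CotangentQuotient G EP P)]
  {hp : IsPrincipalBundle (EG := EG) (EP := EP) (EB := EB) G p}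
  {hρ : IsSmoothSubmersion (I := cotangentModel EP) (I' := 𝓘(ℝ, EZ)) (quotientMap G EP P)}

variable {w : PoissonStructure 𝓘(ℝ, EZ) (CotangentQuotient G EP P)}

namespace Approximation

variable (A : Approximation w (zeroSection hp hρ))

/-- The projection onto the Sternberg-Weinstein approximation. -/
def proj : RestrictedTangent (zeroSection hp hρ) → A.Total := normalProj (zeroSection hp hρ)

/-- The base point of an element of the Sternberg-Weinstein approximation. -/
def base : A.Total → B := NormalBundle.base

/-- The fibrewise linear function on the Sternberg-Weinstein approximation given by `α`. -/
def linear {α : ∀ z : CotangentQuotient G EP P, Cotangent 𝓘(ℝ, EZ) z}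
    (hα : Annihilates (zeroSection hp hρ) α) : A.Total → ℝ :=
  fiberLinear (zeroSection hp hρ) α hα

theorem tensor_skew (n : A.Total) (κ κ' : Cotangent 𝓘(ℝ, EZ) n) :
    A.tensor n κ κ' = - A.tensor n κ' κ :=
  letI := A.topology
  letI := A.charts
  A.poisson.skew n κ κ'

theorem isSmoothSubmersion_proj :
    IsSmoothSubmersion (I := 𝓘(ℝ, EB).prod 𝓘(ℝ, EZ)) (I' := 𝓘(ℝ, EZ)) A.proj := A.submersion

/-- The linearization, as a bijection onto the Sternberg-Weinstein approximation. -/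
def linearizationEquiv : CotangentQuotient G EP P ≃ A.Total :=
  SternbergWeinstein.linearizationEquiv hp hρ

/-- The linearization, as a diffeomorphism onto the Sternberg-Weinstein approximation. -/
def linearizationDiffeomorph : CotangentQuotient G EP P ≃ₘ⟮𝓘(ℝ, EZ), 𝓘(ℝ, EZ)⟯ A.Total where
  toEquiv := A.linearizationEquiv
  contMDiff_toFun := by
    refine contMDiff_of_comp_submersion (isSmoothSubmersion_normalQuotient hp hρ)
      (normalQuotient_surjective hp hρ) ?_
    have h1 : A.linearizationEquiv ∘ normalQuotient hp hρ = A.proj :=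
      funext (linearization_normalQuotient hp hρ)
    exact h1 ▸ A.isSmoothSubmersion_proj.1
  contMDiff_invFun :=
    contMDiff_of_comp_submersion A.isSmoothSubmersion_proj normalProj_surjective
      (contMDiff_normalQuotient hp hρ)

theorem linearizationDiffeomorph_quotientMap (a : CotangentBundle EP P) :
    A.linearizationDiffeomorph (quotientMap G EP P a) =
      A.point (p a.proj) (mfderiv (cotangentModel EP) 𝓘(ℝ, EZ) (quotientMap G EP P)
        ⟨a.proj, 0⟩ (verticalVector a)) := by
  rw [verticalVector_eq]
  rfl

theorem base_comp_linearizationDiffeomorph (h : B → ℝ) :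
    (h ∘ A.base) ∘ A.linearizationDiffeomorph = h ∘ quotientProj hp :=
  funext fun z => congrArg h (linearization_base hp hρ z)

theorem contMDiff_of_comp_linearizationDiffeomorph {f : A.Total → ℝ}
    (hf : ContMDiff 𝓘(ℝ, EZ) 𝓘(ℝ, ℝ) ∞ (f ∘ A.linearizationDiffeomorph)) :
    ContMDiff 𝓘(ℝ, EZ) 𝓘(ℝ, ℝ) ∞ f := by
  have h1 : f = (f ∘ A.linearizationDiffeomorph) ∘ A.linearizationDiffeomorph.symm :=
    funext fun n => congrArg f (A.linearizationDiffeomorph.apply_symm_apply n).symm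
  rw [h1]
  exact hf.comp A.linearizationDiffeomorph.symm.contMDiff

theorem contMDiff_comp_base {h : B → ℝ} (hh : ContMDiff 𝓘(ℝ, EB) 𝓘(ℝ, ℝ) ∞ h) :
    ContMDiff 𝓘(ℝ, EZ) 𝓘(ℝ, ℝ) ∞ (h ∘ A.base) := by
  refine A.contMDiff_of_comp_linearizationDiffeomorph ?_
  rw [base_comp_linearizationDiffeomorph]
  exact hh.comp (contMDiff_quotientProj hp hρ)

theorem contMDiff_linear {α : ∀ z : CotangentQuotient G EP P, Cotangent 𝓘(ℝ, EZ) z}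
    (hα : Annihilates (zeroSection hp hρ) α) (hαs : IsSmoothForm α) :
    ContMDiff 𝓘(ℝ, EZ) 𝓘(ℝ, ℝ) ∞ (A.linear hα) :=
  A.contMDiff_of_comp_linearizationDiffeomorph (contMDiff_linearFunction hα hαs)

variable (hw : IsPoissonMap (canonicalPoisson EP P) w.tensor (quotientMap G EP P))
include hw

theorem bracket_base_base {h k : B → ℝ} (hh : ContMDiff 𝓘(ℝ, EB) 𝓘(ℝ, ℝ) ∞ h)
    (hk : ContMDiff 𝓘(ℝ, EB) 𝓘(ℝ, ℝ) ∞ k) (z : CotangentQuotient G EP P) :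
    bracket A.tensor (h ∘ A.base)
      (k ∘ A.base) (A.linearizationDiffeomorph z) =
    bracket w.tensor ((h ∘ A.base) ∘ A.linearizationDiffeomorph)
      ((k ∘ A.base) ∘ A.linearizationDiffeomorph) z := by
  rw [base_comp_linearizationDiffeomorph, base_comp_linearizationDiffeomorph]
  exact (A.base_base h k hh hk _).trans (SternbergWeinstein.bracket_base_base (hρ := hρ) hw hh hk z).symm

theorem bracket_linear_base {α : ∀ z : CotangentQuotient G EP P, Cotangent 𝓘(ℝ, EZ) z}
    (hα : Annihilates (zeroSection hp hρ) α) (hαs : IsSmoothForm α) {h : B → ℝ}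
    (hh : ContMDiff 𝓘(ℝ, EB) 𝓘(ℝ, ℝ) ∞ h) (z : CotangentQuotient G EP P) :
    bracket A.tensor (A.linear hα)
      (h ∘ A.base) (A.linearizationDiffeomorph z) =
    bracket w.tensor (A.linear hα ∘ A.linearizationDiffeomorph)
      ((h ∘ A.base) ∘ A.linearizationDiffeomorph) z := by
  rw [base_comp_linearizationDiffeomorph]
  obtain ⟨⟨y, γ⟩, rfl⟩ := quotientMap_surjective z
  obtain ⟨u, hu⟩ := ((isSplitting_zeroSection hp hρ y).sharp_mem_range_iff
    (tensor_zeroSection hp hρ hw y)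
    (fun β => apply_sharp w.tensor (zeroSection hp hρ (p y)) β _)).2 (hα.apply_eq_zero (p y))
  let D : EB →L[ℝ] EZ := mfderiv 𝓘(ℝ, EB) 𝓘(ℝ, EZ) (zeroSection hp hρ) (p y)
  have hu' : D (-u) = - sharp w.tensor (zeroSection hp hρ (p y)) (α (zeroSection hp hρ (p y))) :=
    (map_neg D u).trans (congrArg Neg.neg hu)
  exact (A.linear_base α hα h hαs hh (A.linearizationDiffeomorph (quotientMap G EP P ⟨y, γ⟩))
    (-u) hu').trans (SternbergWeinstein.bracket_linear_base hα hw hαs hh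
      (quotientMap G EP P ⟨y, γ⟩) hu').symm

theorem bracket_linear_linear {α β : ∀ z : CotangentQuotient G EP P, Cotangent 𝓘(ℝ, EZ) z}
    (hα : Annihilates (zeroSection hp hρ) α) (hβ : Annihilates (zeroSection hp hρ) β)
    (hαs : IsSmoothForm α) (hβs : IsSmoothForm β) (z : CotangentQuotient G EP P) :
    bracket A.tensor (A.linear hα)
      (A.linear hβ) (A.linearizationDiffeomorph z) =
    bracket w.tensor (A.linear hα ∘ A.linearizationDiffeomorph)
      (A.linear hβ ∘ A.linearizationDiffeomorph) z := by
  obtain ⟨v, rfl⟩ := normalQuotient_surjective hp hρ z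
  have h1 : A.linearizationDiffeomorph (normalQuotient hp hρ v) = A.proj v :=
    linearization_normalQuotient hp hρ v
  rw [h1]
  exact (A.linear_linear α β hα hβ hαs hβs v.proj v.snd).trans
    (SternbergWeinstein.bracket_linear_linear hα hβ hw hαs hβs v).symm

theorem isPoissonMap_linearizationDiffeomorph :
    IsPoissonMap w.tensor A.tensor A.linearizationDiffeomorph := by
  have : T2Space A.Total := A.linearizationDiffeomorph.toHomeomorph.t2Space
  refine isPoissonMap_of_tensor A.linearizationDiffeomorph.contMDiff fun z κ κ' => ?_
  let Φ := A.linearizationDiffeomorph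
  let e := Φ.mfderivToContinuousLinearEquiv (by simp) z
  have hdecomp : ∀ κ : Cotangent 𝓘(ℝ, EZ) (Φ z), ∃ (h : B → ℝ)
      (α : ∀ z : CotangentQuotient G EP P, Cotangent 𝓘(ℝ, EZ) z)
      (hα : Annihilates (zeroSection hp hρ) α), ContMDiff 𝓘(ℝ, EB) 𝓘(ℝ, ℝ) ∞ h ∧ IsSmoothForm α ∧
      κ = diff 𝓘(ℝ, EZ) (h ∘ A.base) (Φ z) +
        diff 𝓘(ℝ, EZ) (A.linear hα) (Φ z) := by
    intro κ
    obtain ⟨h, α, hα, hh, hαs, hl⟩ := exists_diff_add_eq hp hρ z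
      (κ.comp (mfderiv 𝓘(ℝ, EZ) 𝓘(ℝ, EZ) Φ z))
    refine ⟨h, α, hα, hh, hαs, ?_⟩
    have h1 := diff_comp (q := Φ) (z := z) ((A.contMDiff_comp_base hh _).mdifferentiableAt (by simp))
      ((Φ.contMDiff z).mdifferentiableAt (by simp))
    have h2 := diff_comp (q := Φ) (z := z)
      ((A.contMDiff_linear hα hαs _).mdifferentiableAt (by simp))
      ((Φ.contMDiff z).mdifferentiableAt (by simp))
    rw [A.base_comp_linearizationDiffeomorph] at h1
    refine ContinuousLinearMap.ext fun Y => ?_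
    obtain ⟨X, rfl⟩ := e.surjective Y
    have h3 := DFunLike.congr_fun hl X
    exact h3.trans (congrArg₂ (· + ·) (DFunLike.congr_fun h1 X) (DFunLike.congr_fun h2 X))
  have hb : ∀ {f g : A.Total → ℝ}, ContMDiff 𝓘(ℝ, EZ) 𝓘(ℝ, ℝ) ∞ f →
      ContMDiff 𝓘(ℝ, EZ) 𝓘(ℝ, ℝ) ∞ g →
      bracket A.tensor f g (Φ z) = bracket w.tensor (f ∘ Φ) (g ∘ Φ) z →
      A.tensor (Φ z) (diff 𝓘(ℝ, EZ) f (Φ z)) (diff 𝓘(ℝ, EZ) g (Φ z)) =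
        w.tensor z ((diff 𝓘(ℝ, EZ) f (Φ z)).comp (mfderiv 𝓘(ℝ, EZ) 𝓘(ℝ, EZ) Φ z))
          ((diff 𝓘(ℝ, EZ) g (Φ z)).comp (mfderiv 𝓘(ℝ, EZ) 𝓘(ℝ, EZ) Φ z)) := by
    intro f g hf hg h
    have hΦz : MDifferentiableAt 𝓘(ℝ, EZ) 𝓘(ℝ, EZ) Φ z := (Φ.contMDiff z).mdifferentiableAt (by simp)
    rw [← diff_comp ((hf _).mdifferentiableAt (by simp)) hΦz,
      ← diff_comp ((hg _).mdifferentiableAt (by simp)) hΦz]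
    exact h
  obtain ⟨h, α, hα, hh, hαs, hκ⟩ := hdecomp κ
  obtain ⟨k, β, hβ, hk, hβs, hκ'⟩ := hdecomp κ'
  have h1 := hb (A.contMDiff_comp_base hh) (A.contMDiff_comp_base hk) (A.bracket_base_base hw hh hk z)
  have h2 := hb (A.contMDiff_linear hα hαs) (A.contMDiff_comp_base hk)
    (A.bracket_linear_base hw hα hαs hk z)
  have h3 := hb (A.contMDiff_linear hβ hβs) (A.contMDiff_comp_base hh)
    (A.bracket_linear_base hw hβ hβs hh z)
  have h4 := hb (A.contMDiff_linear hα hαs) (A.contMDiff_linear hβ hβs)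
    (A.bracket_linear_linear hw hα hβ hαs hβs z)
  have h5 := (A.tensor_skew (Φ z) (diff 𝓘(ℝ, EZ) (h ∘ A.base) (Φ z))
    (diff 𝓘(ℝ, EZ) (A.linear hβ) (Φ z))).trans
    ((congrArg Neg.neg h3).trans (w.skew z _ _).symm)
  have h6 := bilin_add_add (A.tensor (Φ z)) (w.tensor z)
    (T := fun κ : Cotangent 𝓘(ℝ, EZ) (Φ z) => κ.comp (mfderiv 𝓘(ℝ, EZ) 𝓘(ℝ, EZ) Φ z))
    (fun _ _ => ContinuousLinearMap.add_comp _ _ _) h1 h5 h2 h4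
  rw [← hκ, ← hκ'] at h6
  exact h6

end Approximation

end Isomorphism

end SternbergWeinstein

end

open SternbergWeinstein in
theorem mainTheorem12
    {EG : Type*} [NormedAddCommGroup EG] [NormedSpace ℝ EG] [FiniteDimensional ℝ EG]
    {G : Type*} [Group G] [TopologicalSpace G] [ChartedSpace EG G] [LieGroup 𝓘(ℝ, EG) ∞ G]
    [T2Space G] [SecondCountableTopology G]
    {EP : Type*} [NormedAddCommGroup EP] [NormedSpace ℝ EP] [FiniteDimensional ℝ EP]
    {P : Type*} [TopologicalSpace P] [ChartedSpace EP P] [IsManifold 𝓘(ℝ, EP) ∞ P]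
    [T2Space P] [SecondCountableTopology P] [MulAction Gᵐᵒᵖ P]
    {EB : Type*} [NormedAddCommGroup EB] [NormedSpace ℝ EB] [FiniteDimensional ℝ EB]
    {B : Type*} [TopologicalSpace B] [ChartedSpace EB B] [IsManifold 𝓘(ℝ, EB) ∞ B]
    [T2Space B] [SecondCountableTopology B]
    (p : P → B) (hp : IsPrincipalBundle (EG := EG) (EP := EP) (EB := EB) G p)
    {EZ : Type*} [NormedAddCommGroup EZ] [NormedSpace ℝ EZ] [FiniteDimensional ℝ EZ]
    [ChartedSpace EZ (CotangentQuotient G EP P)]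
    [IsManifold 𝓘(ℝ, EZ) ∞ (CotangentQuotient G EP P)]
    [T2Space (CotangentQuotient G EP P)]
    (hρ : IsSmoothSubmersion (I := cotangentModel EP) (I' := 𝓘(ℝ, EZ)) (quotientMap G EP P)) :
    (∃! ϖ : PoissonStructure 𝓘(ℝ, EZ) (CotangentQuotient G EP P),
      IsPoissonMap (canonicalPoisson EP P) ϖ.tensor (quotientMap G EP P)) ∧
    ∀ ϖ : PoissonStructure 𝓘(ℝ, EZ) (CotangentQuotient G EP P),
      IsPoissonMap (canonicalPoisson EP P) ϖ.tensor (quotientMap G EP P) →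
      ∃ i : C^∞⟮𝓘(ℝ, EB), B; 𝓘(ℝ, EZ), CotangentQuotient G EP P⟯,
        (∀ y : P, i (p y) = quotientMap G EP P ⟨y, 0⟩) ∧
        IsLagrangianInLeaf 𝓘(ℝ, EB) B ϖ.tensor i ∧
        Nonempty (Approximation ϖ i) ∧
        ∀ A : Approximation ϖ i,
          ∃ Φ : CotangentQuotient G EP P ≃ₘ⟮𝓘(ℝ, EZ), 𝓘(ℝ, EZ)⟯ A.Total,
            (∀ a : CotangentBundle EP P,
              Φ (quotientMap G EP P a) =
                A.point (p a.proj) (mfderiv (cotangentModel EP) 𝓘(ℝ, EZ) (quotientMap G EP P)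
                  ⟨a.proj, 0⟩ (verticalVector a))) ∧
            IsPoissonMap ϖ.tensor A.tensor Φ := by
  exact ⟨existsUnique_quotientPoisson hp hρ, fun ϖ hϖ =>
    ⟨zeroSection hp hρ, zeroSection_apply hp hρ, isLagrangianInLeaf_zeroSection hρ hϖ,
      exists_approximation hϖ, fun A => ⟨A.linearizationDiffeomorph,
        A.linearizationDiffeomorph_quotientMap, A.isPoissonMap_linearizationDiffeomorph hϖ⟩⟩⟩
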